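/- Let $k$ be an algebraically closed field of characteristic zero (for instance $k=\mathbb C$), let $\epsilon>0$ be a real number, and let $Z$ be an irreducible smooth projective surface over $k$ with canonical divisor $K_Z$. Let $B$ be an effective $\mathbb R$-divisor on $Z$ such that $K_Z+B\equiv 0$ (that is, $(K_Z+B)\cdot C'=0$ for every integral curve $C'\subseteq Z$) and such that $(Z,B)$ is $\epsilon$-lc: for every resolution (proper birational morphism from a smooth variety) $\varphi:W\to Z$, writing $K_W+B_W=\varphi^*(K_Z+B)$ with $\varphi_*K_W=K_Z$, all coefficients of $B_W$ are at most $1-\epsilon$. Then every irreducible smooth projective curve $C\subseteq Z$ satisfies $$C^2\ \ge\ -\frac{2}{\epsilon}.$$ In particular, if $(Z,B)$ is $\tfrac16$-lc, then $C^2\ge -12$ for every such curve $C$. -/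

import Mathlib

open CategoryTheory AlgebraicGeometry

universe u

namespace LcSurface

noncomputable section

/-! ### Function fields, morphisms and rational functions -/

/-- The function field of an integral scheme over a field `k` is a `k`-algebra. -/
instance functionFieldAlgebra {k : Type u} [Field k] (V : Scheme.{u}) [IsIntegral V]
    [V.Over (Spec (.of k))] : Algebra k V.functionField :=
  RingHom.toAlgebra
    ((Scheme.ΓSpecIso (.of k)).inv ≫ (V ↘ Spec (.of k)).appTop ≫
      V.presheaf.germ ⊤ (genericPoint V) trivial).hom

/-- A dominant morphism of integral schemes maps the generic point to the generic point. -/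
theorem map_genericPoint_specializes {V W : Scheme.{u}} [IsIntegral V] [IsIntegral W]
    (φ : W ⟶ V) [IsDominant φ] : φ (genericPoint W) ⤳ genericPoint V := by
  have h : IsGenericPoint (φ (genericPoint W)) (closure (φ '' Set.univ)) :=
    (genericPoint_spec W).image φ.continuous
  rw [Set.image_univ, φ.denseRange.closure_range] at h
  exact h.specializes trivial

/-- The pullback `φ^* : K(V) → K(W)` of rational functions along a dominant morphism
`φ : W ⟶ V` of integral schemes. -/
def pullbackFun {V W : Scheme.{u}} [IsIntegral V] [IsIntegral W] (φ : W ⟶ V) [IsDominant φ] :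
    V.functionField →+* W.functionField :=
  (V.presheaf.stalkSpecializes (map_genericPoint_specializes φ) ≫
    φ.stalkMap (genericPoint W)).hom

attribute [local instance] MvPolynomial.gradedAlgebra

/-- A scheme over a field `k` is projective if it is isomorphic over `k` to a closed subscheme of
some projective space `ℙⁿ_k = Proj k[x₀, …, xₙ]`. -/
def IsProjective {k : Type u} [Field k] {V : Scheme.{u}} (s : V ⟶ Spec (.of k)) : Prop :=
  ∃ (n : ℕ) (j : V ⟶ Proj (MvPolynomial.homogeneousSubmodule (Fin (n + 1)) k)),
    IsClosedImmersion j ∧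
      j ≫ Proj.toSpecZero (MvPolynomial.homogeneousSubmodule (Fin (n + 1)) k) ≫
        Spec.map (CommRingCat.ofHom (algebraMap k
          (MvPolynomial.homogeneousSubmodule (Fin (n + 1)) k 0))) = s

/-! ### Canonical divisors -/

/-- Rational `n`-forms on an integral `k`-scheme: the `n`-th exterior power of the Kähler
differentials of the function field. -/
abbrev RationalForm (k : Type u) [Field k] (n : ℕ) (V : Scheme.{u}) [IsIntegral V]
    [V.Over (Spec (.of k))] : Type u :=
  ⋀[V.functionField]^n (Ω[V.functionField⁄k])

/-- Let `K / k` be a field extension of transcendence degree `n` and let `v : K → ℤ` be (off `0`)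
a discrete valuation with valuation ring `R`. The order along `v` of an `n`-form
`ω ∈ ⋀ⁿ Ω_{K/k}` is the largest `m` with `ω ∈ 𝔪ᵐ · L`, where `𝔪ᵐ = {h | v h ≥ m}` and
`L ⊆ ⋀ⁿ Ω_{K/k}` is the image of `⋀ⁿ Ω_{R/k}`, i.e. the `R`-module generated by all
`da₁ ∧ ⋯ ∧ daₙ` with `aᵢ ∈ R`. -/
def formOrder (k : Type u) {K : Type u} [Field k] [Field K] [Algebra k K] {n : ℕ} (v : K → ℤ)
    (ω : ⋀[K]^n (Ω[K⁄k])) : ℤ :=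
  sSup {m : ℤ | ω ∈ AddSubgroup.closure
    {η | ∃ (h : K) (a : Fin n → K), (h = 0 ∨ m ≤ v h) ∧ (∀ i, a i = 0 ∨ 0 ≤ v (a i)) ∧
      η = h • exteriorPower.ιMulti K n (fun i => KaehlerDifferential.D k K (a i))}}

/-- The canonical divisor `K_V = div ω` of a nonzero rational top-form `ω` on a normal variety `V`
of dimension `n`, as the function that gives the multiplicity at each prime divisor; prime divisors
are represented by their generic points, the points of codimension one. -/
def canonicalDivisor {k : Type u} [Field k] {n : ℕ} {V : Scheme.{u}} [IsIntegral V]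
    [IsLocallyNoetherian V] [V.Over (Spec (.of k))] (ω : RationalForm k n V) (P : V) : ℝ :=
  formOrder k (fun f : V.functionField => Scheme.ord f P) ω

/-! ### `ε`-lc pairs -/

/-- `∏ fᵢ ^ rᵢ` is a local equation at `x` of the `ℝ`-divisor `D` (given by its multiplicities):
`D = ∑ᵢ rᵢ div fᵢ` near `x`, that is, at all prime divisors through `x`. -/
def IsLocalEquation {V : Scheme.{u}} [IsIntegral V] [IsLocallyNoetherian V] (D : V → ℝ) (x : V)
    {m : ℕ} (r : Fin m → ℝ) (f : Fin m → V.functionField) : Prop :=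
  (∀ i, f i ≠ 0) ∧
    ∀ P : V, Order.coheight P = 1 → P ⤳ x → D P = ∑ i, r i * (Scheme.ord (f i) P : ℝ)

/-- `D` is `ℝ`-Cartier: it has a local equation at every point. -/
def IsRCartier {V : Scheme.{u}} [IsIntegral V] [IsLocallyNoetherian V] (D : V → ℝ) : Prop :=
  ∀ x : V, ∃ (m : ℕ) (r : Fin m → ℝ) (f : Fin m → V.functionField), IsLocalEquation D x r f

/-- A resolution of singularities of a variety `V` over a field `k`: a proper birational morphism
`φ : W ⟶ V` where `W` is a variety that is smooth over `k`. -/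
structure IsResolution (k : Type u) [Field k] {V W : Scheme.{u}} [IsIntegral V] [IsIntegral W]
    [V.Over (Spec (.of k))] (φ : W ⟶ V) [IsDominant φ] : Prop where
  proper : IsProper φ
  smooth : Smooth (φ ≫ V ↘ Spec (.of k))
  birational : Function.Bijective (pullbackFun φ)

/-- `(V, B)` is a pair: `V` is a normal variety of dimension `n`, `B` is an effective
`ℝ`-Weil divisor, and `K_V + B` is `ℝ`-Cartier. -/
structure IsPair (k : Type u) [Field k] (n : ℕ) (V : Scheme.{u}) [IsIntegral V]
    [IsLocallyNoetherian V] [V.Over (Spec (.of k))] (B : AlgebraicCycle V ℝ) : Prop where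
  normal : ∀ x : V, IsIntegrallyClosed (V.presheaf.stalk x)
  divisor : ∀ P : V, B P ≠ 0 → Order.coheight P = 1
  effective : ∀ P : V, 0 ≤ B P
  rCartier : ∀ ω : RationalForm k n V, ω ≠ 0 → IsRCartier (fun P => canonicalDivisor ω P + B P)

/-- `(V, B)` (with `V` of dimension `n`) is an `ε`-lc pair: for every resolution `φ : W ⟶ V`, if
`K_W + B_W = φ^*(K_V + B)`, then all coefficients of `B_W` are at most `1 - ε`.

Here `K_V = div ω` and `K_W = div (φ^* ω)` for the same rational form `ω`. The multiplicities at a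
prime divisor `E` of `W` are computed as follows, where `v_E f = ord_E (φ^* f)` for `f ∈ K(V)`: if
`∏ fᵢ ^ rᵢ` is a local equation of `K_V + B` at `φ(E)`, then that of `φ^*(K_V + B)` is
`∑ rᵢ v_E(fᵢ)`; and, as `φ^*` identifies `K(V)` with `K(W)`, that of `K_W` is the order of `ω`
along `v_E`. -/
structure IsEpsilonLc (k : Type u) [Field k] (n : ℕ) (V : Scheme.{u}) [IsIntegral V]
    [IsLocallyNoetherian V] [V.Over (Spec (.of k))] (B : AlgebraicCycle V ℝ) (ε : ℝ) : Prop
    extends IsPair k n V B where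
  coeff_le : ∀ (W : Scheme.{u}) [IsIntegral W] [IsLocallyNoetherian W] (φ : W ⟶ V) [IsDominant φ],
    IsResolution k φ →
    ∀ ω : RationalForm k n V, ω ≠ 0 →
    ∀ E : W, Order.coheight E = 1 →
    ∀ (m : ℕ) (r : Fin m → ℝ) (f : Fin m → V.functionField),
      IsLocalEquation (fun P => canonicalDivisor ω P + B P) (φ E) r f →
      ∑ i, r i * (Scheme.ord (pullbackFun φ (f i)) E : ℝ)
        - (formOrder k (fun g : V.functionField => Scheme.ord (pullbackFun φ g) E) ω : ℝ)
      ≤ 1 - ε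

/-! ### Intersection numbers on a smooth projective surface -/

open scoped Classical in
/-- The ideal in `𝒪_{V,p}` of the integral closed subscheme with generic point `P`
(the unit ideal if `p` does not lie on it). -/
def localIdeal {V : Scheme.{u}} (P p : V) : Ideal (V.presheaf.stalk p) :=
  if h : P ⤳ p then
    (IsLocalRing.maximalIdeal (V.presheaf.stalk P)).comap (V.presheaf.stalkSpecializes h).hom
  else ⊤

/-- The intersection number of two distinct integral curves `P ≠ C` (given by their generic points)
on a smooth projective surface over an algebraically closed field: the sum over all points `p` of
the local intersection multiplicities `length 𝒪_{V,p} / (I_P + I_C)`. -/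
def curveIntersection {V : Scheme.{u}} (P C : V) : ℤ :=
  ∑ᶠ p : V, ((Module.length (V.presheaf.stalk p)
    (V.presheaf.stalk p ⧸ (localIdeal P p ⊔ localIdeal C p))).toNat : ℤ)

open scoped Classical in
/-- The intersection number `D · C` of an `ℝ`-divisor `D` and an integral curve `C` on a smooth
projective surface over an algebraically closed field. Choose a rational function `f` with
`ord_C f = 1`; then `D' = D - (mult_C D) div f` is `ℝ`-linearly equivalent to `D` and does not
contain `C`, and `D · C = D' · C = ∑_{P ≠ C} (mult_P D') (P · C)`. The value does not depend on
`f`, because principal divisors have degree zero on `C`. (Such an `f` always exists; the value `0`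
in the last line is never used.) -/
def intersectionNumber {V : Scheme.{u}} [IsIntegral V] [IsLocallyNoetherian V]
    (D : V → ℝ) (C : V) : ℝ :=
  if h : ∃ f : V.functionField, Scheme.ord f C = 1 then
    ∑ᶠ (P : V) (_ : Order.coheight P = 1 ∧ P ≠ C),
      (D P - D C * (Scheme.ord h.choose P : ℝ)) * (curveIntersection P C : ℝ)
  else 0

/-- `D ≡ 0`: the divisor `D` on a smooth projective surface has intersection number zero with every
integral curve. -/
def IsNumericallyTrivial {V : Scheme.{u}} [IsIntegral V] [IsLocallyNoetherian V]
    (D : V → ℝ) : Prop :=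
  ∀ C : V, Order.coheight C = 1 → intersectionNumber D C = 0

open scoped Classical in
/-- The self-intersection number `C²` of an integral curve, given by its generic point: the
intersection number with `C` of the prime divisor `1 · C`. -/
def selfIntersection {V : Scheme.{u}} [IsIntegral V] [IsLocallyNoetherian V] (C : V) : ℝ :=
  intersectionNumber (fun P => if P = C then 1 else 0) C

end

end LcSurface

/-!
Write `K = div ω`, let `ξ` be the generic point of the curve `C`, `b` the multiplicity of `C` in
`B`, and `f` a rational function with `ord_C f = 1`. As `K + B ≡ 0`,

  `(1 - b) C² = (K + B) · C + (1 - b) C² = (K + C) · C + (B - b C) · C ≥ (K + C) · C`,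

because the components of `B - b C` meet `C` nonnegatively
(`neg_two_le_intersectionNumber_add`). The identity of `Z` is a resolution, so `b ≤ 1 - ε`
(`IsEpsilonLc.apply_le`), and the bound follows from `(K + C) · C ≥ -2`.

The last inequality is one half of the adjunction formula `(K + C) · C = 2 g - 2`, together with
`g ≥ 0`. It is proved without cohomology. If `κ` is the order of `ω` along `C`, then
`ω / f ^ (κ + 1)` has a simple pole along `C`, and its residue is a rational one-form on `C`. The
dual vector field `δ`, a derivation of the function field of `C`, is
`h ↦ f ^ κ {f, h}` restricted to `C`, where `df ∧ dh = {f, h} ω`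
(`exists_derivation_functionField`).

* Locally at a closed point `q` of `C` there are coordinates `c, s` of the surface such that `c = 0`
  is the curve (`exists_adapted_coordinates`). The local ring of the surface is factorial, so the
  order of `δ s` at `q` is minus the local contribution of `q` to the intersection number of `C`
  with `div ω - (κ + 1) div f` (`finite_and_ord_eq_finsum`, `exists_ordOf_derivation_eq`). Hence
  `(K + C) · C = -deg δ` (`neg_two_le_finsum_adjunctionCoeff`).

* A nonzero vector field on a smooth projective curve has degree at most two
  (`IsPlaceFamily.sum_ordOf_derivation_le_two`). For a space `V` of functions of dimension `n` whose
  poles are bounded by a divisor of degree `D`, the Wronskian of `V` with respect to `δ` is nonzero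
  in characteristic zero, it vanishes to order `n (n - 1) / 2 * deg δ` in total, up to poles of
  total order `n D`, and its divisor has degree zero. So `(n - 1) deg δ ≤ 2 D`, and there are
  spaces with `D / n → 1`.

The degree of a principal divisor on a curve is zero by the fundamental identity for the extension
`L / k(x)` of its function field; the valuative criterion of properness identifies the closed points
of the curve with the places of `L` (`isPlaceFamily_closedPointValuation`).
-/

namespace LcSurface

/-! ### Wronskians -/

/-- The Wronskian matrix `(δⁱ fⱼ)` of a finite family of elements of a differential field. -/
def wronskianMatrix {k L : Type*} [Field k] [Field L] [Algebra k L] (δ : Derivation k L L) {n : ℕ}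
    (f : Fin n → L) : Matrix (Fin n) (Fin n) L :=
  Matrix.of fun i j => (⇑δ)^[i] (f j)

/-- If the constants of `δ` are the elements of `k`, the Wronskian detects linear independence
over `k`. -/
theorem wronskianMatrix_det_ne_zero {k L : Type*} [Field k] [Field L] [Algebra k L]
    (δ : Derivation k L L) (hδ : ∀ x, δ x = 0 → ∃ c : k, algebraMap k L c = x) {n : ℕ}
    (f : Fin n → L) (hf : LinearIndependent k f) : (wronskianMatrix δ f).det ≠ 0 := by
  induction n with
  | zero => simp
  | succ n ih =>
    intro h0
    obtain ⟨v, hv0, hv⟩ := Matrix.exists_mulVec_eq_zero_iff.mpr h0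
    have hM := ih (fun j => f j.castSucc) (hf.comp _ (Fin.castSucc_injective n))
    have key : ∀ w : Fin n → L, (∀ i : Fin n, ∑ j, (⇑δ)^[i] (f j.castSucc) * w j = 0) → w = 0 := by
      intro w hw
      by_contra hne
      exact hM (Matrix.exists_mulVec_eq_zero_iff.mp ⟨w, hne, funext hw⟩)
    have hrow : ∀ i : Fin (n + 1), ∑ j, (⇑δ)^[i] (f j) * v j = 0 := fun i => congrFun hv i
    have hlast : v (Fin.last n) ≠ 0 := by
      intro hl
      refine hv0 (funext fun j => ?_)
      have := key (fun j => v j.castSucc) fun i => by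
        simpa [Fin.sum_univ_castSucc, hl] using hrow i.castSucc
      refine Fin.lastCases hl (fun j => congrFun this j) j
    -- After normalising the last coefficient of the relation to be `1`, differentiating the relation
    -- gives a shorter one, so that all its coefficients are constants.
    set a : Fin (n + 1) → L := fun j => v j / v (Fin.last n) with ha
    have ha1 : a (Fin.last n) = 1 := div_self hlast
    have hrow' : ∀ i : ℕ, i < n + 1 → ∑ j, (⇑δ)^[i] (f j) * a j = 0 := fun i hi => by
      have := hrow ⟨i, hi⟩
      simp only [ha, mul_div_assoc', ← Finset.sum_div] at this ⊢
      rw [this, zero_div]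
    have hda : (fun j : Fin n => δ (a j.castSucc)) = 0 := key _ fun i => by
      have h1 := congrArg δ (hrow' i (by omega))
      have h2 := hrow' (i + 1) (by omega)
      simp only [map_sum, Derivation.leibniz, smul_eq_mul, map_zero, Finset.sum_add_distrib,
        ← Function.iterate_succ_apply' (⇑δ)] at h1
      have h3 : ∑ j, a j * (⇑δ)^[(i : ℕ).succ] (f j) = 0 := by
        rw [← h2]; exact Finset.sum_congr rfl fun j _ => mul_comm _ _
      rw [h3, add_zero, Fin.sum_univ_castSucc, ha1] at h1
      simpa using h1
    have hc : ∀ j, ∃ c : k, algebraMap k L c = a j := fun j => by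
      refine Fin.lastCases ⟨1, by simp [ha1]⟩ (fun j => hδ _ (congrFun hda j)) j
    choose c hc using hc
    have h0 := Fintype.linearIndependent_iff.mp hf c (by
      have := hrow' 0 (by omega)
      simpa [Algebra.smul_def, hc, mul_comm] using this) (Fin.last n)
    have := hc (Fin.last n)
    rw [h0, ha1] at this
    simp at this

/-- The lower triangular matrix that expresses the iterates `δⁱ (g / u)` through the iterates
`(ε⁻¹ δ)ˡ g`; see `iterate_derivation_eq_sum`. -/
def iterateCoeff {k L : Type*} [Field k] [Field L] [Algebra k L] (δ : Derivation k L L)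
    (ε u : L) : ℕ → ℕ → L
  | 0, 0 => u⁻¹
  | 0, _ + 1 => 0
  | i + 1, 0 => δ (iterateCoeff δ ε u i 0)
  | i + 1, l + 1 => δ (iterateCoeff δ ε u i (l + 1)) + ε * iterateCoeff δ ε u i l

section iterateCoeff

variable {k L : Type*} [Field k] [Field L] [Algebra k L] (δ : Derivation k L L) (ε u : L)

theorem iterateCoeff_eq_zero {i l : ℕ} (h : i < l) : iterateCoeff δ ε u i l = 0 := by
  induction i generalizing l with
  | zero => cases l with
    | zero => omega
    | succ l => simp [iterateCoeff]
  | succ i ih => cases l with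
    | zero => omega
    | succ l => simp [iterateCoeff, ih (show i < l + 1 by omega), ih (show i < l by omega)]

theorem iterateCoeff_self (i : ℕ) : iterateCoeff δ ε u i i = ε ^ i * u⁻¹ := by
  induction i with
  | zero => simp [iterateCoeff]
  | succ i ih =>
    simp [iterateCoeff, iterateCoeff_eq_zero δ ε u (Nat.lt_succ_self i), ih]
    ring

theorem iterate_derivation_eq_sum (hε : ε ≠ 0) (g : L) (i N : ℕ) (hi : i < N) :
    (⇑δ)^[i] (u⁻¹ * g) =
      ∑ l ∈ Finset.range N, iterateCoeff δ ε u i l * (fun x => ε⁻¹ * δ x)^[l] g := by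
  induction i with
  | zero =>
    rw [Finset.sum_eq_single_of_mem 0 (by simp; omega)]
    · simp [iterateCoeff]
    · intro l _ hl
      rw [iterateCoeff_eq_zero _ _ _ (by omega), zero_mul]
  | succ i ih =>
    obtain ⟨N, rfl⟩ : ∃ M, N = M + 1 := ⟨N - 1, by omega⟩
    set G : ℕ → L := fun l => (fun x => ε⁻¹ * δ x)^[l] g with hG
    have hGs : ∀ l, δ (G l) = ε * G (l + 1) := fun l => by
      simp only [hG, Function.iterate_succ_apply']
      field_simp
    rw [Function.iterate_succ_apply', ih (by omega), map_sum]
    change ∑ l ∈ Finset.range (N + 1), δ (iterateCoeff δ ε u i l * G l) =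
      ∑ l ∈ Finset.range (N + 1), iterateCoeff δ ε u (i + 1) l * G l
    simp only [Derivation.leibniz, smul_eq_mul, hGs, Finset.sum_add_distrib]
    rw [Finset.sum_range_succ (fun l => iterateCoeff δ ε u i l * (ε * G (l + 1))),
      Finset.sum_range_succ' (fun l => G l * δ (iterateCoeff δ ε u i l)),
      Finset.sum_range_succ' (fun l => iterateCoeff δ ε u (i + 1) l * G l),
      iterateCoeff_eq_zero δ ε u (show i < N by omega)]
    simp only [iterateCoeff, add_mul, Finset.sum_add_distrib, mul_comm (G _), zero_mul,
      mul_left_comm _ ε, mul_assoc]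
    ring

end iterateCoeff

/-- Local estimate for the Wronskian: if `u fⱼ` is integral for all `j` and `ε⁻¹ δ` preserves the
valuation ring of `v`, then the Wronskian of `f` is an integral multiple of
`u⁻ⁿ ε^(0 + 1 + ⋯ + (n - 1))`. -/
theorem valuation_wronskianMatrix_det_le {k L Γ : Type*} [Field k] [Field L] [Algebra k L]
    [LinearOrderedCommGroupWithZero Γ] (v : Valuation L Γ)
    (δ : Derivation k L L) {ε u : L} (hε : ε ≠ 0) (hu : u ≠ 0)
    (hδ : ∀ x, v x ≤ 1 → v (δ x) ≤ v ε) {n : ℕ} (f : Fin n → L) (hf : ∀ j, v (u * f j) ≤ 1) :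
    v (wronskianMatrix δ f).det ≤ v ε ^ (∑ i : Fin n, (i : ℕ)) * (v u)⁻¹ ^ n := by
  set T : Matrix (Fin n) (Fin n) L := Matrix.of fun i l => iterateCoeff δ ε u i l with hT
  set G : Matrix (Fin n) (Fin n) L :=
    Matrix.of fun l j => (fun x => ε⁻¹ * δ x)^[l] (u * f j) with hG
  have hmul : wronskianMatrix δ f = T * G := by
    ext i j
    rw [Matrix.mul_apply]
    have h := iterate_derivation_eq_sum δ ε u hε (u * f j) i n i.2
    rw [inv_mul_cancel_left₀ hu] at h
    simpa [wronskianMatrix, hT, hG, Finset.sum_range] using h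
  have hint : ∀ l : ℕ, ∀ j, v ((fun x => ε⁻¹ * δ x)^[l] (u * f j)) ≤ 1 := by
    intro l j
    induction l with
    | zero => simpa using hf j
    | succ l ih =>
      rw [Function.iterate_succ_apply', map_mul, map_inv₀, inv_mul_le_iff₀, mul_one]
      · exact hδ _ ih
      · exact zero_lt_iff.mpr ((map_ne_zero v).mpr hε)
  have hGdet : v G.det ≤ 1 := by
    rw [Matrix.det_apply]
    refine v.map_sum_le fun σ _ => ?_
    have hp : v (∏ i, G (σ i) i) ≤ 1 := by
      rw [map_prod]
      exact Finset.prod_le_one' fun i _ => hint _ _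
    rcases Int.units_eq_one_or (Equiv.Perm.sign σ) with h | h <;>
      simp only [h, one_smul, hp, Units.neg_smul, Valuation.map_neg]
  have hTdet : T.det = ε ^ (∑ i : Fin n, (i : ℕ)) * u⁻¹ ^ n := by
    rw [Matrix.det_of_isLowerTriangular]
    · simp only [hT, Matrix.of_apply, iterateCoeff_self, Finset.prod_mul_distrib,
        Finset.prod_pow_eq_pow_sum]
      simp
    · intro i j hij
      exact iterateCoeff_eq_zero _ _ _ hij
  rw [hmul, Matrix.det_mul, map_mul, hTdet, map_mul, map_pow, map_pow, map_inv₀]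
  exact mul_le_of_le_one_right' hGdet

/-! ### Places and the degree of a principal divisor -/

open WithZero IsDedekindDomain in
/-- A discrete valuation ring is a maximal subring, so that an inclusion of valuation rings is an
equality of normalised valuations. -/
theorem eq_of_le_one_of_exists_exp {L : Type*} [Field L] {v w : Valuation L ℤᵐ⁰}
    (hv : ∃ s, v s = exp (-1 : ℤ)) (hw : ∃ s, w s = exp (-1 : ℤ))
    (h : ∀ x, v x ≤ 1 → w x ≤ 1) : v = w := by
  obtain ⟨s, hs⟩ := hv
  obtain ⟨s', hs'⟩ := hw
  have hs0 : s ≠ 0 := fun h =>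
    exp_ne_zero (a := (-1 : ℤ)) (by rw [← hs, h, map_zero])
  have hu : ∀ x, v x = 1 → w x = 1 := fun x hx => by
    have hx0 : x ≠ 0 := fun h => by simp [h] at hx
    refine le_antisymm (h x hx.le) ?_
    have := h x⁻¹ (by simp [hx])
    rwa [map_inv₀, inv_le_one₀] at this
    exact zero_lt_iff.mpr ((map_ne_zero w).mpr hx0)
  have hpow : ∀ x, x ≠ 0 → ∃ n : ℤ, v x = v s ^ n ∧ w x = w s ^ n := fun x hx => by
    refine ⟨-log (v x), ?_, ?_⟩
    · rw [hs, ← exp_zsmul]; simp [exp_log ((map_ne_zero v).mpr hx)]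
    · have h1 := hu (x * s ^ (log (v x))) (by
        rw [map_mul, map_zpow₀, hs, ← exp_zsmul]
        nth_rewrite 1 [← exp_log ((map_ne_zero v).mpr hx)]
        rw [← exp_add]; simp)
      rw [map_mul, map_zpow₀] at h1
      rw [zpow_neg]
      exact eq_inv_of_mul_eq_one_left h1
  have hws0 : w s ≠ 0 := (map_ne_zero w).mpr hs0
  have hws : w s = exp (-1 : ℤ) := by
    obtain ⟨n, -, hn⟩ := hpow s' (fun h => exp_ne_zero (a := (-1 : ℤ)) (by rw [← hs', h, map_zero]))
    have hle : w s ≤ 1 := h s (by rw [hs]; exact_mod_cast (exp_le_exp.mpr (by omega : (-1:ℤ) ≤ 0)))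
    have hlog : log (w s) ≤ 0 := by
      rw [log_le_iff_le_exp hws0]; simpa using hle
    have h2 := congrArg log hn
    rw [hs', log_exp, log_zpow, smul_eq_mul] at h2
    have h3 : log (w s) = -1 := by
      have : IsUnit (log (w s)) := IsUnit.of_mul_eq_one (-n) (by linarith)
      rcases Int.isUnit_iff.mp this with h | h <;> omega
    rw [← h3, exp_log hws0]
  ext x
  by_cases hx : x = 0
  · simp [hx]
  · obtain ⟨n, h1, h2⟩ := hpow x hx
    rw [h1, h2, hs, hws]

/-- Over an algebraically closed field `k`, all inertia degrees are one, so that the fundamental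
identity counts the zeros of `x` with multiplicity. -/
theorem sum_multiplicity_eq_finrank {k R : Type u} {B : Type*} [Field k] [IsAlgClosed k] [CommRing R]
    [IsDedekindDomain R] [Algebra k R] [CommRing B] [IsDedekindDomain B] [Algebra R B]
    [Module.Finite R B] [Module.IsTorsionFree R B] (x : R) (hx0 : algebraMap R B x ≠ 0)
    (hx : (Ideal.span {x}).IsMaximal)
    (hk : Function.Surjective (algebraMap k (R ⧸ Ideal.span {x})))
    [Fintype ((Ideal.span {x}).primesOver B)] :
    ∑ q : (Ideal.span {x}).primesOver B, multiplicity q.1 (Ideal.span {algebraMap R B x}) =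
      Module.finrank R B := by
  rw [← Ideal.sum_ramification_inertia_eq_finrank (Ideal.span {x}) B]
  refine Finset.sum_congr rfl fun q _ => ?_
  have hqp : q.1.IsPrime := q.2.1
  have hlo : q.1.LiesOver (Ideal.span {x}) := q.2.2
  have hmap : Ideal.map (algebraMap R B) (Ideal.span {x}) = Ideal.span {algebraMap R B x} := by
    rw [Ideal.map_span, Set.image_singleton]
  have hne : Ideal.map (algebraMap R B) (Ideal.span {x}) ≠ ⊥ := by
    rw [hmap, Ne, Ideal.span_singleton_eq_bot]; exact hx0
  have hqm : q.1.IsMaximal := Ideal.IsMaximal.of_liesOver_isMaximal q.1 (Ideal.span {x})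
  rw [Ideal.IsDedekindDomain.ramificationIdx_eq_multiplicity (Ideal.span {x}) q.1 hne, hmap,
    Ideal.inertiaDeg_eq_of_isMaximal (Ideal.span {x}) q.1]
  have : Nontrivial (R ⧸ Ideal.span {x}) := Ideal.Quotient.nontrivial_iff.mpr hx.ne_top
  let e : k ≃+* R ⧸ Ideal.span {x} := RingEquiv.ofBijective (algebraMap k (R ⧸ Ideal.span {x}))
    ⟨(algebraMap k (R ⧸ Ideal.span {x})).injective, hk⟩
  let : Field (R ⧸ Ideal.span {x}) := Ideal.Quotient.field _
  let : Field (B ⧸ q.1) := Ideal.Quotient.field _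
  have hac : IsAlgClosed (R ⧸ Ideal.span {x}) := IsAlgClosed.of_ringEquiv k _ e
  have hsurj : Function.Surjective (algebraMap (R ⧸ Ideal.span {x}) (B ⧸ q.1)) :=
    IsAlgClosed.algebraMap_bijective_of_isIntegral.2
  have h1 : Module.finrank (R ⧸ Ideal.span {x}) (B ⧸ q.1) = 1 := by
    rw [finrank_eq_one_iff_of_nonzero' (1 : B ⧸ q.1) one_ne_zero]
    intro w
    obtain ⟨c, rfl⟩ := hsurj w
    exact ⟨c, by rw [Algebra.smul_def, mul_one]⟩
  rw [h1, mul_one]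

/-- The order of `x` with respect to a discrete valuation in multiplicative notation; `0` for
`x = 0`. -/
noncomputable def ordOf {L : Type*} [Field L] (v : Valuation L (WithZero (Multiplicative ℤ)))
    (x : L) : ℤ :=
  -WithZero.log (v x)

section ordOf

open WithZero

variable {L : Type*} [Field L] (v : Valuation L ℤᵐ⁰)

theorem ordOf_mul {x y : L} (hx : x ≠ 0) (hy : y ≠ 0) :
    ordOf v (x * y) = ordOf v x + ordOf v y := by
  rw [ordOf, map_mul, log_mul ((map_ne_zero v).mpr hx) ((map_ne_zero v).mpr hy), ordOf, ordOf]
  ring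

theorem ordOf_pow (x : L) (n : ℕ) : ordOf v (x ^ n) = n * ordOf v x := by
  simp [ordOf, log_pow]

theorem ordOf_inv (x : L) : ordOf v x⁻¹ = -ordOf v x := by
  simp [ordOf, log_inv]

theorem valuation_eq_exp_neg_ordOf {x : L} (hx : x ≠ 0) : v x = exp (-ordOf v x) := by
  simp [ordOf, exp_log ((map_ne_zero v).mpr hx)]

theorem ordOf_le_ordOf_iff {x y : L} (hx : x ≠ 0) (hy : y ≠ 0) :
    ordOf v x ≤ ordOf v y ↔ v y ≤ v x := by
  rw [valuation_eq_exp_neg_ordOf v hx, valuation_eq_exp_neg_ordOf v hy, exp_le_exp]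
  omega

theorem ordOf_pos_iff {x : L} (hx : x ≠ 0) : 0 < ordOf v x ↔ v x < 1 := by
  rw [valuation_eq_exp_neg_ordOf v hx, ← exp_zero, exp_lt_exp]
  omega

theorem ordOf_nonneg_iff {x : L} (hx : x ≠ 0) : 0 ≤ ordOf v x ↔ v x ≤ 1 := by
  rw [valuation_eq_exp_neg_ordOf v hx, ← exp_zero, exp_le_exp]
  omega

theorem ordOf_eq_zero_iff {x : L} (hx : x ≠ 0) : ordOf v x = 0 ↔ v x = 1 := by
  rw [valuation_eq_exp_neg_ordOf v hx, ← exp_zero, exp_inj]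
  omega

end ordOf

/-- The family `v` consists of all places of the field extension `L / k`: normalised discrete
valuations that are trivial on `k`, and each valuation ring `≠ L` of `L / k` is the valuation ring of
exactly one member of the family. -/
structure IsPlaceFamily (k : Type*) {L ι : Type*} [Field k] [Field L] [Algebra k L]
    (v : ι → Valuation L (WithZero (Multiplicative ℤ))) : Prop where
  le_one : ∀ i (c : k), v i (algebraMap k L c) ≤ 1
  exists_uniformizer : ∀ i, ∃ s, v i s = WithZero.exp (-1 : ℤ)
  injective : Function.Injective v
  exhaustive : ∀ V : ValuationSubring L, (∀ c : k, algebraMap k L c ∈ V) → V ≠ ⊤ →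
    ∃ i, (v i).valuationSubring = V

namespace IsPlaceFamily

open WithZero IsDedekindDomain

variable {k L : Type u} {ι : Type*} [Field k] [Field L] [Algebra k L] {v : ι → Valuation L ℤᵐ⁰}

theorem exists_eq (hv : IsPlaceFamily k v) (w : Valuation L ℤᵐ⁰)
    (hw : ∃ s, w s = exp (-1 : ℤ)) (hk : ∀ c : k, w (algebraMap k L c) ≤ 1) : ∃ i, v i = w := by
  obtain ⟨i, hi⟩ := hv.exhaustive w.valuationSubring hk (fun h => by
    obtain ⟨s, hs⟩ := hw
    have : s⁻¹ ∈ w.valuationSubring := h ▸ ValuationSubring.mem_top _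
    rw [Valuation.mem_valuationSubring_iff, map_inv₀, hs, ← exp_neg, ← exp_zero, exp_le_exp] at this
    omega)
  refine ⟨i, eq_of_le_one_of_exists_exp (hv.exists_uniformizer i) hw fun x hx => ?_⟩
  have : x ∈ (v i).valuationSubring := hx
  rwa [hi] at this

theorem algebraMap_eq_one (hv : IsPlaceFamily k v) (i : ι) {c : k} (hc : c ≠ 0) :
    v i (algebraMap k L c) = 1 := by
  refine le_antisymm (hv.le_one i c) ?_
  have := hv.le_one i c⁻¹
  rwa [map_inv₀, map_inv₀, inv_le_one₀] at this
  exact zero_lt_iff.mpr ((map_ne_zero _).mpr ((map_ne_zero _).mpr hc))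

/-- The zeros of `x` among the places correspond to the primes over `x` in the integral closure `B`
of `R = k[x]`. -/
theorem sum_ordOf_eq_finrank_of_adjoin [IsAlgClosed k] (hv : IsPlaceFamily k v) {R : Type u}
    {B : Type*} [CommRing R] [IsDedekindDomain R] [Algebra k R] [CommRing B] [IsDedekindDomain B]
    [Algebra R B]
    [Module.Finite R B] [Module.IsTorsionFree R B] [Algebra R L] [Algebra B L] [IsFractionRing B L]
    [IsScalarTower R B L] [IsScalarTower k R L] (x : R) (hx0 : algebraMap R B x ≠ 0)
    (hgen : Algebra.adjoin k {x} = ⊤) (hx : (Ideal.span {x}).IsMaximal)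
    (hk : Function.Surjective (algebraMap k (R ⧸ Ideal.span {x}))) :
    ∃ S : Finset ι, (∀ i, i ∈ S ↔ v i (algebraMap R L x) < 1) ∧
      ∑ i ∈ S, ordOf (v i) (algebraMap R L x) = Module.finrank R B := by
  classical
  have : Fintype ((Ideal.span {x}).primesOver B) := Fintype.ofFinite _
  -- The places given by the primes of `B` over `x` are zeros of `x`.
  have hxq : ∀ q : (Ideal.span {x}).primesOver B, algebraMap R B x ∈ q.1 := fun q => by
    have hlo : q.1.LiesOver (Ideal.span {x}) := q.2.2
    have h1 : x ∈ q.1.under R := hlo.over ▸ Ideal.mem_span_singleton_self x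
    exact h1
  set ht : (Ideal.span {x}).primesOver B → HeightOneSpectrum B := fun q =>
    ⟨q.1, q.2.1, fun h => hx0 (by simpa [h] using hxq q)⟩ with hht
  have hplace : ∀ q, ∃ i, v i = (ht q).valuation L := fun q => by
    refine hv.exists_eq _ ((ht q).valuation_exists_uniformizer L) fun c => ?_
    rw [IsScalarTower.algebraMap_apply k R L, IsScalarTower.algebraMap_apply R B L]
    exact (ht q).valuation_le_one _
  choose pl hpl using hplace
  have hlt : ∀ q, v (pl q) (algebraMap R L x) < 1 := fun q => by
    rw [hpl, IsScalarTower.algebraMap_apply R B L]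
    exact ((ht q).valuation_lt_one_iff_mem (K := L) (algebraMap R B x)).mpr (hxq q)
  have hinj : Function.Injective pl := fun q q' h => by
    have h1 : (ht q).valuation L = (ht q').valuation L := by rw [← hpl, ← hpl, h]
    refine Subtype.ext (Ideal.ext fun b => ?_)
    have h2 := (ht q).valuation_lt_one_iff_mem (K := L) b
    rw [h1, (ht q').valuation_lt_one_iff_mem] at h2
    exact h2.symm
  -- Conversely, a zero `i` of `x` is nonnegative on `B`; it comes from its center `Q` on `B`.
  have hsurj : ∀ i, v i (algebraMap R L x) < 1 → ∃ q, pl q = i := fun i hi => by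
    have hRi : ∀ r : R, v i (algebraMap R L r) ≤ 1 := fun r => by
      have hr : r ∈ Algebra.adjoin k {x} := hgen ▸ Algebra.mem_top
      induction hr using Algebra.adjoin_induction with
      | mem y hy => rw [Set.mem_singleton_iff.mp hy]; exact hi.le
      | algebraMap c => rw [← IsScalarTower.algebraMap_apply]; exact hv.le_one i c
      | add y z _ _ hy hz => rw [map_add]; exact (v i).map_add_le hy hz
      | mul y z _ _ hy hz => rw [map_mul, map_mul]; exact mul_le_one' hy hz
    have hBi : ∀ b : B, v i (algebraMap B L b) ≤ 1 := fun b => by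
      have hb : IsIntegral R b := Algebra.IsIntegral.isIntegral b
      obtain ⟨p, hp, hpe⟩ := hb.algebraMap (B := L)
      exact (Valuation.integer.integers (v i)).mem_of_integral (x := algebraMap B L b)
        ⟨p.map ((algebraMap R L).codRestrict (v i).integer hRi), hp.map _, by
          rw [Polynomial.eval₂_map]; exact hpe⟩
    let Q : Ideal B :=
      { carrier := {b | v i (algebraMap B L b) < 1}
        add_mem' := fun {a b} ha hb => by
          simp only [Set.mem_ofPred_eq, map_add] at ha hb ⊢
          exact (v i).map_add_lt ha hb
        zero_mem' := by simp
        smul_mem' := fun c b hb => by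
          simp only [Set.mem_ofPred_eq, smul_eq_mul, map_mul] at hb ⊢
          exact lt_of_le_of_lt (mul_le_of_le_one_left' (hBi c)) hb }
    have hQmem : ∀ b : B, b ∈ Q ↔ v i (algebraMap B L b) < 1 := fun b => Iff.rfl
    have hQp : Q.IsPrime := by
      refine ⟨fun h => ?_, fun {a b} hab => ?_⟩
      · have := (hQmem 1).mp (h ▸ Submodule.mem_top)
        simp at this
      · by_contra! hcon
        rw [hQmem, hQmem, not_lt, not_lt] at hcon
        rw [hQmem, map_mul, map_mul] at hab
        exact absurd hab (not_lt.mpr (one_le_mul hcon.1 hcon.2))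
    have hxQ : algebraMap R B x ∈ Q := by
      rw [hQmem, ← IsScalarTower.algebraMap_apply]; exact hi
    have hlo : Q.LiesOver (Ideal.span {x}) := ⟨by
      refine hx.eq_of_le (Ideal.IsPrime.ne_top (Ideal.IsPrime.under R Q)) ?_
      rw [Ideal.span_singleton_le_iff_mem]
      exact hxQ⟩
    refine ⟨⟨Q, hQp, hlo⟩, hv.injective ?_⟩
    rw [hpl]
    refine eq_of_le_one_of_exists_exp ((ht _).valuation_exists_uniformizer L)
      (hv.exists_uniformizer i) fun y hy => ?_
    obtain ⟨n, d, hnd⟩ := (ht _).exists_primeCompl_mul_eq_of_integer y hy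
    have hd : v i (algebraMap B L d) = 1 :=
      le_antisymm (hBi d) (not_lt.mp fun h => d.2 ((hQmem _).mpr h))
    have h1 := congrArg (v i) hnd
    rw [map_mul, hd, mul_one] at h1
    rw [h1]
    exact hBi n
  refine ⟨Finset.univ.image pl, fun i => ⟨?_, fun hi => ?_⟩, ?_⟩
  · intro h
    obtain ⟨q, -, rfl⟩ := Finset.mem_image.mp h
    exact hlt q
  · obtain ⟨q, rfl⟩ := hsurj i hi
    exact Finset.mem_image_of_mem _ (Finset.mem_univ q)
  · rw [Finset.sum_image fun q _ q' _ h => hinj h, ← sum_multiplicity_eq_finrank x hx0 hx hk,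
      Nat.cast_sum]
    refine Finset.sum_congr rfl fun q _ => ?_
    rw [ordOf, hpl, IsScalarTower.algebraMap_apply R B L, HeightOneSpectrum.valuation_of_algebraMap,
      HeightOneSpectrum.intValuation_eq_exp_neg_multiplicity _ hx0]
    simp [hht]

open scoped IntermediateField.algebraAdjoinAdjoin IntermediateField in
/-- A nonconstant function `x` has `[L : k(x)]` zeros, counted with multiplicity. -/
theorem sum_ordOf_eq_finrank [IsAlgClosed k] [CharZero k] (hv : IsPlaceFamily k v) {x : L}
    (hx : Transcendental k x) [FiniteDimensional k⟮x⟯ L] :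
    ∃ S : Finset ι, (∀ i, i ∈ S ↔ v i x < 1) ∧
      ∑ i ∈ S, ordOf (v i) x = Module.finrank k⟮x⟯ L := by
  let R := Algebra.adjoin k {x}
  let e := Polynomial.algEquivOfTranscendental k x hx
  have : IsPrincipalIdealRing R := IsPrincipalIdealRing.of_surjective e.toRingEquiv.toRingHom
    e.surjective
  let B := integralClosure R L
  have : CharZero k⟮x⟯ := charZero_of_injective_algebraMap (algebraMap k k⟮x⟯).injective
  have : IsDedekindDomain B := IsIntegralClosure.isDedekindDomain R k⟮x⟯ L B
  have : Module.Finite R B := IsIntegralClosure.finite R k⟮x⟯ L B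
  have : IsFractionRing B L := IsIntegralClosure.isFractionRing_of_finite_extension R k⟮x⟯ L B
  have hBinj : Function.Injective (algebraMap R B) := fun a b h =>
    Subtype.ext (congrArg (fun z : B => (z : L)) h)
  have : FaithfulSMul R B := (faithfulSMul_iff_algebraMap_injective R B).mpr hBinj
  let x' : R := ⟨x, Algebra.self_mem_adjoin_singleton k x⟩
  have hx0 : x ≠ 0 := fun h => hx (h ▸ isAlgebraic_zero)
  have hxB : algebraMap R B x' ≠ 0 := fun h => hx0 (congrArg (fun z : B => (z : L)) h)
  have heX : e Polynomial.X = x' := Polynomial.algEquivOfTranscendental_apply_X k x hx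
  have hk : Function.Surjective (algebraMap k (R ⧸ Ideal.span {x'})) := fun y => by
    obtain ⟨r, rfl⟩ := Ideal.Quotient.mk_surjective y
    obtain ⟨p, rfl⟩ := e.surjective r
    refine ⟨p.coeff 0, ?_⟩
    conv_rhs => rw [← Polynomial.divX_mul_X_add p]
    rw [map_add, map_mul, heX, map_add, map_mul,
      Ideal.Quotient.eq_zero_iff_mem.mpr (Ideal.mem_span_singleton_self x'), mul_zero, zero_add,
      Polynomial.C_eq_algebraMap, AlgEquiv.commutes]
    rfl
  have hnu : ¬ IsUnit x' := by
    rw [← heX, MulEquiv.isUnit_map]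
    exact Polynomial.not_isUnit_X
  have hmax : (Ideal.span {x'}).IsMaximal := by
    have : Nontrivial (R ⧸ Ideal.span {x'}) := Ideal.Quotient.nontrivial_iff.mpr
      (by rwa [Ne, Ideal.span_singleton_eq_top])
    apply Ideal.Quotient.maximal_of_isField
    exact MulEquiv.isField (Field.toIsField k) (RingEquiv.ofBijective
      (algebraMap k (R ⧸ Ideal.span {x'})) ⟨(algebraMap k _).injective, hk⟩).symm.toMulEquiv
  have hgen : Algebra.adjoin k {x'} = ⊤ := by
    rw [eq_top_iff]
    rintro r -
    obtain ⟨p, rfl⟩ := e.surjective r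
    rw [Polynomial.algEquivOfTranscendental_apply]
    exact Polynomial.aeval_mem_adjoin_singleton k x'
  obtain ⟨S, hS, hsum⟩ := hv.sum_ordOf_eq_finrank_of_adjoin (B := B) x' hxB hgen hmax hk
  refine ⟨S, hS, ?_⟩
  rw [IsFractionRing.finrank_eq R k⟮x⟯ B L]
  exact hsum

end IsPlaceFamily

open scoped IntermediateField in
theorem finiteDimensional_of_transcendental {k L : Type u} [Field k] [Field L] [Algebra k L]
    [Algebra.EssFiniteType k L] (t : L) [Algebra.IsAlgebraic k⟮t⟯ L] {x : L}
    (hx : Transcendental k x) : FiniteDimensional k⟮x⟯ L := by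
  have hF : Algebra.IsAlgebraic (Algebra.adjoin k {t}) L := by
    open scoped IntermediateField.algebraAdjoinAdjoin in
    exact (IsFractionRing.comap_isAlgebraic_iff (A := Algebra.adjoin k {t}) (K := k⟮t⟯)).mpr
      inferInstance
  have hind : AlgebraicIndependent k (fun _ : Unit => x) :=
    algebraicIndependent_unique_type_iff.mpr hx
  have hb : IsTranscendenceBasis k (fun _ : Unit => x) :=
    hind.isTranscendenceBasis_of_lift_trdeg_le_of_finite (by
      have := Algebra.IsAlgebraic.trdeg_le_cardinalMk k ({t} : Set L)
      simpa using this)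
  have halg : Algebra.IsAlgebraic k⟮x⟯ L := by
    have h := hb.isAlgebraic
    rw [Set.range_const] at h
    open scoped IntermediateField.algebraAdjoinAdjoin in
    exact (IsFractionRing.comap_isAlgebraic_iff (A := Algebra.adjoin k {x}) (K := k⟮x⟯)).mp h
  have hess : Algebra.EssFiniteType k⟮x⟯ L := Algebra.EssFiniteType.of_comp k k⟮x⟯ L
  obtain ⟨S, hS⟩ := IntermediateField.fg_top k⟮x⟯ L
  have := IntermediateField.finiteDimensional_adjoin (K := k⟮x⟯) (L := L) (S := (S : Set L))
    (fun z _ => (Algebra.IsAlgebraic.isAlgebraic z).isIntegral)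
  rw [hS] at this
  exact Module.Finite.equiv (IntermediateField.topEquiv (F := k⟮x⟯) (E := L)).toLinearEquiv

theorem mem_range_algebraMap_of_isAlgebraic {k L : Type*} [Field k] [IsAlgClosed k] [Field L]
    [Algebra k L] {x : L} (hx : IsAlgebraic k x) : ∃ c : k, algebraMap k L c = x := by
  have := IsAlgClosed.degree_eq_one_of_irreducible k (minpoly.irreducible hx.isIntegral)
  exact minpoly.mem_range_of_degree_eq_one k x this

open scoped IntermediateField in
/-- In characteristic zero, the constants of a nonzero derivation of a function field of one
variable over `k` are the elements of `k`. -/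
theorem exists_algebraMap_eq_of_derivation_eq_zero {k L : Type u} [Field k] [IsAlgClosed k]
    [CharZero k] [Field L] [Algebra k L] [Algebra.EssFiniteType k L] (t : L)
    [Algebra.IsAlgebraic k⟮t⟯ L] {δ : Derivation k L L} (hδ : δ ≠ 0) (x : L) (hx : δ x = 0) :
    ∃ c : k, algebraMap k L c = x := by
  by_cases halg : IsAlgebraic k x
  · exact mem_range_algebraMap_of_isAlgebraic halg
  exfalso
  have := finiteDimensional_of_transcendental t halg
  -- If `x` is transcendental then `δ` is `k(x)`-linear, and `L / k(x)` is separable.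
  let F : IntermediateField k L :=
    { carrier := {z | δ z = 0}
      add_mem' := fun {a b} ha hb => by
        simp only [Set.mem_ofPred_eq] at ha hb ⊢
        rw [map_add, ha, hb, add_zero]
      mul_mem' := fun {a b} ha hb => by
        simp only [Set.mem_ofPred_eq] at ha hb ⊢
        rw [Derivation.leibniz, ha, hb, smul_zero, smul_zero, add_zero]
      algebraMap_mem' := fun c => δ.map_algebraMap c
      inv_mem' := fun a ha => by
        change δ a = 0 at ha
        change δ a⁻¹ = 0
        rw [Derivation.leibniz_inv, ha, smul_zero] }
  have hF : k⟮x⟯ ≤ F := by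
    rw [IntermediateField.adjoin_simple_le_iff]
    exact hx
  have hc : ∀ c : k⟮x⟯, δ (algebraMap k⟮x⟯ L c) = 0 := fun c => hF c.2
  let δ' : Derivation k⟮x⟯ L L := Derivation.mk'
    { toFun := δ
      map_add' := map_add δ
      map_smul' := fun c z => by
        rw [Algebra.smul_def, Derivation.leibniz, hc, smul_zero, add_zero]
        rfl } (fun a b => δ.leibniz a b)
  have : CharZero k⟮x⟯ := charZero_of_injective_algebraMap (algebraMap k k⟮x⟯).injective
  refine hδ (Derivation.ext fun z => ?_)
  have h1 := δ'.map_aeval (minpoly k⟮x⟯ z) z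
  rw [minpoly.aeval, map_zero, smul_eq_mul, eq_comm, mul_eq_zero] at h1
  exact h1.resolve_left ((Algebra.IsSeparable.isSeparable k⟮x⟯ z).aeval_derivative_ne_zero
    (minpoly.aeval _ _))

namespace IsPlaceFamily

open WithZero

variable {k L : Type u} {ι : Type*} [Field k] [Field L] [Algebra k L] {v : ι → Valuation L ℤᵐ⁰}

open scoped IntermediateField in
/-- The divisor of poles of a nonconstant function has degree `[L : k(x)]`. -/
theorem sum_poles_eq_finrank [IsAlgClosed k] [CharZero k] (hv : IsPlaceFamily k v) {x : L}
    (hx : Transcendental k x) [FiniteDimensional k⟮x⟯ L] :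
    ∃ S : Finset ι, (∀ i, i ∈ S ↔ 0 < -ordOf (v i) x) ∧
      ∑ i ∈ S, -ordOf (v i) x = Module.finrank k⟮x⟯ L := by
  have hx0 : x ≠ 0 := fun h => hx (h ▸ isAlgebraic_zero)
  have hx' : Transcendental k x⁻¹ := fun h => hx (by simpa using h.inv)
  have hadj : k⟮x⁻¹⟯ = k⟮x⟯ := by
    apply le_antisymm
    · rw [IntermediateField.adjoin_simple_le_iff]
      exact inv_mem (IntermediateField.mem_adjoin_simple_self k x)
    · rw [IntermediateField.adjoin_simple_le_iff]
      simpa using inv_mem (IntermediateField.mem_adjoin_simple_self k x⁻¹)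
  have : FiniteDimensional k⟮x⁻¹⟯ L := by rw [hadj]; infer_instance
  obtain ⟨S, hS, hsum⟩ := hv.sum_ordOf_eq_finrank hx'
  refine ⟨S, fun i => ?_, ?_⟩
  · rw [hS, ← ordOf_pos_iff _ (inv_ne_zero hx0), ordOf_inv]
  · rw [hadj] at hsum
    simpa [ordOf_inv] using hsum

open scoped IntermediateField in
/-- A principal divisor has degree zero. -/
theorem sum_ordOf_eq_zero [IsAlgClosed k] [CharZero k] (hv : IsPlaceFamily k v)
    [Algebra.EssFiniteType k L] (t : L) [Algebra.IsAlgebraic k⟮t⟯ L] {x : L} (hx0 : x ≠ 0) :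
    ∃ S : Finset ι, (∀ i ∉ S, ordOf (v i) x = 0) ∧ ∑ i ∈ S, ordOf (v i) x = 0 := by
  classical
  by_cases halg : IsAlgebraic k x
  · obtain ⟨c, rfl⟩ := mem_range_algebraMap_of_isAlgebraic halg
    refine ⟨∅, fun i _ => ?_, by simp⟩
    rw [ordOf_eq_zero_iff _ hx0]
    exact hv.algebraMap_eq_one i (fun h => hx0 (by simp [h]))
  have := finiteDimensional_of_transcendental t halg
  obtain ⟨S, hS, hSsum⟩ := hv.sum_ordOf_eq_finrank halg
  obtain ⟨T, hT, hTsum⟩ := hv.sum_poles_eq_finrank halg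
  simp only [← ordOf_pos_iff _ hx0] at hS
  refine ⟨S ∪ T, fun i hi => ?_, ?_⟩
  · rw [Finset.mem_union, hS, hT] at hi
    omega
  · rw [Finset.sum_union, hSsum]
    · rw [Finset.sum_neg_distrib] at hTsum
      omega
    · rw [Finset.disjoint_left]
      intro i hi hi'
      rw [hS] at hi
      rw [hT] at hi'
      omega

end IsPlaceFamily

/-! ### The degree of a vector field on a curve -/

theorem linearIndependent_pow_of_transcendental {k K : Type*} [Field k] [Field K] [Algebra k K]
    {x : K} (hx : Transcendental k x) : LinearIndependent k (fun n : ℕ => x ^ n) := by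
  have h := (Polynomial.basisMonomials k).linearIndependent.map'
    (Polynomial.aeval x : Polynomial k →ₐ[k] K).toLinearMap
    (LinearMap.ker_eq_bot.mpr (transcendental_iff_injective.mp hx))
  convert! h using 1
  ext n
  simp

theorem two_mul_sum_fin_val (n : ℕ) : 2 * ∑ i : Fin n, (i : ℤ) = n * (n - 1) := by
  induction n with
  | zero => simp
  | succ n ih =>
    rw [Fin.sum_univ_castSucc, mul_add]
    simp only [Fin.val_castSucc, Fin.val_last]
    rw [ih]
    push_cast
    ring

namespace IsPlaceFamily

open WithZero

variable {k L : Type u} {ι : Type*} [Field k] [Field L] [Algebra k L] {v : ι → Valuation L ℤᵐ⁰}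

/-- Local estimate for the Wronskian, in terms of orders. -/
theorem le_ordOf_wronskianMatrix_det (hv : IsPlaceFamily k v) (δ : Derivation k L L) (i : ι) {ε : L}
    (hε : ε ≠ 0) (hδ : ∀ x, v i x ≤ 1 → v i (δ x) ≤ v i ε) {n : ℕ} (f : Fin n → L) (D : ℕ)
    (hf0 : ∀ j, f j ≠ 0) (hf : ∀ j, -(D : ℤ) ≤ ordOf (v i) (f j))
    (hW : (wronskianMatrix δ f).det ≠ 0) :
    (∑ j : Fin n, (j : ℤ)) * ordOf (v i) ε - n * D ≤ ordOf (v i) (wronskianMatrix δ f).det := by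
  obtain ⟨π, hπ⟩ := hv.exists_uniformizer i
  have hπ0 : π ≠ 0 := fun h => exp_ne_zero (a := (-1 : ℤ)) (by rw [← hπ, h, map_zero])
  have hπ1 : ordOf (v i) π = 1 := by rw [ordOf, hπ, log_exp, neg_neg]
  have hu : π ^ D ≠ 0 := pow_ne_zero _ hπ0
  have h := valuation_wronskianMatrix_det_le (v i) δ hε hu hδ f fun j => by
    rw [← ordOf_nonneg_iff _ (mul_ne_zero hu (hf0 j)), ordOf_mul _ hu (hf0 j), ordOf_pow, hπ1]
    have := hf j
    omega
  rw [← map_inv₀, ← map_pow, ← map_pow, ← map_mul, ← ordOf_le_ordOf_iff _ ?_ hW, ordOf_mul,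
    ordOf_pow, ordOf_pow, ordOf_inv, ordOf_pow, hπ1] at h
  · push_cast at h
    linarith
  · exact pow_ne_zero _ hε
  · exact pow_ne_zero _ (inv_ne_zero hu)
  · exact mul_ne_zero (pow_ne_zero _ hε) (pow_ne_zero _ (inv_ne_zero hu))

open scoped IntermediateField in
/-- A nonzero vector field on a smooth projective curve has degree at most two: the sum of the
orders of vanishing of a derivation `δ` at all places is at most `2`. The order at the place `v i` is
that of `δ (s i)`, where `δ (s i)` generates the image of `δ` on the valuation ring.

If `V` is the space of functions spanned by the `tᵐ yⱼ` with `m ≤ N`, then the degree-zero divisor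
of the Wronskian of `V` bounds the degree of `δ` by `2 (N [L : k(t)] + const) / (dim V - 1)`, which
tends to `2` for `N → ∞`. -/
theorem sum_ordOf_derivation_le_two [IsAlgClosed k] [CharZero k] (hv : IsPlaceFamily k v)
    [Algebra.EssFiniteType k L] (t₀ : L) [Algebra.IsAlgebraic k⟮t₀⟯ L] (δ : Derivation k L L)
    (s : ι → L) (hδ : ∀ i x, v i x ≤ 1 → v i (δ x) ≤ v i (δ (s i))) (hs : ∀ i, δ (s i) ≠ 0)
    (S : Finset ι) (hS : ∀ i ∉ S, ordOf (v i) (δ (s i)) = 0) :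
    ∑ i ∈ S, ordOf (v i) (δ (s i)) ≤ 2 := by
  classical
  rcases S.eq_empty_or_nonempty with rfl | ⟨i₀, -⟩
  · simp
  have hδ0 : δ ≠ 0 := fun h => hs i₀ (by simp [h])
  -- A uniformizer serves as a transcendental element.
  obtain ⟨t, ht⟩ := hv.exists_uniformizer i₀
  have ht0 : t ≠ 0 := fun h => exp_ne_zero (a := (-1 : ℤ)) (by rw [← ht, h, map_zero])
  have htt : Transcendental k t := fun h => by
    obtain ⟨c, rfl⟩ := mem_range_algebraMap_of_isAlgebraic h
    rw [hv.algebraMap_eq_one i₀ (fun h => ht0 (by simp [h])), ← exp_zero, exp_inj] at ht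
    omega
  have := finiteDimensional_of_transcendental t₀ htt
  set d := Module.finrank k⟮t⟯ L with hd
  have hdpos : 0 < d := Module.finrank_pos
  let y := Module.finBasis k⟮t⟯ L
  have hy0 : ∀ j, y j ≠ 0 := fun j => y.ne_zero j
  obtain ⟨St, hSt, hSt_sum⟩ := hv.sum_poles_eq_finrank htt
  -- `m i` bounds the poles of all `y j` at the place `i`.
  choose Sy hSy hSy_sum using fun j => hv.sum_ordOf_eq_zero t₀ (hy0 j)
  set m : ι → ℕ := fun i => ∑ j, (ordOf (v i) (y j)).natAbs with hm
  set p : ι → ℕ := fun i => (-ordOf (v i) t).toNat with hp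
  set F₀ : Finset ι := S ∪ St ∪ Finset.univ.biUnion Sy with hF₀
  set M : ℕ := ∑ i ∈ F₀, m i with hM
  have hm0 : ∀ i ∉ F₀, m i = 0 := fun i hi => by
    refine Finset.sum_eq_zero fun j _ => ?_
    rw [hSy j i, Int.natAbs_zero]
    intro h
    exact hi (Finset.mem_union_right _ (Finset.mem_biUnion.mpr ⟨j, Finset.mem_univ j, h⟩))
  have hp0 : ∀ i ∉ St, p i = 0 := fun i hi => by
    rw [hSt] at hi
    exact Int.toNat_of_nonpos (by omega)
  have hp_sum : ∑ i ∈ St, (p i : ℤ) = d := by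
    rw [← hSt_sum]
    refine Finset.sum_congr rfl fun i hi => ?_
    exact Int.toNat_of_nonneg ((hSt i).mp hi).le
  have key : ∀ N : ℕ, ((N + 1) * d - 1 : ℤ) * ∑ i ∈ S, ordOf (v i) (δ (s i)) ≤
      2 * (N * d + M) := by
    intro N
    set n := (N + 1) * d with hn
    have hnpos : (0 : ℤ) < n := by positivity
    -- The functions `tᵐ yⱼ` with `m ≤ N`; their poles at `i` have order at most `N p i + m i`.
    set f : Fin n → L := fun j => t ^ ((finProdFinEquiv.symm j).1 : ℕ) *
      y (finProdFinEquiv.symm j).2 with hf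
    have hf0 : ∀ j, f j ≠ 0 := fun j => mul_ne_zero (pow_ne_zero _ ht0) (hy0 _)
    have hgen : Transcendental k (IntermediateField.AdjoinSimple.gen k t) := fun h => htt (by
      have := h.algebraMap (A := L)
      rwa [IntermediateField.AdjoinSimple.algebraMap_gen] at this)
    have hlin : LinearIndependent k f := by
      have h1 := ((linearIndependent_pow_of_transcendental hgen).comp
        (fun i : Fin (N + 1) => (i : ℕ)) Fin.val_injective)
      have h2 := (linearIndependent_smul h1 y.linearIndependent).comp finProdFinEquiv.symm
        finProdFinEquiv.symm.injective
      exact h2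
    have hW := wronskianMatrix_det_ne_zero δ
      (exists_algebraMap_eq_of_derivation_eq_zero t₀ hδ0) f hlin
    obtain ⟨SW, hSW, hSW_sum⟩ := hv.sum_ordOf_eq_zero t₀ hW
    set F := F₀ ∪ SW with hF
    have hFsum : ∀ (T : Finset ι) (g : ι → ℤ), T ⊆ F → (∀ i ∉ T, g i = 0) →
        ∑ i ∈ F, g i = ∑ i ∈ T, g i := fun T g hT hg =>
      (Finset.sum_subset hT fun i _ hi => hg i hi).symm
    have hlocal : ∀ i, (∑ j : Fin n, (j : ℤ)) * ordOf (v i) (δ (s i)) - n * (N * p i + m i : ℕ) ≤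
        ordOf (v i) (wronskianMatrix δ f).det := fun i => by
      refine hv.le_ordOf_wronskianMatrix_det δ i (hs i) (hδ i) f (N * p i + m i) hf0 (fun j => ?_) hW
      rw [ordOf_mul _ (pow_ne_zero _ ht0) (hy0 _), ordOf_pow]
      set a := (finProdFinEquiv.symm j).1
      set b := (finProdFinEquiv.symm j).2
      have h1 : ((ordOf (v i) (y b)).natAbs : ℤ) ≤ m i := by
        exact_mod_cast Finset.single_le_sum
          (f := fun j => (ordOf (v i) (y j)).natAbs) (fun _ _ => Nat.zero_le _) (Finset.mem_univ b)
      have h2 : -(p i : ℤ) ≤ ordOf (v i) t := by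
        have := Int.self_le_toNat (-ordOf (v i) t)
        simp only [hp]
        omega
      have h3 : -((N * p i : ℕ) : ℤ) ≤ (a : ℕ) * ordOf (v i) t := by
        have ha : ((a : ℕ) : ℤ) ≤ N := by exact_mod_cast Nat.lt_succ_iff.mp a.2
        have hp' : (0 : ℤ) ≤ p i := Int.natCast_nonneg _
        push_cast
        nlinarith [Int.natCast_nonneg (a : ℕ)]
      push_cast at h3 ⊢
      linarith [neg_abs_le (ordOf (v i) (y b)), Int.natCast_natAbs (ordOf (v i) (y b))]
    -- Sum the local estimates; the divisor of the Wronskian has degree zero.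
    have hsum := Finset.sum_le_sum fun i (_ : i ∈ F) => hlocal i
    rw [hFsum SW _ Finset.subset_union_right hSW, hSW_sum, Finset.sum_sub_distrib,
      ← Finset.mul_sum, ← Finset.mul_sum] at hsum
    push_cast at hsum
    rw [Finset.sum_add_distrib, ← Finset.mul_sum,
      hFsum S _ (fun i hi => by simp [hF, hF₀, hi]) hS,
      hFsum St (fun i => (p i : ℤ)) (fun i hi => by simp [hF, hF₀, hi])
        (fun i hi => by simp [hp0 i hi]), hp_sum,
      hFsum F₀ (fun i => (m i : ℤ)) Finset.subset_union_left (fun i hi => by simp [hm0 i hi]),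
      show ∑ i ∈ F₀, (m i : ℤ) = M by rw [hM, Nat.cast_sum]] at hsum
    have h2 := two_mul_sum_fin_val n
    set E := ∑ i ∈ S, ordOf (v i) (δ (s i))
    have h3 : (n : ℤ) * ((n - 1) * E) ≤ n * (2 * (N * d + M)) := by
      calc (n : ℤ) * ((n - 1) * E) = 2 * (∑ j : Fin n, (j : ℤ)) * E := by rw [h2]; ring
        _ ≤ n * (2 * (N * d + M)) := by nlinarith
    have h4 := le_of_mul_le_mul_left h3 hnpos
    rw [hn] at h4
    push_cast at h4
    exact h4
  -- If the degree were `≥ 3`, then `3 ((N + 1) d - 1) ≤ 2 (N d + M)`, which fails for `N > 2 M`.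
  by_contra! hE
  have h := key (2 * M + 1)
  push_cast at h
  have hd1 : (1 : ℤ) ≤ d := by exact_mod_cast hdpos
  have hM0 : (0 : ℤ) ≤ M := Int.natCast_nonneg _
  have h5 : (0 : ℤ) ≤ ((2 * M + 1 + 1) * d - 1 : ℤ) := by nlinarith
  have h6 : ((2 * M + 1 + 1) * d - 1 : ℤ) * 3 ≤
      ((2 * M + 1 + 1) * d - 1 : ℤ) * ∑ i ∈ S, ordOf (v i) (δ (s i)) :=
    mul_le_mul_of_nonneg_left hE h5
  nlinarith

end IsPlaceFamily

/-! ### Rational two-forms and the order of a form -/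

section bracket

variable {k K : Type u} [Field k] [Field K] [Algebra k K]

/-- A nonzero two-form `ω` on a field with at most two-dimensional module of differentials
identifies `⋀²Ω` with `K`: `x ∧ y = b(x, y) ω` for an alternating form `b`. -/
theorem exists_bilinear_ιMulti_eq_smul {a₁ a₂ : K}
    (hspan : Submodule.span K {KaehlerDifferential.D k K a₁, KaehlerDifferential.D k K a₂} = ⊤)
    {ω : ⋀[K]^2 (Ω[K⁄k])} (hω : ω ≠ 0) :
    ∃ b : Ω[K⁄k] →ₗ[K] Ω[K⁄k] →ₗ[K] K, (∀ x, b x x = 0) ∧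
      ∀ x : Fin 2 → Ω[K⁄k], exteriorPower.ιMulti K 2 x = b (x 0) (x 1) • ω := by
  set v : Fin 2 → Ω[K⁄k] := ![KaehlerDifferential.D k K a₁, KaehlerDifferential.D k K a₂] with hv
  have hv' : Submodule.span K (Set.range v) = ⊤ := by
    rw [hv, Matrix.range_cons, Matrix.range_cons, Matrix.range_empty, Set.union_empty,
      Set.singleton_union, hspan]
  have hfam := exteriorPower.ιMulti_family_span_of_span K (n := 2) hv'
  have hsub : Subsingleton (Set.powersetCard (Fin 2) 2) := by
    refine ⟨fun s t => Subtype.ext ?_⟩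
    rw [Finset.eq_univ_of_card s.1 s.2, Finset.eq_univ_of_card t.1 t.2]
  obtain ⟨w, hw⟩ : ∃ w, ∀ x : ⋀[K]^2 (Ω[K⁄k]), ∃ c : K, c • w = x := by
    let s₀ : Set.powersetCard (Fin 2) 2 := ⟨Finset.univ, by simp [Set.powersetCard]⟩
    refine ⟨exteriorPower.ιMulti_family K 2 v s₀, fun x => ?_⟩
    have hx : x ∈ Submodule.span K (Set.range (exteriorPower.ιMulti_family K 2 v)) := by
      rw [hfam]; trivial
    have hr : Set.range (exteriorPower.ιMulti_family K 2 v) =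
        {exteriorPower.ιMulti_family K 2 v s₀} := by
      ext y
      constructor
      · rintro ⟨s, rfl⟩
        rw [Subsingleton.elim s s₀]
        rfl
      · rintro rfl
        exact ⟨s₀, rfl⟩
    rw [hr] at hx
    exact Submodule.mem_span_singleton.mp hx
  have hdim : ∀ x : ⋀[K]^2 (Ω[K⁄k]), ∃ c : K, c • ω = x := by
    intro x
    obtain ⟨c, rfl⟩ := hw x
    obtain ⟨c₀, rfl⟩ := hw ω
    have hc₀ : c₀ ≠ 0 := by rintro rfl; simp at hω
    exact ⟨c * c₀⁻¹, by rw [smul_smul, mul_assoc, inv_mul_cancel₀ hc₀, mul_one]⟩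
  let e : K ≃ₗ[K] ⋀[K]^2 (Ω[K⁄k]) :=
    LinearEquiv.ofBijective (LinearMap.toSpanSingleton K _ ω)
      ⟨(LinearMap.ker_eq_bot.mp (LinearMap.ker_toSpanSingleton K hω)), fun x => hdim x⟩
  have he : ∀ x, e.symm x • ω = x := fun x => e.apply_symm_apply x
  let β : (Ω[K⁄k]) [⋀^Fin 2]→ₗ[K] K := e.symm.toLinearMap.compAlternatingMap
    (exteriorPower.ιMulti K 2)
  have hβ : ∀ x, β x • ω = exteriorPower.ιMulti K 2 x := fun x => he _
  have hu₁ : ∀ x z : Ω[K⁄k], Function.update ![x, 0] 1 z = ![x, z] := by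
    intro x z; ext i; fin_cases i <;> rfl
  have hu₀ : ∀ x z : Ω[K⁄k], Function.update ![0, z] 0 x = ![x, z] := by
    intro x z; ext i; fin_cases i <;> rfl
  have hadd₂ : ∀ x y z, β ![x, y + z] = β ![x, y] + β ![x, z] := by
    intro x y z
    have := β.map_update_add ![x, 0] 1 y z
    simpa only [hu₁, smul_eq_mul] using this
  have hsmul₂ : ∀ (c : K) x y, β ![x, c • y] = c * β ![x, y] := by
    intro c x y
    have := β.map_update_smul ![x, 0] 1 c y
    simpa only [hu₁, smul_eq_mul] using this
  have hadd₁ : ∀ x y z, β ![x + y, z] = β ![x, z] + β ![y, z] := by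
    intro x y z
    have := β.map_update_add ![0, z] 0 x y
    simpa only [hu₀, smul_eq_mul] using this
  have hsmul₁ : ∀ (c : K) x y, β ![c • x, y] = c * β ![x, y] := by
    intro c x y
    have := β.map_update_smul ![0, y] 0 c x
    simpa only [hu₀, smul_eq_mul] using this
  refine ⟨LinearMap.mk₂ K (fun x y => β ![x, y]) (fun x y z => hadd₁ x y z)
    (fun c x y => hsmul₁ c x y) (fun x y z => hadd₂ x y z) (fun c x y => hsmul₂ c x y), ?_, ?_⟩
  · intro x
    exact β.map_eq_zero_of_eq ![x, x] (i := 0) (j := 1) rfl (by decide)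
  · intro x
    have h : ![x 0, x 1] = x := by
      ext i; fin_cases i <;> rfl
    rw [LinearMap.mk₂_apply, h, hβ]

/-- Let `v` be a discrete valuation on `K` with ring `O`. If every product `df ∧ dh` with
`f, h ∈ O` is an `O`-multiple of `da ∧ db = e ω`, where `a, b ∈ O`, then the order of `ω` along
`v` is `-v e`. -/
theorem formOrder_eq_neg {v : K → ℤ} (hmul : ∀ x y, x ≠ 0 → y ≠ 0 → v (x * y) = v x + v y)
    (hadd : ∀ x y, x ≠ 0 → y ≠ 0 → x + y ≠ 0 → min (v x) (v y) ≤ v (x + y))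
    (hneg : ∀ x, v (-x) = v x)
    {ω : ⋀[K]^2 (Ω[K⁄k])} (hω : ω ≠ 0) {b : Ω[K⁄k] →ₗ[K] Ω[K⁄k] →ₗ[K] K}
    (hb : ∀ x : Fin 2 → Ω[K⁄k], exteriorPower.ιMulti K 2 x = b (x 0) (x 1) • ω)
    {x y : K} (hx : 0 ≤ v x) (hy : 0 ≤ v y)
    (he : b (KaehlerDifferential.D k K x) (KaehlerDifferential.D k K y) ≠ 0)
    (hgen : ∀ f h : K, (f = 0 ∨ 0 ≤ v f) → (h = 0 ∨ 0 ≤ v h) → ∃ g : K, (g = 0 ∨ 0 ≤ v g) ∧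
      b (KaehlerDifferential.D k K f) (KaehlerDifferential.D k K h) =
        b (KaehlerDifferential.D k K x) (KaehlerDifferential.D k K y) * g) :
    formOrder k v ω = - v (b (KaehlerDifferential.D k K x) (KaehlerDifferential.D k K y)) := by
  set e := b (KaehlerDifferential.D k K x) (KaehlerDifferential.D k K y) with he'
  have h1 : v 1 = 0 := by have := hmul 1 1 one_ne_zero one_ne_zero; simp at this; exact this
  -- The subgroup in the definition of `formOrder` consists of the `g ω` with `v g ≥ m + v e`.
  have hmem : ∀ m : ℤ, ω ∈ AddSubgroup.closure
    {η | ∃ (h : K) (a : Fin 2 → K), (h = 0 ∨ m ≤ v h) ∧ (∀ i, a i = 0 ∨ 0 ≤ v (a i)) ∧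
      η = h • exteriorPower.ιMulti K 2 (fun i => KaehlerDifferential.D k K (a i))} ↔
      m ≤ - v e := by
    intro m
    constructor
    · intro h
      let T : AddSubgroup (⋀[K]^2 (Ω[K⁄k])) :=
        { carrier := {η | ∃ g : K, (g = 0 ∨ m + v e ≤ v g) ∧ η = g • ω}
          zero_mem' := ⟨0, Or.inl rfl, by simp⟩
          add_mem' := by
            rintro _ _ ⟨g, hg, rfl⟩ ⟨g', hg', rfl⟩
            refine ⟨g + g', ?_, by rw [add_smul]⟩
            by_cases hg0 : g = 0
            · subst hg0; simpa using hg'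
            by_cases hg0' : g' = 0
            · subst hg0'; simpa using hg
            by_cases hs : g + g' = 0
            · exact Or.inl hs
            right
            have := hadd g g' hg0 hg0' hs
            have := hg.resolve_left hg0
            have := hg'.resolve_left hg0'
            omega
          neg_mem' := by
            rintro _ ⟨g, hg, rfl⟩
            exact ⟨-g, by rwa [neg_eq_zero, hneg], (neg_smul g ω).symm⟩ }
      have hT : ω ∈ T := by
        refine (AddSubgroup.closure_le T).mpr ?_ h
        rintro _ ⟨c, a, hc, ha, rfl⟩
        obtain ⟨g, hg, hg'⟩ := hgen (a 0) (a 1) (ha 0) (ha 1)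
        refine ⟨c * (e * g), ?_, by rw [hb, hg', smul_smul]⟩
        by_cases hc0 : c = 0
        · left; simp [hc0]
        by_cases hg0 : g = 0
        · left; simp [hg0]
        right
        have := hc.resolve_left hc0
        have := hg.resolve_left hg0
        rw [hmul _ _ hc0 (mul_ne_zero he hg0), hmul _ _ he hg0]
        omega
      obtain ⟨g, hg, hg'⟩ := hT
      have : g = 1 := by
        by_contra hne
        have : (1 - g) • ω = 0 := (sub_smul 1 g ω).trans (by
          rw [one_smul]; exact sub_eq_zero.mpr hg')
        rcases smul_eq_zero.mp this with h | h
        · exact hne (sub_eq_zero.mp h).symm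
        · exact hω h
      subst this
      have := hg.resolve_left one_ne_zero
      omega
    · intro hm
      refine AddSubgroup.subset_closure ⟨e⁻¹, ![x, y], Or.inr ?_, ?_, ?_⟩
      · have := hmul e e⁻¹ he (inv_ne_zero he)
        rw [mul_inv_cancel₀ he, h1] at this
        omega
      · intro i; fin_cases i
        · exact Or.inr hx
        · exact Or.inr hy
      · rw [hb, smul_smul]
        simp only [Matrix.cons_val_zero, Matrix.cons_val_one]
        rw [← he', inv_mul_cancel₀ he, one_smul]
  rw [formOrder]
  simp_rw [hmem]
  exact csSup_Iic

end bracket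

/-! ### Local coordinates on a surface adapted to a smooth curve -/

section coordinates

open IsLocalRing

variable {k R K A : Type u} [Field k] [CommRing R] [Algebra k R]

/-- In a local `k`-algebra with residue field `k`, elements whose differentials generate `Ω`
generate the maximal ideal after subtracting their values: the class of `h - h(p)` modulo
`𝔪² + (aᵢ - aᵢ(p))` is a derivation that kills all `aᵢ`, hence it is zero. -/
theorem exists_maximalIdeal_eq_span_sub [IsLocalRing R] [IsNoetherianRing R]
    (hk : Function.Surjective (algebraMap k (ResidueField R))) {ι : Type*} (a : ι → R)
    (ha : Submodule.span R (Set.range fun i => KaehlerDifferential.D k R (a i)) = ⊤) :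
    ∃ a₀ : ι → k, maximalIdeal R = Ideal.span (Set.range fun i => a i - algebraMap k R (a₀ i)) := by
  let e : k ≃ₐ[k] ResidueField R := AlgEquiv.ofBijective (Algebra.ofId k (ResidueField R))
    ⟨(algebraMap k (ResidueField R)).injective, hk⟩
  let σ : R →ₐ[k] k := e.symm.toAlgHom.comp (IsScalarTower.toAlgHom k R (ResidueField R))
  have hσ : ∀ h, h - algebraMap k R (σ h) ∈ maximalIdeal R := by
    intro h
    rw [← residue_eq_zero_iff, map_sub, sub_eq_zero]
    have : algebraMap k (ResidueField R) (σ h) = residue R h := e.apply_symm_apply _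
    rw [← this, IsScalarTower.algebraMap_apply k R (ResidueField R)]
    rfl
  have hσm : ∀ h ∈ maximalIdeal R, σ h = 0 := by
    intro h hh
    change e.symm (residue R h) = 0
    rw [(residue_eq_zero_iff h).mpr hh, map_zero]
  refine ⟨fun i => σ (a i), ?_⟩
  set J := Ideal.span (Set.range fun i => a i - algebraMap k R (σ (a i))) with hJ
  have hJm : J ≤ maximalIdeal R := by
    rw [hJ, Ideal.span_le]
    rintro _ ⟨i, rfl⟩
    exact hσ _
  let Q := R ⧸ (maximalIdeal R * maximalIdeal R ⊔ J)
  let q : R →ₐ[k] Q := Ideal.Quotient.mkₐ k _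
  have hq0 : ∀ x, q x = 0 ↔ x ∈ maximalIdeal R * maximalIdeal R ⊔ J := fun x =>
    Ideal.Quotient.eq_zero_iff_mem
  let d : Derivation k R Q := Derivation.mk'
    (q.toLinearMap ∘ₗ (LinearMap.id - (Algebra.linearMap k R) ∘ₗ σ.toLinearMap)) (by
      intro x y
      change q (x * y - algebraMap k R (σ (x * y))) = q x * q (y - algebraMap k R (σ y)) +
        q y * q (x - algebraMap k R (σ x))
      rw [← map_mul, ← map_mul, ← map_add, ← sub_eq_zero, ← map_sub, hq0]
      have h : x * y - algebraMap k R (σ (x * y)) - (x * (y - algebraMap k R (σ y)) +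
          y * (x - algebraMap k R (σ x))) =
          -((x - algebraMap k R (σ x)) * (y - algebraMap k R (σ y))) := by
        rw [map_mul, map_mul]; ring
      rw [h]
      exact neg_mem (Ideal.mem_sup_left (Ideal.mul_mem_mul (hσ x) (hσ y))))
  have hd : ∀ x, d x = q (x - algebraMap k R (σ x)) := fun x => rfl
  have hd0 : d.liftKaehlerDifferential = 0 := by
    refine LinearMap.ext_on_range ha fun i => ?_
    rw [Derivation.liftKaehlerDifferential_comp_D, hd, LinearMap.zero_apply, hq0]
    exact Ideal.mem_sup_right (Ideal.subset_span ⟨i, rfl⟩)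
  have hle : maximalIdeal R ≤ J ⊔ maximalIdeal R • maximalIdeal R := by
    intro x hx
    have h1 : d x = 0 := by
      rw [← Derivation.liftKaehlerDifferential_comp_D, hd0, LinearMap.zero_apply]
    rw [hd, hσm x hx, map_zero, sub_zero, hq0, sup_comm] at h1
    exact h1
  refine le_antisymm ?_ hJm
  exact Submodule.le_of_le_smul_of_le_jacobson_bot (IsNoetherian.noetherian _)
    (IsLocalRing.maximalIdeal_le_jacobson _) hle

/-- The differentials of a `k`-algebra are the combinations of those of `a` and `b` if the latter
generate the module of differentials; the relation is read in the differentials of an extension. -/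
theorem exists_D_eq_of_span_eq_top [Field K] [Algebra k K] [Algebra R K] [IsScalarTower k R K]
    {a b : R}
    (hab : Submodule.span R {KaehlerDifferential.D k R a, KaehlerDifferential.D k R b} = ⊤)
    (h : R) : ∃ α β : R, KaehlerDifferential.D k K (algebraMap R K h) =
      algebraMap R K α • KaehlerDifferential.D k K (algebraMap R K a) +
      algebraMap R K β • KaehlerDifferential.D k K (algebraMap R K b) := by
  have hm : KaehlerDifferential.D k R h ∈
      Submodule.span R {KaehlerDifferential.D k R a, KaehlerDifferential.D k R b} := by
    rw [hab]; trivial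
  obtain ⟨α, β, hαβ⟩ := Submodule.mem_span_pair.mp hm
  refine ⟨α, β, ?_⟩
  have := congrArg (KaehlerDifferential.map k k R K) hαβ
  rw [map_add, map_smul, map_smul, KaehlerDifferential.map_D, KaehlerDifferential.map_D,
    KaehlerDifferential.map_D] at this
  rw [← this, algebraMap_smul, algebraMap_smul]

/-- A smooth curve through a point `p` of a smooth surface is the zero set of one of two suitable
local coordinates `c, s` at `p`. Here `π : R → A` is the restriction from the local ring of the
surface to that of the curve. -/
theorem exists_adapted_coordinates [IsLocalRing R] [IsNoetherianRing R]
    [Field K] [Algebra k K] [Algebra R K] [IsScalarTower k R K]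
    [CommRing A] [IsDomain A] [IsDiscreteValuationRing A] (π : R →+* A)
    (hπ : Function.Surjective π) {a b : R} (hm : maximalIdeal R = Ideal.span {a, b})
    (hD : ∀ h : R, ∃ α β : R, KaehlerDifferential.D k K (algebraMap R K h) =
      algebraMap R K α • KaehlerDifferential.D k K (algebraMap R K a) +
      algebraMap R K β • KaehlerDifferential.D k K (algebraMap R K b)) :
    ∃ c s : R, maximalIdeal R = Ideal.span {c, s} ∧ RingHom.ker π = Ideal.span {c} ∧
      Irreducible (π s) ∧ ∀ h : R, ∃ α β : R, KaehlerDifferential.D k K (algebraMap R K h) =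
      algebraMap R K α • KaehlerDifferential.D k K (algebraMap R K c) +
      algebraMap R K β • KaehlerDifferential.D k K (algebraMap R K s) := by
  -- The restriction of `a` or `b` is a uniformizer of the curve; take it as `s`, subtract a multiple
  -- of it from the other coordinate to make the latter vanish on the curve, and apply Nakayama's
  -- lemma to see that this is an equation of the curve.
  wlog hdvd : π a ∣ π b generalizing a b with H
  · refine H (a := b) (b := a) (by rw [hm, Set.pair_comm]) (fun h => ?_)
      ((ValuationRing.dvd_total (π a) (π b)).resolve_left hdvd)
    obtain ⟨α, β, h⟩ := hD h
    exact ⟨β, α, by rw [h, add_comm]⟩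
  obtain ⟨ρ, hρ⟩ := hdvd
  obtain ⟨r, rfl⟩ := hπ ρ
  have : IsLocalHom π := hπ.isLocalHom _
  have ham : a ∈ maximalIdeal R := hm ▸ Ideal.subset_span (by simp)
  have hmap : maximalIdeal A = Ideal.span {π a} := by
    refine le_antisymm ?_ ?_
    · intro y hy
      obtain ⟨y, rfl⟩ := hπ y
      have hy' : y ∈ maximalIdeal R := (mem_maximalIdeal y).mpr
        (map_mem_nonunits_iff π y |>.mp ((mem_maximalIdeal _).mp hy))
      rw [hm] at hy'
      obtain ⟨u, w, rfl⟩ := Ideal.mem_span_pair.mp hy'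
      rw [Ideal.mem_span_singleton]
      simp only [map_add, map_mul, hρ]
      exact Dvd.intro (π u + π w * π r) (by ring)
    · rw [Ideal.span_singleton_le_iff_mem]
      exact (mem_maximalIdeal _).mpr (map_mem_nonunits_iff π a |>.mpr ((mem_maximalIdeal _).mp ham))
  have hirr : Irreducible (π a) :=
    (IsDiscreteValuationRing.irreducible_iff_uniformizer _).mpr hmap
  refine ⟨b - r * a, a, ?_, ?_, hirr, ?_⟩
  · rw [hm]
    refine le_antisymm (Ideal.span_le.mpr ?_) (Ideal.span_le.mpr ?_)
    · rintro x (rfl | rfl)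
      · exact Ideal.subset_span (by simp)
      · exact Ideal.mem_span_pair.mpr ⟨1, r, by ring⟩
    · rintro x (rfl | rfl)
      · exact Ideal.mem_span_pair.mpr ⟨-r, 1, by ring⟩
      · exact Ideal.subset_span (by simp)
  · have hc : b - r * a ∈ RingHom.ker π := by
      rw [RingHom.mem_ker, map_sub, map_mul, hρ]; ring
    refine le_antisymm ?_ ((Ideal.span_singleton_le_iff_mem _).mpr hc)
    refine Submodule.le_of_le_smul_of_le_jacobson_bot (I := maximalIdeal R)
      (IsNoetherian.noetherian _) (IsLocalRing.maximalIdeal_le_jacobson _) ?_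
    intro h hh
    have hhm : h ∈ maximalIdeal R := by
      rw [mem_maximalIdeal]
      refine map_mem_nonunits_iff π h |>.mp ?_
      rw [(RingHom.mem_ker).mp hh]
      simp
    rw [hm] at hhm
    obtain ⟨u, w, rfl⟩ := Ideal.mem_span_pair.mp hhm
    have hw : u + w * r ∈ RingHom.ker π := by
      rw [RingHom.mem_ker] at hh ⊢
      simp only [map_add, map_mul, hρ] at hh ⊢
      have : π a * (π u + π w * π r) = 0 := by rw [← hh]; ring
      exact (mul_eq_zero.mp this).resolve_left hirr.ne_zero
    have : u * a + w * b = w * (b - r * a) + a * (u + w * r) := by ring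
    rw [this]
    exact Submodule.add_mem_sup (Ideal.mem_span_singleton.mpr (Dvd.intro_left _ rfl))
      (Submodule.smul_mem_smul ham hw)
  · -- `dc = (1 - aβ) db - (r + aα) da` where `dr = α da + β db`, and `1 - aβ` is a unit.
    intro h
    obtain ⟨α, β, hr⟩ := hD r
    obtain ⟨α', β', hh⟩ := hD h
    have hu : IsUnit (1 - a * β) := by
      have : a * β ∈ maximalIdeal R := Ideal.mul_mem_right _ _ ham
      by_contra hn
      have h1 := Ideal.add_mem _ ((mem_maximalIdeal _).mpr hn) this
      rw [sub_add_cancel] at h1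
      exact (Ideal.ne_top_iff_one _).mp (maximalIdeal.isMaximal R).ne_top h1
    obtain ⟨w, hw⟩ := hu.exists_left_inv
    have hwK : algebraMap R K w * (1 - algebraMap R K a * algebraMap R K β) = 1 := by
      rw [← map_one (algebraMap R K), ← map_mul, ← map_sub, ← map_mul, hw]
    have hc : KaehlerDifferential.D k K (algebraMap R K (b - r * a)) =
        (1 - algebraMap R K a * algebraMap R K β) • KaehlerDifferential.D k K (algebraMap R K b) -
        (algebraMap R K r + algebraMap R K a * algebraMap R K α) •
          KaehlerDifferential.D k K (algebraMap R K a) := by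
      rw [map_sub, map_mul, map_sub, Derivation.leibniz, hr]
      module
    have hb : KaehlerDifferential.D k K (algebraMap R K b) =
        algebraMap R K w • KaehlerDifferential.D k K (algebraMap R K (b - r * a)) +
        (algebraMap R K w * (algebraMap R K r + algebraMap R K a * algebraMap R K α)) •
          KaehlerDifferential.D k K (algebraMap R K a) := by
      rw [hc, smul_sub, smul_smul, hwK, smul_smul]
      module
    refine ⟨β' * w, α' + β' * (w * (r + a * α)), ?_⟩
    rw [hh, hb]
    simp only [map_add, map_mul]
    module

end coordinates

/-! ### Factoriality and local intersection numbers -/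

section factorial

open IsLocalRing

/-- The intersection multiplicity of `(x)` and the curve `(c)` is the order of vanishing of the
restriction of `x` to the curve. -/
theorem length_quotient_sup_eq_ord {R A : Type u} [CommRing R] [CommRing A] (π : R →+* A)
    (hπ : Function.Surjective π) {c : R} (hker : RingHom.ker π = Ideal.span {c}) (x : R) :
    Module.length R (R ⧸ (Ideal.span {x} ⊔ Ideal.span {c})) = Ring.ord A (π x) := by
  algebraize [π]
  have hq : Function.Surjective (Ideal.Quotient.mk (Ideal.span {π x})) :=
    Ideal.Quotient.mk_surjective
  let φ : R →ₗ[R] A ⧸ Ideal.span {π x} :=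
    (Ideal.Quotient.mkₐ R (Ideal.span {π x})).toLinearMap ∘ₗ Algebra.linearMap R A
  have hφ : Function.Surjective φ := hq.comp hπ
  have hk : LinearMap.ker φ = Ideal.span {x} ⊔ Ideal.span {c} := by
    rw [← hker]
    ext y
    have h1 : y ∈ LinearMap.ker φ ↔ π y ∈ Ideal.span {π x} := Ideal.Quotient.eq_zero_iff_mem
    rw [h1, ← Set.image_singleton, ← Ideal.map_span, ← Ideal.mem_comap,
      Ideal.comap_map_of_surjective _ hπ]
    rfl
  rw [Ring.ord, ← Module.length_eq_of_surjective (S := R) (R := A) (M := A ⧸ Ideal.span {π x}) hπ,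
    ← hk]
  exact (LinearMap.quotKerEquivOfSurjective φ hφ).length_eq

variable {R A : Type u} [CommRing R] [IsDomain R] [IsLocalRing R] [IsNoetherianRing R]
  [CommRing A] [IsDomain A] [IsDiscreteValuationRing A]

/-- A Noetherian local domain with a principal prime ideal `(c)` such that the quotient by `(c)`
is a discrete valuation ring is factorial: a prime `P` that does not contain `c` has principal
image in the quotient, and `P ∩ (c) = cP`, so that `P` is principal by Nakayama's lemma. -/
theorem uniqueFactorizationMonoid_of_ker_eq_span (π : R →+* A) (hπ : Function.Surjective π)
    {c : R} (hc : c ≠ 0) (hker : RingHom.ker π = Ideal.span {c}) :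
    UniqueFactorizationMonoid R := by
  have hcp : Prime c := (Ideal.span_singleton_prime hc).mp (hker ▸ RingHom.ker_isPrime π)
  rw [UniqueFactorizationMonoid.iff_exists_prime_mem_of_isPrime]
  intro P hP hPp
  by_cases hcP : c ∈ P
  · exact ⟨c, hcP, hcp⟩
  have hprinc : (P.map π).IsPrincipal := IsPrincipalIdealRing.principal _
  obtain ⟨y', hy'⟩ := hprinc
  have hy'mem : y' ∈ P.map π := hy' ▸ Submodule.mem_span_singleton_self y'
  obtain ⟨y, hyP, rfl⟩ := (Ideal.mem_map_iff_of_surjective π hπ).mp hy'mem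
  have hcm : c ∈ maximalIdeal R := (mem_maximalIdeal c).mpr hcp.not_isUnit
  have hPy : P = Ideal.span {y} := by
    refine le_antisymm ?_ ((Ideal.span_singleton_le_iff_mem _).mpr hyP)
    refine Submodule.le_of_le_smul_of_le_jacobson_bot (I := maximalIdeal R)
      (IsNoetherian.noetherian _) (IsLocalRing.maximalIdeal_le_jacobson _) ?_
    intro x hx
    have hx' : π x ∈ Submodule.span A {π y} := hy' ▸ Ideal.mem_map_of_mem π hx
    obtain ⟨z', hz'⟩ := Submodule.mem_span_singleton.mp hx'
    obtain ⟨z, rfl⟩ := hπ z'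
    have hxz : x - z * y ∈ RingHom.ker π := by
      rw [RingHom.mem_ker, map_sub, map_mul, ← hz', smul_eq_mul, sub_self]
    rw [hker] at hxz
    obtain ⟨w, hw⟩ := Ideal.mem_span_singleton.mp hxz
    have hwP : w ∈ P := by
      have : c * w ∈ P := hw ▸ P.sub_mem hx (P.mul_mem_left z hyP)
      exact (hPp.mem_or_mem this).resolve_left hcP
    have : x = z * y + c * w := by rw [← hw]; ring
    rw [this]
    exact Submodule.add_mem_sup (Ideal.mem_span_singleton.mpr (Dvd.intro_left _ rfl))
      (Submodule.smul_mem_smul hcm hwP)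
  refine ⟨y, hyP, ?_⟩
  rw [hPy] at hPp
  refine (Ideal.span_singleton_prime ?_).mp hPp
  rintro rfl
  exact hP (by rw [hPy]; simp)

/-- Order of vanishing along a curve as a sum of local intersection multiplicities: for a family
of prime divisors `t` with ideals `I t` and orders `o t` that comprises all prime divisors except
`(c)`, the restriction of `y` to `(c)` vanishes to the order `∑ o_t(y) (I_t · (c))`. -/
theorem finite_and_ord_eq_finsum (π : R →+* A) (hπ : Function.Surjective π)
    {c : R} (hc : c ≠ 0) (hker : RingHom.ker π = Ideal.span {c})
    {T : Type*} (I : T → Ideal R) (o : T → R → ℤ)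
    (ho_mul : ∀ t x y, x ≠ 0 → y ≠ 0 → o t (x * y) = o t x + o t y)
    (ho_zero : ∀ t x, x ∉ I t → o t x = 0) (ho_one : ∀ t x, I t = Ideal.span {x} → o t x = 1)
    (hI : ∀ t, ∃ x, Prime x ∧ I t = Ideal.span {x}) (hinj : Function.Injective I)
    (hsurj : ∀ x, Prime x → ¬ c ∣ x → ∃ t, I t = Ideal.span {x}) {y : R} (hy : ¬ c ∣ y) :
    {t | o t y ≠ 0}.Finite ∧ ((Ring.ord A (π y)).toNat : ℤ) =
      ∑ᶠ t, o t y * ((Module.length R (R ⧸ (I t ⊔ Ideal.span {c}))).toNat : ℤ) := by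
  have := uniqueFactorizationMonoid_of_ker_eq_span π hπ hc hker
  induction y using UniqueFactorizationMonoid.induction_on_prime with
  | h₁ => simp at hy
  | h₂ u hu =>
    have h0 : ∀ t, o t u = 0 := by
      intro t
      obtain ⟨x, hx, hIx⟩ := hI t
      refine ho_zero t u fun hut => hx.not_isUnit ?_
      rw [hIx, Ideal.mem_span_singleton] at hut
      exact isUnit_of_dvd_unit hut hu
    constructor
    · simp [h0]
    · rw [Ring.ord_of_isUnit (hu.map π)]
      simp [h0]
  | h₃ y x hy0 hx ih =>
    obtain ⟨hfin, hsum⟩ := ih fun h => hy (h.mul_left x)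
    have hcx : ¬ c ∣ x := fun h => hy (h.mul_right y)
    obtain ⟨t₀, ht₀⟩ := hsurj x hx hcx
    have hox : ∀ t, t ≠ t₀ → o t x = 0 := by
      intro t ht
      obtain ⟨z, hz, hIz⟩ := hI t
      refine ho_zero t x fun hxt => ht (hinj ?_)
      rw [hIz, Ideal.mem_span_singleton] at hxt
      rw [hIz, ht₀, Ideal.span_singleton_eq_span_singleton]
      exact hz.associated_of_dvd hx hxt
    have hπ0 : ∀ z, ¬ c ∣ z → π z ∈ nonZeroDivisors A := by
      intro z hz
      rw [mem_nonZeroDivisors_iff_ne_zero, Ne, ← RingHom.mem_ker, hker, Ideal.mem_span_singleton]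
      exact hz
    have hfinx : {t | o t x ≠ 0}.Finite := (Set.finite_singleton t₀).subset fun t ht => by
      by_contra hne
      exact ht (hox t hne)
    have hoxy : ∀ t, o t (x * y) = o t x + o t y := fun t => ho_mul t x y hx.ne_zero hy0
    refine ⟨(hfinx.union hfin).subset fun t ht => ?_, ?_⟩
    · by_contra hne
      simp only [Set.mem_union, Set.mem_ofPred_eq, not_or, not_not] at hne
      exact ht (by rw [hoxy, hne.1, hne.2, add_zero])
    · have hxy : Ring.ord A (π (x * y)) = Ring.ord A (π x) + Ring.ord A (π y) := by
        rw [map_mul, Ring.ord_mul A (hπ0 y fun h => hy (h.mul_left x))]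
      rw [hxy, ENat.toNat_add (Ring.ord_ne_top (hπ0 x hcx))
        (Ring.ord_ne_top (hπ0 y fun h => hy (h.mul_left x))), Nat.cast_add, hsum]
      simp only [hoxy, add_mul]
      rw [finsum_add_distrib (hfinx.subset fun t ht h => ht (by simp [h]))
        (hfin.subset fun t ht h => ht (by simp [h])), finsum_eq_single (fun t => o t x * _) t₀
        (fun t ht => by simp [hox t ht]), ho_one t₀ x ht₀, one_mul, ht₀,
        length_quotient_sup_eq_ord π hπ hker]

end factorial

/-! ### Local rings of an integral scheme in its function field -/

section stalks

/-- The local rings of a scheme over a field `k` are `k`-algebras. At the generic point this is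
definitionally the `k`-algebra structure of the function field. -/
noncomputable instance stalkAlgebra {k : Type u} [Field k] (V : Scheme.{u})
    [V.Over (Spec (.of k))] (x : V) : Algebra k (V.presheaf.stalk x) :=
  RingHom.toAlgebra
    ((Scheme.ΓSpecIso (.of k)).inv ≫ (V ↘ Spec (.of k)).appTop ≫ V.presheaf.germ ⊤ x trivial).hom

section

variable {V : Scheme.{u}}

theorem stalkSpecializes_algebraMap {k : Type u} [Field k] [V.Over (Spec (.of k))] {x y : V}
    (h : x ⤳ y) (c : k) :
    (V.presheaf.stalkSpecializes h).hom (algebraMap k (V.presheaf.stalk y) c) =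
      algebraMap k (V.presheaf.stalk x) c := by
  have := V.presheaf.germ_stalkSpecializes (U := ⊤) trivial h
  exact congr($(this).hom
    ((V ↘ Spec (.of k)).appTop.hom ((Scheme.ΓSpecIso (.of k)).inv.hom c)))

/-- The maps between local rings that are induced by a morphism over `k` are `k`-linear. -/
theorem stalkMap_algebraMap {k : Type u} [Field k] {W : Scheme.{u}} [V.Over (Spec (.of k))]
    [W.Over (Spec (.of k))] (φ : W ⟶ V) [φ.IsOver (Spec (.of k))] (x : W) (c : k) :
    (φ.stalkMap x).hom (algebraMap k (V.presheaf.stalk (φ x)) c) =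
      algebraMap k (W.presheaf.stalk x) c := by
  have h2 : (W ↘ Spec (.of k)).appTop = (V ↘ Spec (.of k)).appTop ≫ φ.appTop := by
    rw [← Scheme.Hom.comp_appTop, comp_over φ]
  have h3 := Scheme.Hom.germ_stalkMap φ ⊤ x trivial
  refine (congr($(h3).hom
    ((V ↘ Spec (.of k)).appTop.hom ((Scheme.ΓSpecIso (.of k)).inv.hom c)))).trans ?_
  exact (congr((W.presheaf.germ ⊤ x trivial).hom
    ($(h2).hom ((Scheme.ΓSpecIso (.of k)).inv.hom c)))).symm

theorem mem_localIdeal {P p : V} (h : P ⤳ p) {x : V.presheaf.stalk p} :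
    x ∈ localIdeal P p ↔
      (V.presheaf.stalkSpecializes h).hom x ∈ IsLocalRing.maximalIdeal (V.presheaf.stalk P) := by
  rw [localIdeal, dif_pos h, Ideal.mem_comap]

theorem localIdeal_isPrime {P p : V} (h : P ⤳ p) : (localIdeal P p).IsPrime := by
  rw [localIdeal, dif_pos h]
  infer_instance

/-- The generizations of `p` correspond to the primes of the local ring at `p`. -/
theorem fromSpecStalk_localIdeal {P p : V} (h : P ⤳ p) :
    V.fromSpecStalk p ⟨localIdeal P p, localIdeal_isPrime h⟩ = P := by
  have h1 := Scheme.SpecMap_stalkSpecializes_fromSpecStalk h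
  have h2 : V.fromSpecStalk P (IsLocalRing.closedPoint (V.presheaf.stalk P)) = P :=
    Scheme.fromSpecStalk_closedPoint
  have h3 : (⟨localIdeal P p, localIdeal_isPrime h⟩ : PrimeSpectrum (V.presheaf.stalk p)) =
      PrimeSpectrum.comap (V.presheaf.stalkSpecializes h).hom
        (IsLocalRing.closedPoint (V.presheaf.stalk P)) := by
    ext x
    exact mem_localIdeal h
  rw [← h1] at h2
  exact (congrArg (V.fromSpecStalk p) h3).trans h2

theorem exists_localIdeal_eq (p : V) (I : Ideal (V.presheaf.stalk p)) [I.IsPrime] :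
    ∃ P : V, P ⤳ p ∧ localIdeal P p = I := by
  have hI : V.fromSpecStalk p ⟨I, ‹_›⟩ ⤳ p := by
    have : V.fromSpecStalk p ⟨I, ‹_›⟩ ∈ Set.range (V.fromSpecStalk p) := ⟨_, rfl⟩
    rwa [Scheme.range_fromSpecStalk] at this
  refine ⟨_, hI, ?_⟩
  have := (V.fromSpecStalk p).isEmbedding.injective (fromSpecStalk_localIdeal hI)
  exact congrArg PrimeSpectrum.asIdeal this

theorem localIdeal_le_iff_specializes {P Q p : V} (hP : P ⤳ p) (hQ : Q ⤳ p) :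
    localIdeal P p ≤ localIdeal Q p ↔ P ⤳ Q := by
  have := (V.fromSpecStalk p).isEmbedding.isInducing.specializes_iff
    (x := ⟨localIdeal P p, localIdeal_isPrime hP⟩) (y := ⟨localIdeal Q p, localIdeal_isPrime hQ⟩)
  rw [fromSpecStalk_localIdeal hP, fromSpecStalk_localIdeal hQ] at this
  rw [this]
  exact PrimeSpectrum.le_iff_specializes ⟨localIdeal P p, localIdeal_isPrime hP⟩
    ⟨localIdeal Q p, localIdeal_isPrime hQ⟩

end

variable {V : Scheme.{u}} [IsIntegral V]

theorem algebraMap_stalkSpecializes {x y : V} (h : x ⤳ y) (a : V.presheaf.stalk y) :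
    algebraMap (V.presheaf.stalk x) V.functionField ((V.presheaf.stalkSpecializes h).hom a) =
      algebraMap (V.presheaf.stalk y) V.functionField a := by
  have := V.presheaf.stalkSpecializes_comp
    ((genericPoint_spec V).specializes trivial : genericPoint V ⤳ x) h
  exact congr($(this).hom a)

instance stalk_isScalarTower {k : Type u} [Field k] [V.Over (Spec (.of k))] (x : V) :
    IsScalarTower k (V.presheaf.stalk x) V.functionField :=
  IsScalarTower.of_algebraMap_eq fun c =>
    (stalkSpecializes_algebraMap ((genericPoint_spec V).specializes trivial) c).symm

/-- The local ring at a generization `P` of `p` consists of fractions with denominators outside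
the prime ideal of `P`. -/
theorem exists_algebraMap_mul_eq {P p : V} (h : P ⤳ p) (a : V.presheaf.stalk P) :
    ∃ y z : V.presheaf.stalk p, z ∉ localIdeal P p ∧
      algebraMap _ V.functionField a * algebraMap _ V.functionField z =
        algebraMap _ V.functionField y := by
  obtain ⟨_, ⟨U, hU, rfl⟩, hpU, -⟩ :=
    V.isBasis_affineOpens.exists_subset_of_mem_open (Set.mem_univ p) isOpen_univ
  have hPU : P ∈ U := h.mem_open U.isOpen hpU
  have hU' : IsAffineOpen U := hU
  let _ : Algebra Γ(V, U) (V.presheaf.stalk P) := (V.presheaf.germ U P hPU).hom.toAlgebra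
  have hloc : IsLocalization.AtPrime (V.presheaf.stalk P) (hU'.primeIdealOf ⟨P, hPU⟩).asIdeal :=
    hU'.isLocalization_stalk ⟨P, hPU⟩
  obtain ⟨⟨y, z⟩, hyz⟩ := IsLocalization.surj (hU'.primeIdealOf ⟨P, hPU⟩).asIdeal.primeCompl a
  have hz : IsUnit ((V.presheaf.germ U P hPU).hom z.1) :=
    IsLocalization.map_units (V.presheaf.stalk P) z
  have hyz' : a * (V.presheaf.germ U P hPU).hom z.1 = (V.presheaf.germ U P hPU).hom y := hyz
  have hg : ∀ s, (V.presheaf.stalkSpecializes h).hom ((V.presheaf.germ U p hpU).hom s) =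
      (V.presheaf.germ U P hPU).hom s := fun s =>
    congr($(V.presheaf.germ_stalkSpecializes hpU h).hom s)
  refine ⟨(V.presheaf.germ U p hpU).hom y, (V.presheaf.germ U p hpU).hom z.1, ?_, ?_⟩
  · rw [mem_localIdeal h, hg, IsLocalRing.mem_maximalIdeal, mem_nonunits_iff, not_not]
    exact hz
  · rw [← algebraMap_stalkSpecializes h, ← algebraMap_stalkSpecializes h, hg, hg, ← map_mul, hyz']

theorem localIdeal_eq_bot_iff {P p : V} (h : P ⤳ p) : localIdeal P p = ⊥ ↔ P = genericPoint V := by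
  have hg : genericPoint V ⤳ p := (genericPoint_spec V).specializes trivial
  have hg0 : localIdeal (genericPoint V) p = ⊥ := by
    refine (Submodule.eq_bot_iff _).mpr fun x hx => ?_
    rw [mem_localIdeal hg] at hx
    have h1 := (IsLocalRing.maximalIdeal_eq_bot (R := V.functionField)) ▸ hx
    exact IsFractionRing.injective (V.presheaf.stalk p) V.functionField
      ((Ideal.mem_bot.mp h1).trans (map_zero _).symm)
  constructor
  · intro h0
    have := (localIdeal_le_iff_specializes h hg).mp (h0.le.trans bot_le)
    exact (this.antisymm ((genericPoint_spec V).specializes trivial)).eq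
  · rintro rfl
    exact hg0

end stalks

/-! ### Points of codimension one and the orders along them -/

section codimensionOne

variable {V : Scheme.{u}} [IsIntegral V]

theorem ne_genericPoint_of_coheight_eq_one {P : V} (hP : Order.coheight P = 1) :
    P ≠ genericPoint V := by
  rintro rfl
  have : Order.coheight (⊤ : V) = 0 := Order.coheight_top V
  exact zero_ne_one (this.symm.trans hP)

/-- A point of codimension one has no generizations but itself and the generic point. -/
theorem eq_of_specializes_of_coheight_eq_one {P Q : V} (h : P ⤳ Q) (hQ : Order.coheight Q = 1)
    (hP : P ≠ genericPoint V) : P = Q := by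
  by_contra hne
  have hlt : Q < P := lt_of_le_not_ge h fun h' => hne (h.antisymm h').eq
  have hlt' : P < (⊤ : V) := lt_of_le_not_ge le_top fun h' =>
    hP (Specializes.antisymm h' ((genericPoint_spec V).specializes trivial)).eq
  have h1 := Order.coheight_add_one_le hlt
  have h2 := Order.coheight_add_one_le hlt'
  rw [hQ] at h1
  have h3 : (1 : ℕ∞) + 1 ≤ 1 := by
    calc (1 : ℕ∞) + 1 ≤ (Order.coheight (⊤ : V) + 1) + 1 := by simp
      _ ≤ Order.coheight P + 1 := by gcongr
      _ ≤ 1 := h1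
  exact absurd h3 (by decide)

/-- If a prime divisor through `p` has the local equation `x` at `p`, then `x` generates the maximal
ideal of the local ring at its generic point. -/
theorem maximalIdeal_stalk_eq_span {P p : V} (h : P ⤳ p) {x : V.presheaf.stalk p}
    (hx : localIdeal P p = Ideal.span {x}) :
    IsLocalRing.maximalIdeal (V.presheaf.stalk P) =
      Ideal.span {(V.presheaf.stalkSpecializes h).hom x} := by
  refine le_antisymm (fun a ha => ?_) ?_
  · obtain ⟨y, z, hz, hyz⟩ := exists_algebraMap_mul_eq h a
    rw [← algebraMap_stalkSpecializes h, ← algebraMap_stalkSpecializes h, ← map_mul] at hyz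
    have hyz' := IsFractionRing.injective (V.presheaf.stalk P) V.functionField hyz
    have hy : y ∈ localIdeal P p := by
      rw [mem_localIdeal h, ← hyz']
      exact Ideal.mul_mem_right _ _ ha
    rw [mem_localIdeal h, IsLocalRing.mem_maximalIdeal, mem_nonunits_iff, not_not] at hz
    rw [hx] at hy
    obtain ⟨w, rfl⟩ := Ideal.mem_span_singleton.mp hy
    rw [map_mul] at hyz'
    rw [Ideal.mem_span_singleton, ← hz.dvd_mul_right, hyz']
    exact dvd_mul_right _ _
  · rw [Ideal.span_singleton_le_iff_mem, ← mem_localIdeal h, hx]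
    exact Ideal.mem_span_singleton_self x

variable [IsLocallyNoetherian V]

/-- The local ring of a normal scheme at a point of codimension one is a discrete valuation
ring. -/
theorem isDiscreteValuationRing_stalk {P : V} [IsIntegrallyClosed (V.presheaf.stalk P)]
    (hP : Order.coheight P = 1) : IsDiscreteValuationRing (V.presheaf.stalk P) := by
  have hdim := ringKrullDim_stalk_eq_coheight P
  rw [hP] at hdim
  have hf : ¬ IsField (V.presheaf.stalk P) := by
    intro h
    rw [ringKrullDim_eq_zero_of_isField h] at hdim
    exact absurd hdim (by decide)
  have htfae : IsDiscreteValuationRing (V.presheaf.stalk P) ↔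
      IsIntegrallyClosed (V.presheaf.stalk P) ∧
        ∃! I : Ideal (V.presheaf.stalk P), I ≠ ⊥ ∧ I.IsPrime :=
    (IsDiscreteValuationRing.TFAE (V.presheaf.stalk P) hf).out 0 3
  refine htfae.mpr
    ⟨‹_›, IsLocalRing.maximalIdeal _, ⟨IsLocalRing.isField_iff_maximalIdeal_eq.not.mp hf,
      inferInstance⟩, fun I hI => ?_⟩
  have : Ring.KrullDimLE 1 (V.presheaf.stalk P) := krullDimLE_of_coheight_le hP.le
  have := hI.2
  exact IsLocalRing.eq_maximalIdeal (Ideal.isMaximal_of_isPrime_of_ne_bot I hI.1)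

theorem isDiscreteValuationRing_stalk_of_localIdeal {P p : V} (h : P ⤳ p) {x : V.presheaf.stalk p}
    (hx : localIdeal P p = Ideal.span {x}) (hx0 : x ≠ 0) :
    IsDiscreteValuationRing (V.presheaf.stalk P) := by
  have hm := maximalIdeal_stalk_eq_span h hx
  have hf : ¬ IsField (V.presheaf.stalk P) := by
    rw [IsLocalRing.isField_iff_maximalIdeal_eq, hm, Ideal.span_singleton_eq_bot]
    intro h0
    have h1 := algebraMap_stalkSpecializes h x
    rw [h0, map_zero] at h1
    exact hx0 ((map_eq_zero_iff _
      (IsFractionRing.injective (V.presheaf.stalk p) V.functionField)).mp h1.symm)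
  have htfae : IsDiscreteValuationRing (V.presheaf.stalk P) ↔
      (IsLocalRing.maximalIdeal (V.presheaf.stalk P)).IsPrincipal :=
    (IsDiscreteValuationRing.TFAE (V.presheaf.stalk P) hf).out 0 4
  exact htfae.mpr ⟨_, hm⟩

theorem coheight_eq_one_of_localIdeal {P p : V} (h : P ⤳ p) {x : V.presheaf.stalk p}
    (hx : localIdeal P p = Ideal.span {x}) (hx0 : x ≠ 0) : Order.coheight P = 1 := by
  have := isDiscreteValuationRing_stalk_of_localIdeal h hx hx0
  have hdim := ringKrullDim_stalk_eq_coheight P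
  rw [IsPrincipalIdealRing.ringKrullDim_eq_one _
    (IsDiscreteValuationRing.not_isField (V.presheaf.stalk P))] at hdim
  exact_mod_cast hdim.symm

variable {P : V} [IsDiscreteValuationRing (V.presheaf.stalk P)]

theorem ord_eq_ordOf (hP : Order.coheight P = 1) {x : V.functionField} (hx : x ≠ 0) :
    Scheme.ord x P =
      ordOf ((IsDiscreteValuationRing.maximalIdeal (V.presheaf.stalk P)).valuation _) x := by
  rw [Scheme.ord_eq_iff hP hx]
  have : Ring.KrullDimLE 1 (V.presheaf.stalk P) := krullDimLE_of_coheight_le hP.le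
  change Ring.ordFrac (V.presheaf.stalk P) x = _
  rw [Ring.ordFrac_eq_valuation_inv, valuation_eq_exp_neg_ordOf _ hx, ← WithZero.exp_neg, neg_neg]
  rfl

theorem ord_nonneg_iff (hP : Order.coheight P = 1) {x : V.functionField} (hx : x ≠ 0) :
    0 ≤ Scheme.ord x P ↔ ∃ a : V.presheaf.stalk P, algebraMap _ _ a = x := by
  rw [ord_eq_ordOf hP hx, ordOf_nonneg_iff _ hx]
  constructor
  · exact IsDiscreteValuationRing.exists_lift_of_le_one
  · rintro ⟨a, rfl⟩
    exact IsDedekindDomain.HeightOneSpectrum.valuation_le_one _ a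

theorem ord_pos_iff (hP : Order.coheight P = 1) {a : V.presheaf.stalk P} (ha : a ≠ 0) :
    0 < Scheme.ord (algebraMap _ V.functionField a) P ↔
      a ∈ IsLocalRing.maximalIdeal (V.presheaf.stalk P) := by
  have ha' : algebraMap _ V.functionField a ≠ 0 := (map_ne_zero_iff _
    (IsFractionRing.injective (V.presheaf.stalk P) V.functionField)).mpr ha
  rw [ord_eq_ordOf hP ha', ordOf_pos_iff _ ha',
    IsDedekindDomain.HeightOneSpectrum.valuation_lt_one_iff_mem]
  rfl

theorem ord_neg_eq (hP : Order.coheight P = 1) (x : V.functionField) :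
    Scheme.ord (-x) P = Scheme.ord x P := by
  by_cases hx : x = 0
  · simp [hx]
  · rw [ord_eq_ordOf hP hx, ord_eq_ordOf hP (neg_ne_zero.mpr hx), ordOf, ordOf, Valuation.map_neg]

theorem ord_algebraMap_eq_zero (hP : Order.coheight P = 1) {p : V} (h : P ⤳ p)
    {a : V.presheaf.stalk p} (ha : a ∉ localIdeal P p) :
    Scheme.ord (algebraMap _ V.functionField a) P = 0 := by
  have ha0 : (V.presheaf.stalkSpecializes h).hom a ≠ 0 := by
    rw [mem_localIdeal h] at ha
    exact fun h0 => ha (h0 ▸ zero_mem _)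
  rw [mem_localIdeal h, ← ord_pos_iff hP ha0, not_lt] at ha
  rw [← algebraMap_stalkSpecializes h]
  refine le_antisymm ha ((ord_nonneg_iff hP ?_).mpr ⟨_, rfl⟩)
  exact (map_ne_zero_iff _ (IsFractionRing.injective _ _)).mpr ha0

theorem ord_algebraMap_eq_one (hP : Order.coheight P = 1) {p : V} (h : P ⤳ p)
    {x : V.presheaf.stalk p} (hx : localIdeal P p = Ideal.span {x}) :
    Scheme.ord (algebraMap _ V.functionField x) P = 1 := by
  have hirr : Irreducible ((V.presheaf.stalkSpecializes h).hom x) :=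
    (IsDiscreteValuationRing.irreducible_iff_uniformizer _).mpr (maximalIdeal_stalk_eq_span h hx)
  rw [← algebraMap_stalkSpecializes h, Scheme.ord_eq_iff hP ((map_ne_zero_iff _
    (IsFractionRing.injective (V.presheaf.stalk P) V.functionField)).mpr hirr.ne_zero)]
  exact Ring.ordFrac_irreducible hirr

end codimensionOne

/-! ### Differentials of smooth varieties -/

section differentials

/-- A smooth variety of dimension `n` has, near every point, functions `a₁, …, aₙ` whose
differentials form a basis of the differentials of all nearby local rings. -/
theorem exists_basis_kaehlerDifferential_stalk {k : Type u} [Field k] {n : ℕ} (V : Scheme.{u})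
    [V.Over (Spec (.of k))] (hV : SmoothOfRelativeDimension n (V ↘ Spec (.of k))) (x : V) :
    ∃ (U : V.Opens) (_ : x ∈ U) (a : Fin n → Γ(V, U)), ∀ (y : V) (hy : y ∈ U),
      Algebra.EssFiniteType k (V.presheaf.stalk y) ∧
      ∃ b : Module.Basis (Fin n) (V.presheaf.stalk y) (Ω[V.presheaf.stalk y⁄k]),
        ∀ i, b i = KaehlerDifferential.D k _ ((V.presheaf.germ U y hy).hom (a i)) := by
  obtain ⟨W, hW, U, hU, hxU, e, h⟩ := hV.exists_isStandardSmoothOfRelativeDimension x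
  have hWtop : W = ⊤ := by
    ext z
    have hz : z = (V ↘ Spec (.of k)) x := Subsingleton.elim (α := PrimeSpectrum k) _ _
    simp only [TopologicalSpace.Opens.coe_top, Set.mem_univ, iff_true, SetLike.mem_coe]
    exact hz ▸ e hxU
  subst hWtop
  let g : k →+* Γ(V, U) := ((Scheme.ΓSpecIso (.of k)).inv ≫ (V ↘ Spec (.of k)).appLE ⊤ U e).hom
  have hg : g.IsStandardSmoothOfRelativeDimension n := by
    have h1 := RingHom.IsStandardSmoothOfRelativeDimension.equiv
      (Scheme.ΓSpecIso (.of k)).symm.commRingCatIsoToRingEquiv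
    exact h.comp h1
  let _ : Algebra k Γ(V, U) := g.toAlgebra
  have hstd : Algebra.IsStandardSmoothOfRelativeDimension n k Γ(V, U) := hg
  have hft : Algebra.FiniteType k Γ(V, U) := by
    have := Algebra.IsStandardSmoothOfRelativeDimension.isStandardSmooth n (R := k) (S := Γ(V, U))
    infer_instance
  obtain ⟨ι, σ, _, _, P, hP⟩ := hstd.out
  have hcard : Nat.card ((Set.range P.map)ᶜ : Set ι) = n := by
    have := Fintype.ofFinite ι
    have := Fintype.ofFinite σ
    classical
    rw [← hP, Algebra.Presentation.dimension, Nat.card_eq_fintype_card, Fintype.card_compl_set,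
      Set.card_range_of_injective P.map_inj, Nat.card_eq_fintype_card, Nat.card_eq_fintype_card]
  let eqv : ((Set.range P.map)ᶜ : Set ι) ≃ Fin n := Finite.equivFinOfCardEq hcard
  refine ⟨U, hxU, fun i => P.val (eqv.symm i), fun y hy => ?_⟩
  let _ : Algebra Γ(V, U) (V.presheaf.stalk y) := (V.presheaf.germ U y hy).hom.toAlgebra
  have hloc : IsLocalization.AtPrime (V.presheaf.stalk y) (hU.primeIdealOf ⟨y, hy⟩).asIdeal :=
    hU.isLocalization_stalk ⟨y, hy⟩
  have htower : IsScalarTower k Γ(V, U) (V.presheaf.stalk y) := by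
    refine IsScalarTower.of_algebraMap_eq fun c => ?_
    have h1 : V.presheaf.map (homOfLE le_top).op ≫ V.presheaf.germ U y hy =
        V.presheaf.germ ⊤ y trivial := V.presheaf.germ_res (homOfLE le_top) y hy
    exact congr($(h1.symm).hom
      ((V ↘ Spec (.of k)).appTop.hom ((Scheme.ΓSpecIso (.of k)).inv.hom c)))
  refine ⟨?_, ?_⟩
  · have := Algebra.EssFiniteType.of_isLocalization (V.presheaf.stalk y)
      (hU.primeIdealOf ⟨y, hy⟩).asIdeal.primeCompl
    exact Algebra.EssFiniteType.comp k Γ(V, U) _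
  · let B := (P.basisKaehler.reindex eqv).ofIsLocalizedModule (V.presheaf.stalk y)
      (hU.primeIdealOf ⟨y, hy⟩).asIdeal.primeCompl
      (KaehlerDifferential.map k k Γ(V, U) (V.presheaf.stalk y))
    refine ⟨B, fun i => ?_⟩
    rw [Module.Basis.ofIsLocalizedModule_apply, Module.Basis.reindex_apply,
      Algebra.SubmersivePresentation.basisKaehler_apply, KaehlerDifferential.map_D]
    rfl

theorem specMap_algebraMap_stalk {k : Type u} [Field k] (V : Scheme.{u})
    [V.Over (Spec (.of k))] (x : V) :
    Spec.map (CommRingCat.ofHom (algebraMap k (V.presheaf.stalk x))) =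
      V.fromSpecStalk x ≫ V ↘ Spec (.of k) := by
  refine ext_of_isAffine ?_
  rw [Scheme.Hom.comp_appTop, Scheme.fromSpecStalk_appTop,
    ← cancel_mono (Scheme.ΓSpecIso (V.presheaf.stalk x)).hom, Scheme.ΓSpecIso_naturality]
  have h : CommRingCat.ofHom (algebraMap k (V.presheaf.stalk x)) =
    (Scheme.ΓSpecIso (.of k)).inv ≫ (V ↘ Spec (.of k)).appTop ≫ V.presheaf.germ ⊤ x trivial := rfl
  rw [h]
  simp

theorem residueField_algebraMap_surjective {k : Type u} [Field k] [IsAlgClosed k] (V : Scheme.{u})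
    [V.Over (Spec (.of k))] [LocallyOfFiniteType (V ↘ Spec (.of k))] {x : V}
    (hx : IsClosed {x}) :
    Function.Surjective (algebraMap k (IsLocalRing.ResidueField (V.presheaf.stalk x))) := by
  have h1 := SpecMap_residueFieldIsoBase_inv (V ↘ Spec (.of k)) x hx
  have h2 : (residueFieldIsoBase (V ↘ Spec (.of k)) x hx).inv =
      CommRingCat.ofHom (algebraMap k (V.presheaf.stalk x)) ≫ V.residue x := by
    apply Spec.map_injective
    rw [h1, Spec.map_comp, specMap_algebraMap_stalk]
    simp [Scheme.fromSpecResidueField]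
  have h3 : Function.Surjective (residueFieldIsoBase (V ↘ Spec (.of k)) x hx).inv :=
    (ConcreteCategory.bijective_of_isIso _).2
  rw [h2] at h3
  exact h3

/-- If `Ω[L⁄k]` is generated by `dt` then `L` is algebraic over `k(t)`: it is unramified. -/
theorem isAlgebraic_adjoin_of_span_D_eq_top {k L : Type u} [Field k] [Field L] [Algebra k L]
    [Algebra.EssFiniteType k L] {t : L}
    (ht : Submodule.span L {KaehlerDifferential.D k L t} = ⊤) :
    Algebra.IsAlgebraic (IntermediateField.adjoin k {t}) L := by
  let F := IntermediateField.adjoin k {t}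
  have hess : Algebra.EssFiniteType F L := Algebra.EssFiniteType.of_comp k F L
  have hD : KaehlerDifferential.D F L t = 0 :=
    (KaehlerDifferential.D F L).map_algebraMap (⟨t, IntermediateField.mem_adjoin_simple_self k t⟩ : F)
  have h0 : KaehlerDifferential.map k F L L = 0 := by
    refine LinearMap.ext_on ht fun x hx => ?_
    rw [Set.mem_singleton_iff.mp hx, KaehlerDifferential.map_D]
    exact hD
  have hsub : Subsingleton (Ω[L⁄F]) := by
    refine ⟨fun x y => ?_⟩
    obtain ⟨x, rfl⟩ := KaehlerDifferential.map_surjective k F L x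
    obtain ⟨y, rfl⟩ := KaehlerDifferential.map_surjective k F L y
    rw [h0, LinearMap.zero_apply, LinearMap.zero_apply]
  have hunr : Algebra.FormallyUnramified F L := ⟨hsub⟩
  have := Algebra.FormallyUnramified.finite_of_free F L
  infer_instance

end differentials

/-! ### The places of a smooth projective curve -/

section places

section valuative

variable {k : Type u} [Field k] (V : Scheme.{u}) [IsIntegral V] [V.Over (Spec (.of k))]
  (O : ValuationSubring V.functionField) (hk : ∀ c : k, algebraMap k V.functionField c ∈ O)

/-- The structure map `k → O` of a valuation ring that contains `k`. -/
noncomputable def toValuationSubring : k →+* O :=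
  (algebraMap k V.functionField).codRestrict O.toSubring hk

/-- The valuative square given by the generic point of `V` and a valuation ring of the function
field that contains the ground field. -/
noncomputable def genericValuativeCommSq : ValuativeCommSq (V ↘ Spec (.of k)) where
  R := O
  K := V.functionField
  i₁ := V.fromSpecStalk (genericPoint V)
  i₂ := Spec.map (CommRingCat.ofHom (toValuationSubring V O hk))
  commSq := ⟨by
    rw [← specMap_algebraMap_stalk, ← Spec.map_comp]
    rfl⟩

variable {V O}

/-- A point whose local ring is dominated by the valuation ring gives a lift in the valuative
square. -/
noncomputable def liftStructOfDominated {x : V} (e : V.presheaf.stalk x →+* O)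
    (he : ∀ a, (e a : V.functionField) = algebraMap _ _ a) :
    (genericValuativeCommSq V O hk).commSq.LiftStruct where
  l := Spec.map (CommRingCat.ofHom e) ≫ V.fromSpecStalk x
  fac_left := by
    have h : genericPoint V ⤳ x := (genericPoint_spec V).specializes trivial
    have h1 : CommRingCat.ofHom e ≫ CommRingCat.ofHom (algebraMap O V.functionField) =
        V.presheaf.stalkSpecializes h := by
      ext a
      exact he a
    have h2 : Spec.map (CommRingCat.ofHom (algebraMap O V.functionField)) ≫
        Spec.map (CommRingCat.ofHom e) ≫ V.fromSpecStalk x = V.fromSpecStalk (genericPoint V) := by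
      rw [← Category.assoc, ← Spec.map_comp, h1, Scheme.SpecMap_stalkSpecializes_fromSpecStalk]
    exact h2
  fac_right := by
    have h1 : CommRingCat.ofHom (algebraMap k (V.presheaf.stalk x)) ≫ CommRingCat.ofHom e =
        CommRingCat.ofHom (toValuationSubring V O hk) := by
      ext c
      change (e (algebraMap k _ c) : V.functionField) = algebraMap k _ c
      rw [he, ← IsScalarTower.algebraMap_apply]
    have h2 : (Spec.map (CommRingCat.ofHom e) ≫ V.fromSpecStalk x) ≫ V ↘ Spec (.of k) =
        Spec.map (CommRingCat.ofHom (toValuationSubring V O hk)) := by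
      rw [Category.assoc, ← specMap_algebraMap_stalk, ← Spec.map_comp, h1]
    exact h2

theorem liftStructOfDominated_apply {x : V} (e : V.presheaf.stalk x →+* O) [IsLocalHom e]
    (he : ∀ a, (e a : V.functionField) = algebraMap _ _ a) :
    (liftStructOfDominated hk e he).l (IsLocalRing.closedPoint O) = x := by
  have h1 : Spec.map (CommRingCat.ofHom e) (IsLocalRing.closedPoint O) =
      IsLocalRing.closedPoint (V.presheaf.stalk x) :=
    IsLocalRing.comap_closedPoint e
  exact (congrArg (V.fromSpecStalk x) h1).trans Scheme.fromSpecStalk_closedPoint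

/-- On a separated variety at most one local ring is dominated by a given valuation ring. -/
theorem eq_of_dominated [IsSeparated (V ↘ Spec (.of k))] {x y : V}
    (e : V.presheaf.stalk x →+* O) [IsLocalHom e]
    (he : ∀ a, (e a : V.functionField) = algebraMap _ _ a)
    (e' : V.presheaf.stalk y →+* O) [IsLocalHom e']
    (he' : ∀ a, (e' a : V.functionField) = algebraMap _ _ a)
    (hk : ∀ c : k, algebraMap k V.functionField c ∈ O) : x = y := by
  have := IsSeparated.valuativeCriterion (V ↘ Spec (.of k)) (genericValuativeCommSq V O hk)
  have h := Subsingleton.elim (liftStructOfDominated hk e he) (liftStructOfDominated hk e' he')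
  rw [← liftStructOfDominated_apply hk e he, h, liftStructOfDominated_apply]

/-- On a proper variety every valuation ring of the function field that contains the ground field
dominates some local ring. -/
theorem exists_dominated [IsProper (V ↘ Spec (.of k))]
    (hk : ∀ c : k, algebraMap k V.functionField c ∈ O) :
    ∃ (x : V) (e : V.presheaf.stalk x →+* O), IsLocalHom e ∧
      ∀ a, (e a : V.functionField) = algebraMap _ _ a := by
  have hp : IsProper (V ↘ Spec (.of k)) := inferInstance
  rw [IsProper.eq_valuativeCriterion] at hp
  obtain ⟨⟨l⟩⟩ := hp.1.1.1.existence (genericValuativeCommSq V O hk)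
  let f : Spec (.of O) ⟶ V := l.l
  have hf : Spec.map (CommRingCat.ofHom (algebraMap O V.functionField)) ≫ f =
      V.fromSpecStalk (genericPoint V) := l.fac_left
  refine ⟨_, (Scheme.stalkClosedPointTo f).hom, inferInstance, fun a => ?_⟩
  have h : genericPoint V ⤳ f (IsLocalRing.closedPoint O) :=
    (genericPoint_spec V).specializes trivial
  have h1 : Spec.map (Scheme.stalkClosedPointTo f ≫
      CommRingCat.ofHom (algebraMap O V.functionField)) =
      Spec.map (V.presheaf.stalkSpecializes h) := by
    rw [← cancel_mono (V.fromSpecStalk _), Spec.map_comp, Category.assoc,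
      Scheme.Spec_stalkClosedPointTo_fromSpecStalk, Scheme.SpecMap_stalkSpecializes_fromSpecStalk,
      hf]
  exact congr($(Spec.map_injective h1).hom a)

end valuative

section curve

open IsLocalRing

variable {k : Type u} [Field k] [IsAlgClosed k] {V : Scheme.{u}} [IsIntegral V]
  [IsLocallyNoetherian V] [V.Over (Spec (.of k))] [LocallyOfFiniteType (V ↘ Spec (.of k))]

/-- The local rings of a smooth curve at closed points are discrete valuation rings. -/
theorem isDiscreteValuationRing_stalk_of_isClosed
    (hV : SmoothOfRelativeDimension 1 (V ↘ Spec (.of k))) {q : V} (hq : IsClosed {q}) :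
    IsDiscreteValuationRing (V.presheaf.stalk q) := by
  obtain ⟨U, hqU, a, h⟩ := exists_basis_kaehlerDifferential_stalk V hV q
  obtain ⟨-, b, hb⟩ := h q hqU
  have hspan : Submodule.span (V.presheaf.stalk q) (Set.range fun i =>
      KaehlerDifferential.D k _ ((V.presheaf.germ U q hqU).hom (a i))) = ⊤ := by
    rw [← b.span_eq]
    congr 2
    exact funext fun i => (hb i).symm
  obtain ⟨a₀, ha₀⟩ := exists_maximalIdeal_eq_span_sub
    (residueField_algebraMap_surjective V hq) _ hspan
  have hprinc : (maximalIdeal (V.presheaf.stalk q)).IsPrincipal := by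
    refine ⟨(V.presheaf.germ U q hqU).hom (a 0) - algebraMap k _ (a₀ 0), ?_⟩
    rw [ha₀, Set.range_unique]
    rfl
  have hf : ¬ IsField (V.presheaf.stalk q) := by
    intro hf
    rw [isField_iff_maximalIdeal_eq, ha₀, Ideal.span_eq_bot] at hf
    have h0 := sub_eq_zero.mp (hf _ ⟨0, rfl⟩)
    have h1 := hb 0
    rw [h0, Derivation.map_algebraMap] at h1
    exact b.ne_zero 0 h1
  have htfae : IsDiscreteValuationRing (V.presheaf.stalk q) ↔
      (IsLocalRing.maximalIdeal (V.presheaf.stalk q)).IsPrincipal :=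
    (IsDiscreteValuationRing.TFAE (V.presheaf.stalk q) hf).out 0 4
  exact htfae.mpr hprinc

/-- A point of a smooth curve is either the generic point or closed. -/
theorem isClosed_of_ne_genericPoint [CompactSpace V]
    (hV : SmoothOfRelativeDimension 1 (V ↘ Spec (.of k))) {q : V} (hq : q ≠ genericPoint V) :
    IsClosed {q} := by
  obtain ⟨p, hp, hpc⟩ := IsClosed.exists_closed_singleton (isClosed_closure (s := {q}))
    ⟨q, subset_closure rfl⟩
  have hqp : q ⤳ p := specializes_iff_mem_closure.mpr hp
  have := isDiscreteValuationRing_stalk_of_isClosed hV hpc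
  have hprime := localIdeal_isPrime hqp
  have hmax := eq_maximalIdeal (Ideal.isMaximal_of_isPrime_of_ne_bot (localIdeal q p)
    ((localIdeal_eq_bot_iff hqp).not.mpr hq))
  have hpq : p ⤳ q := by
    rw [← localIdeal_le_iff_specializes specializes_rfl hqp, hmax]
    exact le_maximalIdeal (localIdeal_isPrime specializes_rfl).ne_top
  rwa [(hqp.antisymm hpq).eq]

end curve

section closedPointValuation

variable {k : Type u} [Field k] {V : Scheme.{u}} [IsIntegral V] [V.Over (Spec (.of k))]
  [∀ q : {q : V // IsClosed {q}}, IsDiscreteValuationRing (V.presheaf.stalk q.1)]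

/-- The valuation of the function field of a curve at a closed point. -/
noncomputable def closedPointValuation (q : {q : V // IsClosed {q}}) :
    Valuation V.functionField (WithZero (Multiplicative ℤ)) :=
  (IsDiscreteValuationRing.maximalIdeal (V.presheaf.stalk q.1)).valuation V.functionField

omit [V.Over (Spec (.of k))] in
theorem closedPointValuation_le_one_iff (q : {q : V // IsClosed {q}}) (x : V.functionField) :
    closedPointValuation q x ≤ 1 ↔ ∃ a : V.presheaf.stalk q.1, algebraMap _ _ a = x := by
  constructor
  · exact IsDiscreteValuationRing.exists_lift_of_le_one
  · rintro ⟨a, rfl⟩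
    exact IsDedekindDomain.HeightOneSpectrum.valuation_le_one _ a

theorem exists_dominates_of_forall_mem_iff (O : ValuationSubring V.functionField)
    (q : {q : V // IsClosed {q}}) (hO : ∀ x, x ∈ O ↔ closedPointValuation q x ≤ 1) :
    ∃ e : V.presheaf.stalk q.1 →+* O, IsLocalHom e ∧
      ∀ a, (e a : V.functionField) = algebraMap _ _ a := by
  refine ⟨(algebraMap _ V.functionField).codRestrict O.toSubring fun a => ?_, ⟨fun a ha => ?_⟩,
    fun a => rfl⟩
  · exact (hO _).mpr ((closedPointValuation_le_one_iff q _).mpr ⟨a, rfl⟩)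
  · obtain ⟨b, hb⟩ := ha.exists_right_inv
    obtain ⟨b', hb'⟩ := (closedPointValuation_le_one_iff q _).mp ((hO _).mp b.2)
    have h1 : algebraMap (V.presheaf.stalk q.1) V.functionField a * b = 1 := congrArg Subtype.val hb
    rw [← hb', ← map_mul, ← map_one (algebraMap (V.presheaf.stalk q.1) V.functionField)] at h1
    exact IsUnit.of_mul_eq_one _ (IsFractionRing.injective _ V.functionField h1)

/-- The closed points of a complete smooth curve are the places of its function field: by the
valuative criterion each valuation ring dominates exactly one local ring. -/
theorem isPlaceFamily_closedPointValuation [IsProper (V ↘ Spec (.of k))]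
    (hV : ∀ x : V, x ≠ genericPoint V → IsClosed {x}) :
    IsPlaceFamily k (closedPointValuation (V := V)) where
  le_one q c := (closedPointValuation_le_one_iff q _).mpr
    ⟨algebraMap k _ c, (IsScalarTower.algebraMap_apply ..).symm⟩
  exists_uniformizer q :=
    IsDedekindDomain.HeightOneSpectrum.valuation_exists_uniformizer V.functionField
      (IsDiscreteValuationRing.maximalIdeal (V.presheaf.stalk q.1))
  injective q q' h := by
    have hk : ∀ c : k, algebraMap k V.functionField c ∈ (closedPointValuation q).valuationSubring :=
      fun c => (closedPointValuation_le_one_iff q _).mpr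
        ⟨algebraMap k _ c, (IsScalarTower.algebraMap_apply ..).symm⟩
    obtain ⟨e, h1, h2⟩ := exists_dominates_of_forall_mem_iff
      (closedPointValuation q).valuationSubring q fun x => Iff.rfl
    obtain ⟨e', h1', h2'⟩ := exists_dominates_of_forall_mem_iff
      (closedPointValuation q).valuationSubring q' fun x => by rw [← h]; rfl
    exact Subtype.ext (eq_of_dominated e h2 e' h2' hk)
  exhaustive O hk hO := by
    obtain ⟨x, e, hloc, he⟩ := exists_dominated hk
    have hx : x ≠ genericPoint V := by
      rintro rfl
      refine hO (top_unique fun y _ => ?_)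
      have h1 : (e y : V.functionField) = y :=
        (he y).trans congr($(V.presheaf.stalkSpecializes_refl (genericPoint V)).hom y)
      rw [← h1]
      exact (e y).2
    refine ⟨⟨x, hV x hx⟩, ?_⟩
    ext y
    have hy : y ∈ (closedPointValuation ⟨x, hV x hx⟩).valuationSubring ↔
        ∃ a : V.presheaf.stalk x, algebraMap _ _ a = y :=
      closedPointValuation_le_one_iff ⟨x, hV x hx⟩ y
    rw [hy]
    constructor
    · rintro ⟨a, rfl⟩
      rw [← he]
      exact (e a).2
    · intro hyO
      by_contra hn
      have hdvr : IsDiscreteValuationRing (V.presheaf.stalk x) :=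
        inferInstanceAs (IsDiscreteValuationRing (V.presheaf.stalk
          (⟨x, hV x hx⟩ : {q : V // IsClosed {q}}).1))
      have hy0 : y ≠ 0 := by
        rintro rfl
        exact hn ⟨0, map_zero _⟩
      obtain ⟨a, ha⟩ := (ValuationRing.isInteger_or_isInteger (V.presheaf.stalk x) y).resolve_left hn
      have hea : IsUnit (e a) := by
        refine IsUnit.of_mul_eq_one ⟨y, hyO⟩ (Subtype.ext ?_)
        change (e a : V.functionField) * y = 1
        rw [he, ha, inv_mul_cancel₀ hy0]
      obtain ⟨b, hb⟩ := (isUnit_of_map_unit e a hea).exists_right_inv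
      refine hn ⟨b, ?_⟩
      have := congrArg (algebraMap (V.presheaf.stalk x) V.functionField) hb
      rw [map_mul, ha, map_one] at this
      exact ((inv_mul_eq_one₀ hy0).mp this).symm

end closedPointValuation

end places

/-! ### The vector field on a curve that is induced by a two-form -/

section pairing

open KaehlerDifferential

variable {k K : Type u} [Field k] [Field K] [Algebra k K]

/-- The alternating pairing `b` on the differentials of a field of transcendence degree two that
corresponds to a two-form `ω`, so that `x ∧ y = b(x, y) ω`. -/
structure IsFormPairing (ω : ⋀[K]^2 (Ω[K⁄k])) (b : Ω[K⁄k] →ₗ[K] Ω[K⁄k] →ₗ[K] K) : Prop where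
  self_eq_zero : ∀ x, b x x = 0
  ιMulti_eq : ∀ x : Fin 2 → Ω[K⁄k], exteriorPower.ιMulti K 2 x = b (x 0) (x 1) • ω

variable {ω : ⋀[K]^2 (Ω[K⁄k])} {b : Ω[K⁄k] →ₗ[K] Ω[K⁄k] →ₗ[K] K}

theorem IsFormPairing.swap (hb : IsFormPairing ω b) (x y : Ω[K⁄k]) : b y x = -b x y := by
  have h := hb.self_eq_zero (x + y)
  simp only [map_add, LinearMap.add_apply, hb.self_eq_zero, zero_add, add_zero] at h
  exact eq_neg_of_add_eq_zero_left h

theorem IsFormPairing.apply_combination (hb : IsFormPairing ω b) (x y : Ω[K⁄k]) (α β α' β' : K) :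
    b (α • x + β • y) (α' • x + β' • y) = b x y * (α * β' - β * α') := by
  simp only [map_add, LinearMap.add_apply, map_smul, LinearMap.smul_apply, hb.self_eq_zero,
    hb.swap x y, smul_eq_mul]
  ring

theorem IsFormPairing.ne_zero (hb : IsFormPairing ω b) (hω : ω ≠ 0) {x y : Ω[K⁄k]}
    (h : ∀ z, ∃ α β : K, z = α • x + β • y) : b x y ≠ 0 := by
  intro h0
  have h1 : ∀ z w, b z w = 0 := by
    intro z w
    obtain ⟨α, β, rfl⟩ := h z
    obtain ⟨α', β', rfl⟩ := h w
    rw [hb.apply_combination, h0, zero_mul]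
  have h2 : ω ∈ Submodule.span K (Set.range (exteriorPower.ιMulti K 2 (M := Ω[K⁄k]))) := by
    rw [exteriorPower.ιMulti_span]
    trivial
  have h3 : Submodule.span K (Set.range (exteriorPower.ιMulti K 2 (M := Ω[K⁄k]))) = ⊥ := by
    rw [Submodule.span_eq_bot]
    rintro _ ⟨x, rfl⟩
    rw [hb.ιMulti_eq, h1, zero_smul]
  rw [h3] at h2
  exact hω h2

/-- Let `ϖ` generate the kernel of `ρ : O → L`. If `c {ϖ, h}` is integral for all `h ∈ O`, then
`h ↦ c {ϖ, h}` induces a derivation of `L`, since `{ϖ, ϖ h} = ϖ {ϖ, h}`. -/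
theorem exists_derivation_of_pairing (hb : IsFormPairing ω b) {O L : Type u} [CommRing O]
    [Algebra k O] [Algebra O K] [IsScalarTower k O K] (hinj : Function.Injective (algebraMap O K))
    [Field L] [Algebra k L] (ρ : O →ₐ[k] L) (hρ : Function.Surjective ρ) {ϖ : O}
    (hϖ : ρ ϖ = 0) (hker : ∀ a, ρ a = 0 → ϖ ∣ a) (c : K)
    (H : ∀ h : O, ∃ t : O, algebraMap O K t =
      c * b (D k K (algebraMap O K ϖ)) (D k K (algebraMap O K h))) :
    ∃ δ : Derivation k L L, ∀ h t : O, algebraMap O K t =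
      c * b (D k K (algebraMap O K ϖ)) (D k K (algebraMap O K h)) → δ (ρ h) = ρ t := by
  choose T hT using H
  let d : Derivation k O O := Derivation.mk'
    { toFun := T
      map_add' := fun x y => hinj (by simp only [map_add, hT]; ring)
      map_smul' := fun r x => hinj (by
        rw [hT, RingHom.id_apply, Algebra.smul_def, map_mul, ← IsScalarTower.algebraMap_apply,
          ← Algebra.smul_def, Derivation.map_smul, Algebra.smul_def, map_mul, hT,
          ← IsScalarTower.algebraMap_apply, ← algebraMap_smul K r, map_smul, smul_eq_mul]
        ring) }
    (fun x y => hinj (by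
      change algebraMap O K (T (x * y)) = algebraMap O K (x * T y + y * T x)
      rw [hT, map_mul, Derivation.leibniz, map_add, map_smul, map_smul, map_add, map_mul, map_mul,
        hT, hT, smul_eq_mul, smul_eq_mul]
      ring))
  have hd : ∀ x, ρ x = 0 → ρ (d x) = 0 := by
    intro x hx
    obtain ⟨y, rfl⟩ := hker x hx
    have h1 : T (ϖ * y) = ϖ * T y := hinj (by
      rw [hT, map_mul, Derivation.leibniz, map_add, map_smul, map_smul, hb.self_eq_zero, map_mul,
        hT, smul_eq_mul, smul_zero, add_zero]
      ring)
    change ρ (T (ϖ * y)) = 0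
    rw [h1, map_mul, hϖ, zero_mul]
  refine ⟨Derivation.liftOfSurjective hρ hd, fun h t ht => ?_⟩
  rw [Derivation.liftOfSurjective_apply]
  congr 1
  exact hinj ((hT h).trans ht.symm)

/-- The vector field of `exists_derivation_of_pairing` in local coordinates `c, s` at a point of
the curve: the curve is given by `c`, where `ϖ = υ c`, and the vector field is generated near the
point by its value `C υ {c, s}` at `s`. -/
theorem derivation_of_pairing_eq {R O A L : Type u} [CommRing R]
    [CommRing O] [CommRing A] [Field L] [Algebra k L] [Algebra R K] [Algebra O K] [Algebra A L]
    (j : R →+* O) (hj : ∀ r, algebraMap O K (j r) = algebraMap R K r)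
    (π : R →+* A) (hπ : Function.Surjective π) (ρ : O →+* L)
    (hcomm : ∀ r, ρ (j r) = algebraMap A L (π r))
    {ϖ υ υ' a : O} {c s : R} (hϖ : ϖ = υ * j c) (hυ : υ * υ' = 1) (hc : π c = 0) {C : K}
    (ha : algebraMap O K a = C * (algebraMap O K υ *
      b (D k K (algebraMap R K c)) (D k K (algebraMap R K s))))
    (hD : ∀ h : R, ∃ α β : R, D k K (algebraMap R K h) =
      algebraMap R K α • D k K (algebraMap R K c) + algebraMap R K β • D k K (algebraMap R K s))
    (hDO : ∀ h h' : O, ∃ g : O, b (D k K (algebraMap O K h)) (D k K (algebraMap O K h')) =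
      b (D k K (algebraMap R K c)) (D k K (algebraMap R K s)) * algebraMap O K g)
    (H : ∀ h : O, ∃ t : O, algebraMap O K t =
      C * b (D k K (algebraMap O K ϖ)) (D k K (algebraMap O K h)))
    {δ : Derivation k L L} (hδ : ∀ h t : O, algebraMap O K t =
      C * b (D k K (algebraMap O K ϖ)) (D k K (algebraMap O K h)) → δ (ρ h) = ρ t) :
    δ (algebraMap A L (π s)) = ρ a ∧
      ∀ x : A, ∃ β : A, δ (algebraMap A L x) = algebraMap A L β * δ (algebraMap A L (π s)) := by
  have hρc : ρ (j c) = 0 := by rw [hcomm, hc, map_zero]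
  constructor
  · -- `C {υ c, s} = C υ {c, s} + C c {υ, s}`, and the second term is a multiple of `c`.
    obtain ⟨g, hg⟩ := hDO υ (j s)
    have ht : algebraMap O K (a + a * (j c * υ' * g)) =
        C * b (D k K (algebraMap O K ϖ)) (D k K (algebraMap O K (j s))) := by
      have h1 : algebraMap O K υ * algebraMap O K υ' = 1 := by rw [← map_mul, hυ, map_one]
      rw [hϖ, map_mul (algebraMap O K) υ, Derivation.leibniz, map_add b, LinearMap.add_apply,
        map_smul, map_smul, LinearMap.smul_apply, LinearMap.smul_apply, hg,
        map_add, map_mul, map_mul, map_mul, ha, hj, hj, smul_eq_mul, smul_eq_mul]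
      linear_combination (C * b (D k K (algebraMap R K c)) (D k K (algebraMap R K s)) *
        algebraMap R K c * algebraMap O K g) * h1
    rw [← hcomm, hδ _ _ ht, map_add, map_mul, map_mul, map_mul, hρc]
    ring
  · intro x
    obtain ⟨h, rfl⟩ := hπ x
    obtain ⟨α, β, hαβ⟩ := hD h
    obtain ⟨tc, htc⟩ := H (j c)
    obtain ⟨ts, hts⟩ := H (j s)
    refine ⟨π β, ?_⟩
    have ht : algebraMap O K (j α * tc + j β * ts) =
        C * b (D k K (algebraMap O K ϖ)) (D k K (algebraMap O K (j h))) := by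
      rw [hj, hαβ, map_add (algebraMap O K), map_mul, map_mul, htc, hts, hj, hj, hj, hj, map_add, map_smul, map_smul,
        smul_eq_mul, smul_eq_mul]
      ring
    have htc0 : ρ tc = 0 := by rw [← hδ _ _ htc, hρc, map_zero]
    rw [← hcomm, hδ _ _ ht, map_add, map_mul, map_mul, htc0, mul_zero, zero_add, ← hcomm, ← hcomm,
      hδ _ _ hts]

end pairing

/-! ### Coordinates on a smooth surface and the canonical divisor -/

section coordinatePair

open KaehlerDifferential

/-- The regular functions `x, y` at the point `P` of a surface are coordinates near `P`: their
differentials generate the differentials of all regular functions at `P`. -/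
structure IsCoordinatePair (k : Type u) [Field k] {Z : Scheme.{u}} [IsIntegral Z]
    [Z.Over (Spec (.of k))] (P : Z) (x y : Z.functionField) : Prop where
  left : ∃ a : Z.presheaf.stalk P, algebraMap _ _ a = x
  right : ∃ a : Z.presheaf.stalk P, algebraMap _ _ a = y
  exists_D_eq : ∀ h : Z.presheaf.stalk P, ∃ α β : Z.presheaf.stalk P,
    D k Z.functionField (algebraMap _ _ h) = algebraMap _ Z.functionField α • D k Z.functionField x +
      algebraMap _ Z.functionField β • D k Z.functionField y

variable {k : Type u} [Field k] {Z : Scheme.{u}} [IsIntegral Z] [Z.Over (Spec (.of k))]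

namespace IsCoordinatePair

theorem of_specializes {P p : Z} (h : P ⤳ p) {x y : Z.functionField}
    (hxy : IsCoordinatePair k p x y) : IsCoordinatePair k P x y where
  left := by
    obtain ⟨a, rfl⟩ := hxy.left
    exact ⟨_, algebraMap_stalkSpecializes h a⟩
  right := by
    obtain ⟨a, rfl⟩ := hxy.right
    exact ⟨_, algebraMap_stalkSpecializes h a⟩
  exists_D_eq f := by
    -- for `f = y / z` the quotient rule gives `df = z⁻¹ (dy - f dz)`
    obtain ⟨y', z, hz, hyz⟩ := exists_algebraMap_mul_eq h f
    rw [mem_localIdeal h, IsLocalRing.mem_maximalIdeal, mem_nonunits_iff, not_not] at hz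
    obtain ⟨w, hw⟩ := hz.exists_left_inv
    obtain ⟨α, β, hy⟩ := hxy.exists_D_eq y'
    obtain ⟨α', β', hz'⟩ := hxy.exists_D_eq z
    have hw' : algebraMap _ Z.functionField w * algebraMap _ Z.functionField z = 1 := by
      rw [← algebraMap_stalkSpecializes h, ← map_mul, hw, map_one]
    let j := (Z.presheaf.stalkSpecializes h).hom
    have hj : ∀ a, algebraMap _ Z.functionField (j a) = algebraMap _ Z.functionField a :=
      algebraMap_stalkSpecializes h
    refine ⟨w * (j α - f * j α'), w * (j β - f * j β'), ?_⟩
    have h1 := congrArg (D k Z.functionField) hyz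
    rw [Derivation.leibniz, hy, hz'] at h1
    have h2 : D k Z.functionField (algebraMap _ Z.functionField f) =
        algebraMap _ Z.functionField w • (algebraMap _ Z.functionField z •
          D k Z.functionField (algebraMap _ Z.functionField f)) := by
      rw [smul_smul, hw', one_smul]
    rw [h2, eq_sub_iff_add_eq'.mpr h1]
    simp only [map_mul, map_sub, hj]
    module

theorem exists_eq_combination {P : Z} {x y : Z.functionField} (hxy : IsCoordinatePair k P x y)
    (z : Ω[Z.functionField⁄k]) : ∃ α β : Z.functionField,
      z = α • D k Z.functionField x + β • D k Z.functionField y := by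
  have hg := hxy.of_specializes (P := genericPoint Z) ((genericPoint_spec Z).specializes trivial)
  have hz : z ∈ Submodule.span Z.functionField (Set.range (D k Z.functionField)) := by
    rw [span_range_derivation]
    trivial
  have hle : Submodule.span Z.functionField (Set.range (D k Z.functionField)) ≤
      Submodule.span Z.functionField {D k Z.functionField x, D k Z.functionField y} := by
    rw [Submodule.span_le]
    rintro _ ⟨h, rfl⟩
    obtain ⟨α, β, hαβ⟩ := hg.exists_D_eq h
    have h0 : (Z.presheaf.stalkSpecializes ((genericPoint_spec Z).specializes trivial :
        genericPoint Z ⤳ genericPoint Z)).hom h = h :=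
      congr($(Z.presheaf.stalkSpecializes_refl (genericPoint Z)).hom h)
    refine Submodule.mem_span_pair.mpr ⟨_, _, hαβ.symm.trans ?_⟩
    exact congrArg (D k Z.functionField) h0
  obtain ⟨α, β, h⟩ := Submodule.mem_span_pair.mp (hle hz)
  exact ⟨α, β, h.symm⟩

variable {ω : RationalForm k 2 Z}
  {b : Ω[Z.functionField⁄k] →ₗ[Z.functionField] Ω[Z.functionField⁄k] →ₗ[Z.functionField]
    Z.functionField}

theorem pairing_ne_zero (hb : IsFormPairing ω b) (hω : ω ≠ 0) {P : Z} {x y : Z.functionField}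
    (hxy : IsCoordinatePair k P x y) :
    b (D k Z.functionField x) (D k Z.functionField y) ≠ 0 :=
  hb.ne_zero hω hxy.exists_eq_combination

theorem exists_pairing_eq (hb : IsFormPairing ω b) {P : Z} {x y : Z.functionField}
    (hxy : IsCoordinatePair k P x y) (f h : Z.presheaf.stalk P) :
    ∃ g : Z.presheaf.stalk P,
      b (D k Z.functionField (algebraMap _ _ f)) (D k Z.functionField (algebraMap _ _ h)) =
        b (D k Z.functionField x) (D k Z.functionField y) * algebraMap _ _ g := by
  obtain ⟨α, β, hf⟩ := hxy.exists_D_eq f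
  obtain ⟨α', β', hh⟩ := hxy.exists_D_eq h
  refine ⟨α * β' - β * α', ?_⟩
  rw [hf, hh, hb.apply_combination]
  simp only [map_sub, map_mul]

variable [IsLocallyNoetherian Z]

theorem formOrder_eq (hb : IsFormPairing ω b) (hω : ω ≠ 0) {P : Z}
    [IsDiscreteValuationRing (Z.presheaf.stalk P)] (hP : Order.coheight P = 1)
    {x y : Z.functionField} (hxy : IsCoordinatePair k P x y) :
    formOrder k (fun f : Z.functionField => Scheme.ord f P) ω =
      -Scheme.ord (b (D k Z.functionField x) (D k Z.functionField y)) P := by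
  have hmem : ∀ f : Z.functionField, (f = 0 ∨ 0 ≤ Scheme.ord f P) ↔
      ∃ a : Z.presheaf.stalk P, algebraMap _ _ a = f := by
    intro f
    by_cases hf : f = 0
    · subst hf
      simp only [true_or, true_iff]
      exact ⟨0, map_zero _⟩
    · rw [ord_nonneg_iff hP hf]
      simp [hf]
  have hnonneg : ∀ f : Z.functionField, (∃ a : Z.presheaf.stalk P, algebraMap _ _ a = f) →
      0 ≤ Scheme.ord f P := by
    intro f hf
    rcases (hmem f).mpr hf with rfl | h
    · simp
    · exact h
  refine formOrder_eq_neg (v := fun f => Scheme.ord f P) (fun f g hf hg => Scheme.ord_mul hf hg)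
    (fun f g _ _ h => Scheme.ord_add h) (fun f => ord_neg_eq hP f) hω hb.ιMulti_eq
    (hnonneg x hxy.left) (hnonneg y hxy.right) (hxy.pairing_ne_zero hb hω) ?_
  intro f h hf hh
  obtain ⟨f, rfl⟩ := (hmem f).mp hf
  obtain ⟨h, rfl⟩ := (hmem h).mp hh
  obtain ⟨g, hg⟩ := hxy.exists_pairing_eq hb f h
  exact ⟨_, (hmem _).mpr ⟨g, rfl⟩, hg⟩

end IsCoordinatePair

/-- A smooth surface has coordinates near each point. -/
theorem exists_isCoordinatePair (hZ : SmoothOfRelativeDimension 2 (Z ↘ Spec (.of k))) (p : Z) :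
    ∃ (U : Z.Opens) (_ : p ∈ U) (x y : Z.functionField), ∀ P ∈ U, IsCoordinatePair k P x y := by
  obtain ⟨U, hpU, a, h⟩ := exists_basis_kaehlerDifferential_stalk Z hZ p
  have : Nonempty U := ⟨⟨p, hpU⟩⟩
  refine ⟨U, hpU, Z.germToFunctionField U (a 0), Z.germToFunctionField U (a 1), fun P hP => ?_⟩
  obtain ⟨-, b, hb⟩ := h P hP
  have hspan : Submodule.span (Z.presheaf.stalk P)
      {D k (Z.presheaf.stalk P) ((Z.presheaf.germ U P hP).hom (a 0)),
        D k (Z.presheaf.stalk P) ((Z.presheaf.germ U P hP).hom (a 1))} = ⊤ := by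
    rw [← b.span_eq, ← hb 0, ← hb 1]
    congr 1
    ext z
    simp [Fin.exists_fin_two, eq_comm]
  have h0 := Scheme.algebraMap_germ_eq_germToFunctionField Z hP (a 0)
  have h1 := Scheme.algebraMap_germ_eq_germToFunctionField Z hP (a 1)
  refine ⟨⟨_, h0⟩, ⟨_, h1⟩, fun f => ?_⟩
  rw [← h0, ← h1]
  exact exists_D_eq_of_span_eq_top (K := Z.functionField) hspan f

end coordinatePair

/-! ### A smooth curve on a smooth surface: local computation -/

section curveOnSurface

open KaehlerDifferential IsLocalRing

variable {Z C : Scheme.{u}} [IsIntegral C] (i : C ⟶ Z)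

theorem image_genericPoint_specializes (q : C) : i (genericPoint C) ⤳ i q :=
  ((genericPoint_spec C).specializes trivial).map i.continuous

/-- Restriction to the curve commutes with localization at its generic point. -/
theorem stalkMap_genericPoint_stalkSpecializes (q : C) (r : Z.presheaf.stalk (i q)) :
    (i.stalkMap (genericPoint C)).hom
      ((Z.presheaf.stalkSpecializes (image_genericPoint_specializes i q)).hom r) =
      algebraMap (C.presheaf.stalk q) C.functionField ((i.stalkMap q).hom r) :=
  congr($(Scheme.Hom.stalkSpecializes_stalkMap i (genericPoint C) q
    ((genericPoint_spec C).specializes trivial)).hom r)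

theorem mem_maximalIdeal_iff_stalkMap_eq_zero (a : Z.presheaf.stalk (i (genericPoint C))) :
    a ∈ maximalIdeal (Z.presheaf.stalk (i (genericPoint C))) ↔
      (i.stalkMap (genericPoint C)).hom a = 0 := by
  have h : IsLocalHom (i.stalkMap (genericPoint C)).hom := inferInstance
  rw [mem_maximalIdeal, ← map_mem_nonunits_iff (i.stalkMap (genericPoint C)).hom, mem_nonunits_iff]
  exact (isUnit_iff_ne_zero (G₀ := C.functionField)).not.trans not_not

/-- The ideal of the curve in the local ring of a point on it is the kernel of restriction. -/
theorem localIdeal_image_genericPoint (q : C) :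
    localIdeal (i (genericPoint C)) (i q) = RingHom.ker (i.stalkMap q).hom := by
  ext r
  rw [mem_localIdeal (image_genericPoint_specializes i q), mem_maximalIdeal_iff_stalkMap_eq_zero,
    stalkMap_genericPoint_stalkSpecializes, RingHom.mem_ker]
  exact map_eq_zero_iff _ (IsFractionRing.injective (C.presheaf.stalk q) C.functionField)

variable {k : Type u} [Field k] [IsIntegral Z] [IsLocallyNoetherian Z] [Z.Over (Spec (.of k))]
  [IsClosedImmersion i]

/-- At a closed point of the curve the surface has coordinates `c, s` such that `c` is an equation
of the curve. -/
theorem exists_isCoordinatePair_of_isClosed [IsAlgClosed k] [LocallyOfFiniteType (Z ↘ Spec (.of k))]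
    (hZ : SmoothOfRelativeDimension 2 (Z ↘ Spec (.of k))) {q : C} (hq : IsClosed {q})
    [IsDiscreteValuationRing (C.presheaf.stalk q)] :
    ∃ c s : Z.presheaf.stalk (i q), RingHom.ker (i.stalkMap q).hom = Ideal.span {c} ∧
      IsCoordinatePair k (i q) (algebraMap _ _ c) (algebraMap _ _ s) := by
  have hp : IsClosed {i q} := by
    rw [← Set.image_singleton]
    exact i.isClosedEmbedding.isClosedMap _ hq
  obtain ⟨U, hpU, a, h⟩ := exists_basis_kaehlerDifferential_stalk Z hZ (i q)
  obtain ⟨-, b, hb⟩ := h _ hpU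
  have hspan : Submodule.span (Z.presheaf.stalk (i q)) (Set.range fun j =>
      D k (Z.presheaf.stalk (i q)) ((Z.presheaf.germ U _ hpU).hom (a j))) = ⊤ := by
    rw [← b.span_eq]
    congr 2
    exact funext fun j => (hb j).symm
  obtain ⟨a₀, ha₀⟩ := exists_maximalIdeal_eq_span_sub
    (residueField_algebraMap_surjective Z hp) _ hspan
  have hrange : ∀ {M : Type u} (g : Fin 2 → M), Set.range g = {g 0, g 1} := by
    intro M g
    ext z
    simp [Fin.exists_fin_two, eq_comm]
  rw [hrange] at ha₀
  rw [hrange] at hspan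
  obtain ⟨c, s, -, hker, -, hD⟩ := exists_adapted_coordinates (k := k) (K := Z.functionField)
    (i.stalkMap q).hom (i.stalkMap_surjective q) ha₀ (fun f => by
      obtain ⟨α, β, h⟩ := exists_D_eq_of_span_eq_top (K := Z.functionField) hspan f
      refine ⟨α, β, ?_⟩
      rw [h, map_sub, map_sub, map_sub, map_sub, ← IsScalarTower.algebraMap_apply,
        ← IsScalarTower.algebraMap_apply, Derivation.map_algebraMap, Derivation.map_algebraMap,
        sub_zero, sub_zero])
  exact ⟨c, s, hker, ⟨c, rfl⟩, ⟨s, rfl⟩, hD⟩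

variable {i} {ω : RationalForm k 2 Z}
  {b : Ω[Z.functionField⁄k] →ₗ[Z.functionField] Ω[Z.functionField⁄k] →ₗ[Z.functionField]
    Z.functionField}

/-- The coefficient along `P` of the divisor of the form `ω / f ^ (κ + 1)`, where `κ` is the order
of `ω` along `P₀`. If `f` has order one along `P₀`, the components other than `P₀` of this divisor
cut out on `P₀` the divisor of the residue of that form. -/
noncomputable def adjunctionCoeff (ω : RationalForm k 2 Z) (f : Z.functionField) (P₀ P : Z) : ℤ :=
  formOrder k (fun g : Z.functionField => Scheme.ord g P) ω -
    (formOrder k (fun g : Z.functionField => Scheme.ord g P₀) ω + 1) * Scheme.ord f P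

theorem ord_zpow {P : Z} [IsDiscreteValuationRing (Z.presheaf.stalk P)]
    (hP : Order.coheight P = 1) {f : Z.functionField} (hf : f ≠ 0) (n : ℤ) :
    Scheme.ord (f ^ n) P = n * Scheme.ord f P := by
  rw [ord_eq_ordOf hP hf, ord_eq_ordOf hP (zpow_ne_zero n hf), ordOf, ordOf, map_zpow₀,
    WithZero.log_zpow]
  simp

/-- The form `ω / f ^ (κ + 1)`, where `f` has order one along the curve, has a residue along the
curve, that is a one-form on the curve; `δ` is the vector field dual to it. -/
theorem exists_derivation_functionField [C.Over (Spec (.of k))] [i.IsOver (Spec (.of k))]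
    (hb : IsFormPairing ω b) (hω : ω ≠ 0)
    [IsDiscreteValuationRing (Z.presheaf.stalk (i (genericPoint C)))]
    (hP : Order.coheight (i (genericPoint C)) = 1) {x y : Z.functionField}
    (hxy : IsCoordinatePair k (i (genericPoint C)) x y)
    {ϖ : Z.presheaf.stalk (i (genericPoint C))}
    (hϖ : Scheme.ord (algebraMap _ Z.functionField ϖ) (i (genericPoint C)) = 1) :
    (∀ h : Z.presheaf.stalk (i (genericPoint C)), ∃ t : Z.presheaf.stalk (i (genericPoint C)),
      algebraMap _ Z.functionField t = algebraMap _ Z.functionField ϖ ^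
        formOrder k (fun g : Z.functionField => Scheme.ord g (i (genericPoint C))) ω *
        b (D k _ (algebraMap _ _ ϖ)) (D k _ (algebraMap _ _ h))) ∧
    ∃ δ : Derivation k C.functionField C.functionField,
      ∀ h t : Z.presheaf.stalk (i (genericPoint C)),
      algebraMap _ Z.functionField t = algebraMap _ Z.functionField ϖ ^
        formOrder k (fun g : Z.functionField => Scheme.ord g (i (genericPoint C))) ω *
        b (D k _ (algebraMap _ _ ϖ)) (D k _ (algebraMap _ _ h)) →
      δ ((i.stalkMap (genericPoint C)).hom h) = (i.stalkMap (genericPoint C)).hom t := by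
  set κ := formOrder k (fun g : Z.functionField => Scheme.ord g (i (genericPoint C))) ω with hκ
  have hκ' := hxy.formOrder_eq hb hω hP
  rw [← hκ] at hκ'
  set e := b (D k Z.functionField x) (D k Z.functionField y) with he
  have he0 : e ≠ 0 := hxy.pairing_ne_zero hb hω
  have hϖ0 : algebraMap _ Z.functionField ϖ ≠ 0 := by
    intro h0
    rw [h0, Scheme.ord_zero] at hϖ
    exact zero_ne_one hϖ
  have hinj := IsFractionRing.injective (Z.presheaf.stalk (i (genericPoint C))) Z.functionField
  -- `ϖ ^ κ {x, y}` is a unit at the generic point of the curve, as `{x, y}` has order `-κ` there.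
  obtain ⟨w, hw⟩ := (ord_nonneg_iff hP (mul_ne_zero (zpow_ne_zero κ hϖ0) he0)).mp (by
    rw [Scheme.ord_mul (zpow_ne_zero κ hϖ0) he0, ord_zpow hP hϖ0, hϖ, hκ']
    simp)
  have H : ∀ h : Z.presheaf.stalk (i (genericPoint C)),
      ∃ t : Z.presheaf.stalk (i (genericPoint C)), algebraMap _ Z.functionField t =
        algebraMap _ Z.functionField ϖ ^ κ *
          b (D k _ (algebraMap _ _ ϖ)) (D k _ (algebraMap _ _ h)) := by
    intro h
    obtain ⟨g, hg⟩ := hxy.exists_pairing_eq hb ϖ h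
    exact ⟨w * g, by rw [hg, map_mul, hw, mul_assoc]⟩
  refine ⟨H, ?_⟩
  let ρ : Z.presheaf.stalk (i (genericPoint C)) →ₐ[k] C.functionField :=
    { (i.stalkMap (genericPoint C)).hom with
      commutes' := fun c => stalkMap_algebraMap i (genericPoint C) c }
  have hϖ0' : ϖ ≠ 0 := fun h0 => hϖ0 (by rw [h0, map_zero])
  have hϖm : ϖ ∈ maximalIdeal (Z.presheaf.stalk (i (genericPoint C))) :=
    (ord_pos_iff hP hϖ0').mp (by rw [hϖ]; exact one_pos)
  refine exists_derivation_of_pairing hb hinj ρ (i.stalkMap_surjective (genericPoint C))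
    ((mem_maximalIdeal_iff_stalkMap_eq_zero i ϖ).mp hϖm) (fun a ha => ?_) _ H
  by_cases ha0 : a = 0
  · rw [ha0]
    exact dvd_zero _
  have ha0' : algebraMap _ Z.functionField a ≠ 0 := (map_ne_zero_iff _ hinj).mpr ha0
  have hapos := (ord_pos_iff hP ha0).mpr ((mem_maximalIdeal_iff_stalkMap_eq_zero i a).mpr ha)
  obtain ⟨g, hg⟩ := (ord_nonneg_iff hP (mul_ne_zero ha0' (zpow_ne_zero (-1) hϖ0))).mp (by
    rw [Scheme.ord_mul ha0' (zpow_ne_zero (-1) hϖ0), ord_zpow hP hϖ0, hϖ]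
    omega)
  refine ⟨g, hinj ?_⟩
  rw [map_mul, hg, zpow_neg_one]
  field_simp

end curveOnSurface

section localIntersection

open KaehlerDifferential IsLocalRing

/-- The local intersection multiplicity at `p` of two integral curves on a smooth surface, given by
their generic points. -/
noncomputable def localIntersection {V : Scheme.{u}} (P Q p : V) : ℤ :=
  ((Module.length (V.presheaf.stalk p)
    (V.presheaf.stalk p ⧸ (localIdeal P p ⊔ localIdeal Q p))).toNat : ℤ)

theorem curveIntersection_eq_finsum {V : Scheme.{u}} (P Q : V) :
    curveIntersection P Q = ∑ᶠ p, localIntersection P Q p := rfl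

theorem localIntersection_nonneg {V : Scheme.{u}} (P Q p : V) : 0 ≤ localIntersection P Q p :=
  Int.natCast_nonneg _

theorem specializes_of_localIntersection_ne_zero {V : Scheme.{u}} {P Q p : V}
    (h : localIntersection P Q p ≠ 0) : P ⤳ p ∧ Q ⤳ p := by
  have key : localIdeal P p ⊔ localIdeal Q p ≠ ⊤ := by
    intro htop
    refine h ?_
    have : Subsingleton (V.presheaf.stalk p ⧸ (localIdeal P p ⊔ localIdeal Q p)) :=
      Ideal.Quotient.subsingleton_iff.mpr htop
    rw [localIntersection, Module.length_eq_zero]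
    rfl
  constructor
  · by_contra hP
    exact key (by rw [localIdeal, dif_neg hP, top_sup_eq])
  · by_contra hP
    have h1 : localIdeal Q p = ⊤ := dif_neg hP
    exact key (by rw [h1, sup_top_eq])

theorem ordOf_algebraMap_eq_ord {A L : Type*} [CommRing A] [IsDomain A]
    [IsDiscreteValuationRing A] [Field L] [Algebra A L] [IsFractionRing A L] {x : A} (hx : x ≠ 0) :
    ordOf ((IsDiscreteValuationRing.maximalIdeal A).valuation L) (algebraMap A L x) =
      ((Ring.ord A x).toNat : ℤ) := by
  obtain ⟨ϖ, hϖ⟩ := IsDiscreteValuationRing.exists_irreducible A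
  obtain ⟨n, w, rfl⟩ := IsDiscreteValuationRing.eq_unit_mul_pow_irreducible hx hϖ
  have h1 : Ring.ord A (↑w * ϖ ^ n) = n := by
    rw [Ring.ord_eq_addVal, IsDiscreteValuationRing.addVal_def' w hϖ]
  have h2 := Ring.ordFrac_eq_valuation_inv (R := A) (K := L) (algebraMap A L (↑w * ϖ ^ n))
  rw [Ring.ordFrac_eq_ord A hx, Ring.ordMonoidWithZeroHom_eq_coe A
    (mem_nonZeroDivisors_of_ne_zero hx) h1] at h2
  rw [ordOf, h1, ← inv_inv ((IsDedekindDomain.HeightOneSpectrum.valuation L _) _), ← h2,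
    WithZero.log_inv, neg_neg]
  rfl

variable {Z C : Scheme.{u}} [IsIntegral C] {i : C ⟶ Z} [IsIntegral Z] [IsLocallyNoetherian Z]
  [IsClosedImmersion i] {q : C} {c : Z.presheaf.stalk (i q)}

/-- Order of vanishing on the curve `c = 0` of the restriction of a regular function, as a sum over
the prime divisors of that function. -/
theorem ord_stalkMap_eq_finsum [IsDiscreteValuationRing (C.presheaf.stalk q)]
    (hZ : ∀ x : Z, IsIntegrallyClosed (Z.presheaf.stalk x))
    (hker : RingHom.ker (i.stalkMap q).hom = Ideal.span {c}) (hc : c ≠ 0)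
    {y : Z.presheaf.stalk (i q)} (hy : (i.stalkMap q).hom y ≠ 0) :
    {P | Order.coheight P = 1 ∧ P ≠ i (genericPoint C) ∧ P ⤳ i q ∧
      Scheme.ord (algebraMap _ Z.functionField y) P ≠ 0}.Finite ∧
    ordOf ((IsDiscreteValuationRing.maximalIdeal (C.presheaf.stalk q)).valuation C.functionField)
      (algebraMap _ _ ((i.stalkMap q).hom y)) =
    ∑ᶠ (P : Z) (_ : Order.coheight P = 1 ∧ P ≠ i (genericPoint C)),
      Scheme.ord (algebraMap _ Z.functionField y) P *
        localIntersection P (i (genericPoint C)) (i q) := by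
  -- The prime divisors through `i q`, except the curve.
  let T := {P : Z // (Order.coheight P = 1 ∧ P ≠ i (genericPoint C)) ∧ P ⤳ i q}
  have hloc := localIdeal_image_genericPoint i q
  rw [hker] at hloc
  have hcy : ¬ c ∣ y := by
    rwa [← Ideal.mem_span_singleton, ← hker, RingHom.mem_ker]
  have hDVR : ∀ t : T, IsDiscreteValuationRing (Z.presheaf.stalk t.1) := fun t =>
    have := hZ t.1
    isDiscreteValuationRing_stalk t.2.1.1
  have hinj : Function.Injective (algebraMap (Z.presheaf.stalk (i q)) Z.functionField) :=
    IsFractionRing.injective _ _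
  have hgen : ∀ P : Z, P ⤳ i q → localIdeal P (i q) ≠ ⊥ → P ≠ genericPoint Z :=
    fun P h h' h'' => h' ((localIdeal_eq_bot_iff h).mpr h'')
  have hUFD := uniqueFactorizationMonoid_of_ker_eq_span _ (i.stalkMap_surjective q) hc hker
  obtain ⟨hfin, hord⟩ := finite_and_ord_eq_finsum (i.stalkMap q).hom (i.stalkMap_surjective q) hc
    hker (T := T) (fun t => localIdeal t.1 (i q))
    (fun t x => Scheme.ord (algebraMap _ Z.functionField x) t.1)
    (fun t x y hx hy => by
      rw [map_mul, Scheme.ord_mul ((map_ne_zero_iff _ hinj).mpr hx) ((map_ne_zero_iff _ hinj).mpr hy)])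
    (fun t x hx => have := hDVR t; ord_algebraMap_eq_zero t.2.1.1 t.2.2 hx)
    (fun t x hx => have := hDVR t; ord_algebraMap_eq_one t.2.1.1 t.2.2 hx)
    (fun t => by
      have hprime := localIdeal_isPrime t.2.2
      have hbot : localIdeal t.1 (i q) ≠ ⊥ := fun h =>
        ne_genericPoint_of_coheight_eq_one t.2.1.1 ((localIdeal_eq_bot_iff t.2.2).mp h)
      obtain ⟨x, hxt, hx⟩ := hprime.exists_mem_prime_of_ne_bot hbot
      refine ⟨x, hx, ?_⟩
      have : (Ideal.span {x}).IsPrime := (Ideal.span_singleton_prime hx.ne_zero).mpr hx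
      obtain ⟨P, hP, hPx⟩ := exists_localIdeal_eq (i q) (Ideal.span {x})
      rw [← hPx]
      have hle : localIdeal P (i q) ≤ localIdeal t.1 (i q) := by
        rw [hPx, Ideal.span_le]
        simpa using hxt
      rw [eq_of_specializes_of_coheight_eq_one ((localIdeal_le_iff_specializes hP t.2.2).mp hle)
        t.2.1.1 (hgen P hP (by rw [hPx]; simpa using hx.ne_zero))])
    (fun t t' h => Subtype.ext (Specializes.antisymm
      ((localIdeal_le_iff_specializes t.2.2 t'.2.2).mp h.le)
      ((localIdeal_le_iff_specializes t'.2.2 t.2.2).mp h.ge)).eq)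
    (fun x hx hcx => by
      have : (Ideal.span {x}).IsPrime := (Ideal.span_singleton_prime hx.ne_zero).mpr hx
      obtain ⟨P, hP, hPx⟩ := exists_localIdeal_eq (i q) (Ideal.span {x})
      refine ⟨⟨P, ⟨coheight_eq_one_of_localIdeal hP hPx hx.ne_zero, ?_⟩, hP⟩, hPx⟩
      rintro rfl
      have : x ∈ Ideal.span {c} := by
        rw [← hloc, hPx]
        exact Ideal.mem_span_singleton_self x
      exact hcx (Ideal.mem_span_singleton.mp this)) hcy
  constructor
  · refine (hfin.image Subtype.val).subset ?_
    rintro P ⟨h1, h2, h3, h4⟩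
    exact ⟨⟨P, ⟨h1, h2⟩, h3⟩, h4, rfl⟩
  · have hy0 : ((i.stalkMap q).hom y) ≠ 0 := hy
    rw [ordOf_algebraMap_eq_ord hy0, hord]
    refine (finsum_subtype_eq_finsum_cond (f := fun P : Z =>
      Scheme.ord (algebraMap _ Z.functionField y) P * ((Module.length (Z.presheaf.stalk (i q))
        (Z.presheaf.stalk (i q) ⧸ (localIdeal P (i q) ⊔ Ideal.span {c}))).toNat : ℤ)) _).trans ?_
    refine finsum_congr fun P => ?_
    by_cases hP : P ⤳ i q
    · rw [← hloc]
      simp only [hP, and_true]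
      rfl
    · have h0 : localIntersection P (i (genericPoint C)) (i q) = 0 := by
        by_contra h
        exact hP (specializes_of_localIntersection_ne_zero h).1
      simp [hP, h0]

theorem finsum_mem_sub_of_finite {α M : Type*} [AddCommGroup M] {f g : α → M} {s : Set α}
    (hf : (s ∩ Function.support f).Finite) (hg : (s ∩ Function.support g).Finite) :
    ∑ᶠ x ∈ s, (f x - g x) = ∑ᶠ x ∈ s, f x - ∑ᶠ x ∈ s, g x := by
  rw [← Set.support_indicator] at hf hg
  simp only [finsum_mem_def, Set.indicator_sub]
  exact finsum_sub_distrib hf hg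

/-- The version of `ord_stalkMap_eq_finsum` for a rational function that is a unit at the generic
point of the curve. -/
theorem ordOf_stalkMap_genericPoint_eq_finsum [IsDiscreteValuationRing (C.presheaf.stalk q)]
    (hZ : ∀ x : Z, IsIntegrallyClosed (Z.presheaf.stalk x))
    (hker : RingHom.ker (i.stalkMap q).hom = Ideal.span {c}) (hc : c ≠ 0)
    {a : Z.presheaf.stalk (i (genericPoint C))} (ha : (i.stalkMap (genericPoint C)).hom a ≠ 0) :
    ordOf ((IsDiscreteValuationRing.maximalIdeal (C.presheaf.stalk q)).valuation C.functionField)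
      ((i.stalkMap (genericPoint C)).hom a) =
    ∑ᶠ (P : Z) (_ : Order.coheight P = 1 ∧ P ≠ i (genericPoint C)),
      Scheme.ord (algebraMap _ Z.functionField a) P *
        localIntersection P (i (genericPoint C)) (i q) := by
  obtain ⟨y, z, hz, hyz⟩ := exists_algebraMap_mul_eq (image_genericPoint_specializes i q) a
  rw [localIdeal_image_genericPoint, RingHom.mem_ker] at hz
  have hinj := IsFractionRing.injective (C.presheaf.stalk q) C.functionField
  have hinj' := IsFractionRing.injective (Z.presheaf.stalk (i q)) Z.functionField
  have hyz' : (i.stalkMap (genericPoint C)).hom a * algebraMap _ C.functionField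
      ((i.stalkMap q).hom z) = algebraMap _ C.functionField ((i.stalkMap q).hom y) := by
    rw [← algebraMap_stalkSpecializes (image_genericPoint_specializes i q),
      ← algebraMap_stalkSpecializes (image_genericPoint_specializes i q), ← map_mul] at hyz
    have h := IsFractionRing.injective (Z.presheaf.stalk (i (genericPoint C))) Z.functionField hyz
    rw [← stalkMap_genericPoint_stalkSpecializes, ← stalkMap_genericPoint_stalkSpecializes, ← h,
      map_mul]
  have hz' : algebraMap _ C.functionField ((i.stalkMap q).hom z) ≠ 0 :=
    (map_ne_zero_iff _ hinj).mpr hz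
  have hy : (i.stalkMap q).hom y ≠ 0 := by
    intro h0
    rw [h0, map_zero] at hyz'
    exact mul_ne_zero ha hz' hyz'
  obtain ⟨hfy, hoy⟩ := ord_stalkMap_eq_finsum hZ hker hc hy
  obtain ⟨hfz, hoz⟩ := ord_stalkMap_eq_finsum hZ hker hc hz
  have h0 : ∀ w : Z.presheaf.stalk (i q), (i.stalkMap q).hom w ≠ 0 →
      algebraMap _ Z.functionField w ≠ 0 := fun w hw hw' =>
    hw (by rw [(map_eq_zero_iff _ hinj').mp hw', map_zero])
  have ha0 : algebraMap _ Z.functionField a ≠ 0 := by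
    intro ha0
    rw [ha0, zero_mul] at hyz
    exact h0 y hy hyz.symm
  have hord : ∀ P, Scheme.ord (algebraMap _ Z.functionField a) P =
      Scheme.ord (algebraMap _ Z.functionField y) P -
        Scheme.ord (algebraMap _ Z.functionField z) P := by
    intro P
    rw [← hyz, Scheme.ord_mul ha0 (h0 z hz), add_sub_cancel_right]
  have hfin : ∀ w : Z.presheaf.stalk (i q), {P | Order.coheight P = 1 ∧
      P ≠ i (genericPoint C) ∧ P ⤳ i q ∧ Scheme.ord (algebraMap _ Z.functionField w) P ≠ 0}.Finite →
      ({P | Order.coheight P = 1 ∧ P ≠ i (genericPoint C)} ∩ Function.support fun P =>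
        Scheme.ord (algebraMap _ Z.functionField w) P *
          localIntersection P (i (genericPoint C)) (i q)).Finite := by
    intro w hw
    refine hw.subset ?_
    rintro P ⟨⟨h1, h2⟩, h3⟩
    exact ⟨h1, h2, (specializes_of_localIntersection_ne_zero (right_ne_zero_of_mul h3)).1,
      left_ne_zero_of_mul h3⟩
  rw [← hyz', ordOf_mul _ ha hz'] at hoy
  rw [eq_sub_of_add_eq hoy, hoz]
  refine (finsum_mem_sub_of_finite (hfin y hfy) (hfin z hfz)).symm.trans ?_
  refine finsum_congr fun P => finsum_congr fun _ => ?_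
  rw [hord, sub_mul]

variable {k : Type u} [Field k] [IsAlgClosed k] [Z.Over (Spec (.of k))]
  [LocallyOfFiniteType (Z ↘ Spec (.of k))] [C.Over (Spec (.of k))]
  {ω : RationalForm k 2 Z}
  {b : Ω[Z.functionField⁄k] →ₗ[Z.functionField] Ω[Z.functionField⁄k] →ₗ[Z.functionField]
    Z.functionField}

/-- The adjunction formula near a point `q` of the curve: the vector field dual to the residue of
`ω / f ^ (κ + 1)` is generated near `q` by its value at a local coordinate, whose order is given by
the local intersection multiplicities of the curve with the divisor of `ω / f ^ (κ + 1)`. -/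
theorem exists_ordOf_derivation_eq (hZ : ∀ x : Z, IsIntegrallyClosed (Z.presheaf.stalk x))
    (hZ2 : SmoothOfRelativeDimension 2 (Z ↘ Spec (.of k)))
    (hb : IsFormPairing ω b) (hω : ω ≠ 0) (hq : IsClosed {q})
    [IsDiscreteValuationRing (C.presheaf.stalk q)]
    [IsDiscreteValuationRing (Z.presheaf.stalk (i (genericPoint C)))]
    (hP : Order.coheight (i (genericPoint C)) = 1)
    {ϖ : Z.presheaf.stalk (i (genericPoint C))}
    (hϖ : Scheme.ord (algebraMap _ Z.functionField ϖ) (i (genericPoint C)) = 1)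
    (H : ∀ h : Z.presheaf.stalk (i (genericPoint C)), ∃ t : Z.presheaf.stalk (i (genericPoint C)),
      algebraMap _ Z.functionField t = algebraMap _ Z.functionField ϖ ^
        formOrder k (fun g : Z.functionField => Scheme.ord g (i (genericPoint C))) ω *
        b (D k _ (algebraMap _ _ ϖ)) (D k _ (algebraMap _ _ h)))
    {δ : Derivation k C.functionField C.functionField}
    (hδ : ∀ h t : Z.presheaf.stalk (i (genericPoint C)),
      algebraMap _ Z.functionField t = algebraMap _ Z.functionField ϖ ^
        formOrder k (fun g : Z.functionField => Scheme.ord g (i (genericPoint C))) ω *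
        b (D k _ (algebraMap _ _ ϖ)) (D k _ (algebraMap _ _ h)) →
      δ ((i.stalkMap (genericPoint C)).hom h) = (i.stalkMap (genericPoint C)).hom t) :
    ∃ s : C.functionField, δ s ≠ 0 ∧
      (∀ x : C.functionField,
        (IsDiscreteValuationRing.maximalIdeal (C.presheaf.stalk q)).valuation _ x ≤ 1 →
        (IsDiscreteValuationRing.maximalIdeal (C.presheaf.stalk q)).valuation _ (δ x) ≤
          (IsDiscreteValuationRing.maximalIdeal (C.presheaf.stalk q)).valuation _ (δ s)) ∧
      ordOf ((IsDiscreteValuationRing.maximalIdeal (C.presheaf.stalk q)).valuation _) (δ s) =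
        ∑ᶠ (P : Z) (_ : Order.coheight P = 1 ∧ P ≠ i (genericPoint C)),
          -adjunctionCoeff ω (algebraMap _ Z.functionField ϖ) (i (genericPoint C)) P *
            localIntersection P (i (genericPoint C)) (i q) := by
  obtain ⟨c, s, hker, hcs⟩ := exists_isCoordinatePair_of_isClosed i hZ2 hq
  have hsp := image_genericPoint_specializes i q
  have hcs' := hcs.of_specializes hsp
  have he0 := hcs.pairing_ne_zero hb hω
  have hc' : algebraMap _ Z.functionField c ≠ 0 := by
    intro h0
    rw [h0, map_zero, map_zero, LinearMap.zero_apply] at he0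
    exact he0 rfl
  have hc : c ≠ 0 := fun h0 => hc' (by rw [h0, map_zero])
  have hloc := (localIdeal_image_genericPoint i q).trans hker
  have hκ := hcs'.formOrder_eq hb hω hP
  set κ := formOrder k (fun g : Z.functionField => Scheme.ord g (i (genericPoint C))) ω
  have hinj := IsFractionRing.injective (Z.presheaf.stalk (i (genericPoint C))) Z.functionField
  have hϖ' : algebraMap _ Z.functionField ϖ ≠ 0 := by
    intro h0
    rw [h0, Scheme.ord_zero] at hϖ
    exact zero_ne_one hϖ
  have hϖ0 : ϖ ≠ 0 := fun h0 => hϖ' (by rw [h0, map_zero])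
  have hϖm := (ord_pos_iff hP hϖ0).mp (by rw [hϖ]; exact one_pos)
  rw [maximalIdeal_stalk_eq_span hsp hloc, Ideal.mem_span_singleton'] at hϖm
  obtain ⟨υ, hυ⟩ := hϖm
  have hυ' : algebraMap _ Z.functionField υ * algebraMap _ Z.functionField c =
      algebraMap _ Z.functionField ϖ := by
    rw [← hυ, map_mul, algebraMap_stalkSpecializes]
  have hυ0' : algebraMap _ Z.functionField υ ≠ 0 := by
    intro h0
    rw [h0, zero_mul] at hυ'
    exact hϖ' hυ'.symm
  have hυ0 : υ ≠ 0 := fun h0 => hυ0' (by rw [h0, map_zero])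
  have hordυ : ∀ P, Scheme.ord (algebraMap _ Z.functionField ϖ) P =
      Scheme.ord (algebraMap _ Z.functionField υ) P +
        Scheme.ord (algebraMap _ Z.functionField c) P := by
    intro P
    rw [← hυ', Scheme.ord_mul hυ0' hc']
  have hυP : Scheme.ord (algebraMap _ Z.functionField υ) (i (genericPoint C)) = 0 := by
    have h1 := hordυ (i (genericPoint C))
    rw [hϖ, ord_algebraMap_eq_one hP hsp hloc] at h1
    omega
  obtain ⟨υ', hυυ'⟩ : ∃ υ', υ * υ' = 1 := by
    by_contra! h
    have hnu : ¬ IsUnit υ := fun hu => h _ hu.mul_val_inv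
    have := (ord_pos_iff hP hυ0).mpr hnu
    omega
  -- `δ s` is the restriction of `G = ϖ ^ κ υ {c, s}`, which is a unit at the generic point of the
  -- curve; elsewhere near `i q` the divisor of `G` is that of `f ^ (κ + 1) / ω`.
  have hG0 : algebraMap _ Z.functionField ϖ ^ κ * (algebraMap _ Z.functionField υ *
      b (D k _ (algebraMap _ _ c)) (D k _ (algebraMap _ _ s))) ≠ 0 :=
    mul_ne_zero (zpow_ne_zero _ hϖ') (mul_ne_zero hυ0' he0)
  have hordG : ∀ P, IsDiscreteValuationRing (Z.presheaf.stalk P) → Order.coheight P = 1 →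
      Scheme.ord (algebraMap _ Z.functionField ϖ ^ κ * (algebraMap _ Z.functionField υ *
        b (D k _ (algebraMap _ _ c)) (D k _ (algebraMap _ _ s)))) P =
      κ * Scheme.ord (algebraMap _ Z.functionField ϖ) P +
        (Scheme.ord (algebraMap _ Z.functionField υ) P +
          Scheme.ord (b (D k _ (algebraMap _ _ c)) (D k _ (algebraMap _ _ s))) P) := by
    intro P _ hP1
    rw [Scheme.ord_mul (zpow_ne_zero _ hϖ') (mul_ne_zero hυ0' he0), Scheme.ord_mul hυ0' he0,
      ord_zpow hP1 hϖ']
  have hG : Scheme.ord (algebraMap _ Z.functionField ϖ ^ κ * (algebraMap _ Z.functionField υ *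
      b (D k _ (algebraMap _ _ c)) (D k _ (algebraMap _ _ s)))) (i (genericPoint C)) = 0 := by
    rw [hordG _ inferInstance hP, hϖ, hυP]
    omega
  obtain ⟨a, ha⟩ := (ord_nonneg_iff hP hG0).mp hG.ge
  have ha0 : a ≠ 0 := fun h0 => hG0 (by rw [← ha, h0, map_zero])
  have hρa : (i.stalkMap (genericPoint C)).hom a ≠ 0 := by
    intro h0
    have := (ord_pos_iff hP ha0).mpr ((mem_maximalIdeal_iff_stalkMap_eq_zero i a).mpr h0)
    rw [ha] at this
    omega
  obtain ⟨h1, h2⟩ := derivation_of_pairing_eq (Z.presheaf.stalkSpecializes hsp).hom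
    (algebraMap_stalkSpecializes hsp) (i.stalkMap q).hom (i.stalkMap_surjective q)
    (i.stalkMap (genericPoint C)).hom (stalkMap_genericPoint_stalkSpecializes i q) hυ.symm hυυ'
    (by rw [← RingHom.mem_ker, hker]; exact Ideal.mem_span_singleton_self c) ha hcs.exists_D_eq
    (hcs'.exists_pairing_eq hb) H hδ
  refine ⟨_, h1 ▸ hρa, fun x hx => ?_, ?_⟩
  · obtain ⟨x, rfl⟩ := IsDiscreteValuationRing.exists_lift_of_le_one hx
    obtain ⟨β, hβ⟩ := h2 x
    rw [hβ, map_mul]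
    exact mul_le_of_le_one_left' (IsDedekindDomain.HeightOneSpectrum.valuation_le_one _ β)
  · rw [h1, ordOf_stalkMap_genericPoint_eq_finsum hZ hker hc hρa]
    refine finsum_congr fun P => finsum_congr fun hP1 => ?_
    by_cases h0 : localIntersection P (i (genericPoint C)) (i q) = 0
    · rw [h0, mul_zero, mul_zero]
    have hPq := (specializes_of_localIntersection_ne_zero h0).1
    have := hZ P
    have hDVR := isDiscreteValuationRing_stalk hP1.1
    have hcP : Scheme.ord (algebraMap _ Z.functionField c) P = 0 := by
      refine ord_algebraMap_eq_zero hP1.1 hPq fun hc => hP1.2 ?_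
      -- a curve other than `c = 0` does not lie in the zero locus of `c`
      refine (eq_of_specializes_of_coheight_eq_one ((localIdeal_le_iff_specializes hsp hPq).mp ?_)
        hP1.1 (ne_genericPoint_of_coheight_eq_one hP)).symm
      rw [hloc, Ideal.span_le]
      simpa using hc
    rw [ha, hordG P hDVR hP1.1, adjunctionCoeff, (hcs.of_specializes hPq).formOrder_eq hb hω hP1.1,
      hordυ, hcP]
    ring

end localIntersection

/-! ### Finiteness of supports -/

section finiteness

open KaehlerDifferential TopologicalSpace

/-- A set of points that are maximal under generization in a closed subset of a noetherian space
is finite. -/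
theorem finite_of_forall_specializes_eq {X : Type*} [TopologicalSpace X] [NoetherianSpace X]
    [QuasiSober X] {T S : Set X} (hT : IsClosed T) (hST : S ⊆ T)
    (hS : ∀ x ∈ S, ∀ y ∈ T, y ⤳ x → y = x) : S.Finite := by
  obtain ⟨F, hF, hFc, hFirr, hFT⟩ := NoetherianSpace.exists_finite_set_isClosed_irreducible hT
  choose g hg using fun Y : F => QuasiSober.sober (hFirr Y Y.2) (hFc Y Y.2)
  have := hF.to_subtype
  refine (Set.finite_range g).subset fun x hx => ?_
  have hxT := hST hx
  rw [hFT] at hxT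
  obtain ⟨Y, hY, hxY⟩ := hxT
  refine ⟨⟨Y, hY⟩, hS x hx _ ?_ ((hg ⟨Y, hY⟩).specializes hxY)⟩
  rw [hFT]
  exact ⟨Y, hY, (hg ⟨Y, hY⟩).mem⟩

variable {Z : Scheme.{u}} [IsIntegral Z]

/-- A proper closed subset contains only finitely many prime divisors. -/
theorem finite_coheight_eq_one [NoetherianSpace Z] {T : Set Z} (hT : IsClosed T)
    (hgen : genericPoint Z ∉ T) : {P | Order.coheight P = 1 ∧ P ∈ T}.Finite := by
  refine finite_of_forall_specializes_eq hT (fun P hP => hP.2) fun P hP Q hQ h => ?_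
  exact eq_of_specializes_of_coheight_eq_one h hP.1 (by rintro rfl; exact hgen hQ)

variable [IsLocallyNoetherian Z]

theorem finite_ord_ne_zero [NoetherianSpace Z] {f : Z.functionField} (hf : f ≠ 0) :
    {P : Z | Scheme.ord f P ≠ 0}.Finite := by
  obtain ⟨U, hU, s, rfl⟩ := Z.presheaf.exists_germ_eq f
  have : Nonempty U := ⟨⟨_, hU⟩⟩
  refine (finite_coheight_eq_one (T := (Z.basicOpen s : Set Z)ᶜ)
    (Z.basicOpen s).isOpen.isClosed_compl ?_).subset fun P hP => ⟨?_, fun h => hP ?_⟩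
  · have hs : IsUnit (Z.presheaf.germ U _ hU s) := (isUnit_iff_ne_zero (G₀ := Z.functionField)).mpr hf
    exact fun h => h ((Z.mem_basicOpen s _ hU).mpr hs)
  · by_contra h
    exact hP (Scheme.ord_eq_zero_of_coheight_neq_one h _)
  · have hne : Nonempty (Z.basicOpen s) := ⟨⟨P, h⟩⟩
    have hunit : IsUnit ((Z.presheaf.map (homOfLE (Z.basicOpen_le s)).op).hom s) :=
      Z.toRingedSpace.isUnit_res_basicOpen s
    refine Eq.trans (congrArg (Scheme.ord · P) ?_) (Scheme.ord_of_isUnit hunit h)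
    exact (Z.presheaf.germ_res_apply (homOfLE (Z.basicOpen_le s)) _ _ s).symm

variable {k : Type u} [Field k] [Z.Over (Spec (.of k))]

theorem finite_formOrder_ne_zero [NoetherianSpace Z]
    (hZ : ∀ x : Z, IsIntegrallyClosed (Z.presheaf.stalk x))
    (hZ2 : SmoothOfRelativeDimension 2 (Z ↘ Spec (.of k)))
    {ω : RationalForm k 2 Z} (hω : ω ≠ 0)
    {b : Ω[Z.functionField⁄k] →ₗ[Z.functionField] Ω[Z.functionField⁄k] →ₗ[Z.functionField]
      Z.functionField} (hb : IsFormPairing ω b) :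
    {P : Z | Order.coheight P = 1 ∧
      formOrder k (fun f : Z.functionField => Scheme.ord f P) ω ≠ 0}.Finite := by
  choose U hU x y hxy using exists_isCoordinatePair (k := k) hZ2
  obtain ⟨t, ht⟩ := CompactSpace.elim_nhds_subcover (fun p => (U p : Set Z))
    (fun p => (U p).isOpen.mem_nhds (hU p))
  refine (t.finite_toSet.biUnion fun p _ => finite_ord_ne_zero
    ((hxy p p (hU p)).pairing_ne_zero hb hω)).subset ?_
  rintro P ⟨hP, hP'⟩
  obtain ⟨p, hp, hPp⟩ := Set.mem_iUnion₂.mp (ht.ge (Set.mem_univ P))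
  have := hZ P
  have := isDiscreteValuationRing_stalk hP
  refine Set.mem_iUnion₂.mpr ⟨p, hp, fun h => hP' ?_⟩
  rw [(hxy p P hPp).formOrder_eq hb hω hP, h, neg_zero]

theorem finite_algebraicCycle_ne_zero {V : Scheme.{u}} [CompactSpace V] (B : AlgebraicCycle V ℝ) :
    {P | B P ≠ 0}.Finite :=
  (B.locallyFiniteSupport.finite_inter_support_of_isCompact isCompact_univ).subset
    fun _ hP => ⟨trivial, hP⟩

omit [IsLocallyNoetherian Z] in
/-- Two distinct curves meet in finitely many points, all of them closed. -/
theorem finite_localIntersection_ne_zero {C : Scheme.{u}} [IsIntegral C] (i : C ⟶ Z)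
    [IsClosedImmersion i] [NoetherianSpace C]
    (hC : ∀ q : C, q ≠ genericPoint C → IsClosed {q})
    (hξ : Order.coheight (i (genericPoint C)) = 1) {P : Z} (hP : Order.coheight P = 1)
    (hne : P ≠ i (genericPoint C)) :
    {q : C | localIntersection P (i (genericPoint C)) (i q) ≠ 0}.Finite ∧
      ∀ q : C, localIntersection P (i (genericPoint C)) (i q) ≠ 0 → IsClosed {q} := by
  have hgen : ∀ q : C, i q ∈ closure {P} → IsClosed {q} := by
    intro q hq
    refine hC q ?_
    rintro rfl
    exact hne (eq_of_specializes_of_coheight_eq_one (specializes_iff_mem_closure.mpr hq) hξ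
      (ne_genericPoint_of_coheight_eq_one hP))
  have hmem : ∀ q : C, localIntersection P (i (genericPoint C)) (i q) ≠ 0 → i q ∈ closure {P} :=
    fun q hq => specializes_iff_mem_closure.mp (specializes_of_localIntersection_ne_zero hq).1
  refine ⟨finite_of_forall_specializes_eq (T := i ⁻¹' closure {P})
    (isClosed_closure.preimage i.continuous) hmem fun q hq r hr h => ?_, fun q hq => hgen q (hmem q hq)⟩
  have hqr := specializes_iff_mem_closure.mp h
  rw [(hgen r hr).closure_eq] at hqr
  exact hqr.symm

end finiteness

/-! ### The adjunction inequality -/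

section adjunction

open KaehlerDifferential TopologicalSpace

variable {k : Type u} [Field k] [IsAlgClosed k]

/-- The degree of a vector field on a smooth proper curve is at most two. -/
theorem sum_ordOf_derivation_le_two_of_isProper [CharZero k] {C : Scheme.{u}} [IsIntegral C]
    [IsLocallyNoetherian C] [C.Over (Spec (.of k))] [IsProper (C ↘ Spec (.of k))]
    [∀ q : {q : C // IsClosed {q}}, IsDiscreteValuationRing (C.presheaf.stalk q.1)]
    (hC1 : SmoothOfRelativeDimension 1 (C ↘ Spec (.of k)))
    (hC : ∀ q : C, q ≠ genericPoint C → IsClosed {q})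
    (δ : Derivation k C.functionField C.functionField)
    (s : {q : C // IsClosed {q}} → C.functionField)
    (hδ : ∀ q x, closedPointValuation q x ≤ 1 →
      closedPointValuation q (δ x) ≤ closedPointValuation q (δ (s q)))
    (hs : ∀ q, δ (s q) ≠ 0) (S : Finset {q : C // IsClosed {q}})
    (hS : ∀ q ∉ S, ordOf (closedPointValuation q) (δ (s q)) = 0) :
    ∑ q ∈ S, ordOf (closedPointValuation q) (δ (s q)) ≤ 2 := by
  obtain ⟨U, hU, a, h⟩ := exists_basis_kaehlerDifferential_stalk C hC1 (genericPoint C)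
  obtain ⟨hfin, b, hb⟩ := h _ hU
  have hfin' : Algebra.EssFiniteType k C.functionField := hfin
  let t₀ : C.functionField := (C.presheaf.germ U _ hU).hom (a 0)
  have hspan : Submodule.span C.functionField {D k C.functionField t₀} = ⊤ := by
    have h1 := b.span_eq
    have h2 : Set.range b = {b 0} := by
      ext z
      simp [eq_comm]
    rw [h2, hb 0] at h1
    exact h1
  have halg := isAlgebraic_adjoin_of_span_D_eq_top hspan
  exact (isPlaceFamily_closedPointValuation hC).sum_ordOf_derivation_le_two t₀ δ s hδ hs S hS

variable {Z C : Scheme.{u}} [IsIntegral C] {i : C ⟶ Z} [IsIntegral Z] [IsLocallyNoetherian Z]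
  [IsClosedImmersion i] [Z.Over (Spec (.of k))]
  [LocallyOfFiniteType (Z ↘ Spec (.of k))]
  {ω : RationalForm k 2 Z}

omit [IsAlgClosed k] [LocallyOfFiniteType (Z ↘ Spec (.of k))] [IsLocallyNoetherian Z] in
theorem exists_isFormPairing (hZ2 : SmoothOfRelativeDimension 2 (Z ↘ Spec (.of k))) (hω : ω ≠ 0) :
    ∃ b, IsFormPairing ω b := by
  obtain ⟨U, hU, x, y, h⟩ := exists_isCoordinatePair (k := k) hZ2 (genericPoint Z)
  obtain ⟨b, h1, h2⟩ := exists_bilinear_ιMulti_eq_smul (a₁ := x) (a₂ := y)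
    (Submodule.eq_top_iff'.mpr fun z => by
      obtain ⟨α, β, rfl⟩ := (h _ hU).exists_eq_combination z
      exact Submodule.mem_span_pair.mpr ⟨α, β, rfl⟩) hω
  exact ⟨b, h1, h2⟩

theorem curveIntersection_eq_sum {Z C : Scheme.{u}} [IsIntegral C] {i : C ⟶ Z}
    [IsClosedImmersion i] {P : Z} (S : Finset {q : C // IsClosed {q}})
    (hS : ∀ q : C, localIntersection P (i (genericPoint C)) (i q) ≠ 0 → ∃ q' ∈ S, q'.1 = q) :
    curveIntersection P (i (genericPoint C)) =
      ∑ q ∈ S, localIntersection P (i (genericPoint C)) (i q.1) := by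
  classical
  rw [curveIntersection_eq_finsum, finsum_eq_sum_of_support_subset (s := S.image fun q => i q.1),
    Finset.sum_image]
  · exact fun q _ q' _ h => Subtype.ext (i.isClosedEmbedding.injective h)
  · intro p hp
    have h := (specializes_of_localIntersection_ne_zero hp).2
    have hrange : p ∈ Set.range i :=
      h.mem_closed i.isClosedEmbedding.isClosed_range ⟨_, rfl⟩
    obtain ⟨q, rfl⟩ := hrange
    obtain ⟨q', hq', rfl⟩ := hS q hp
    exact Finset.mem_coe.mpr (Finset.mem_image_of_mem _ hq')

variable [C.Over (Spec (.of k))] [i.IsOver (Spec (.of k))]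

/-- The genus of a smooth curve `C` on a surface is nonnegative, in the form `(K + C) · C ≥ -2`:
here `K + C` is replaced by the linearly equivalent divisor `div ω - (κ + 1) div f + C`, which does
not contain `C`, where `κ` and `1` are the orders of `ω` and `f` along `C`. -/
theorem neg_two_le_finsum_adjunctionCoeff [CharZero k] [NoetherianSpace Z] [NoetherianSpace C]
    [IsLocallyNoetherian C] [IsProper (C ↘ Spec (.of k))]
    (hZ : ∀ x : Z, IsIntegrallyClosed (Z.presheaf.stalk x))
    (hZ2 : SmoothOfRelativeDimension 2 (Z ↘ Spec (.of k)))
    (hC1 : SmoothOfRelativeDimension 1 (C ↘ Spec (.of k)))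
    (hω : ω ≠ 0) {f : Z.functionField} (hf : Scheme.ord f (i (genericPoint C)) = 1) :
    {P : Z | Order.coheight P = 1 ∧ adjunctionCoeff ω f (i (genericPoint C)) P ≠ 0}.Finite ∧
    -2 ≤ ∑ᶠ (P : Z) (_ : Order.coheight P = 1 ∧ P ≠ i (genericPoint C)),
      adjunctionCoeff ω f (i (genericPoint C)) P * curveIntersection P (i (genericPoint C)) := by
  classical
  obtain ⟨b, hb⟩ := exists_isFormPairing hZ2 hω
  have hC : ∀ q : C, q ≠ genericPoint C → IsClosed {q} := fun q => isClosed_of_ne_genericPoint hC1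
  have hDVR : ∀ q : {q : C // IsClosed {q}}, IsDiscreteValuationRing (C.presheaf.stalk q.1) :=
    fun q => isDiscreteValuationRing_stalk_of_isClosed hC1 q.2
  obtain ⟨q₀, -, hq₀⟩ := IsClosed.exists_closed_singleton isClosed_univ
    (⟨genericPoint C, trivial⟩ : (Set.univ : Set C).Nonempty)
  have := hDVR ⟨q₀, hq₀⟩
  have hξ : Order.coheight (i (genericPoint C)) = 1 := by
    by_contra h
    rw [Scheme.ord_eq_zero_of_coheight_neq_one h] at hf
    exact zero_ne_one hf
  have := hZ (i (genericPoint C))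
  have hDVRξ := isDiscreteValuationRing_stalk hξ
  have hf0 : f ≠ 0 := by
    rintro rfl
    rw [Scheme.ord_zero] at hf
    exact zero_ne_one hf
  obtain ⟨ϖ, rfl⟩ := (ord_nonneg_iff hξ hf0).mp (by rw [hf]; exact zero_le_one)
  obtain ⟨c, s, -, hcs⟩ := exists_isCoordinatePair_of_isClosed i hZ2 hq₀
  obtain ⟨H, δ, hδ⟩ := exists_derivation_functionField hb hω hξ
    (hcs.of_specializes (image_genericPoint_specializes i q₀)) hf
  set m := adjunctionCoeff ω (algebraMap _ Z.functionField ϖ) (i (genericPoint C)) with hm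
  have hfin : {P : Z | Order.coheight P = 1 ∧ m P ≠ 0}.Finite := by
    refine ((finite_formOrder_ne_zero hZ hZ2 hω hb).union (finite_ord_ne_zero hf0)).subset ?_
    rintro P ⟨h1, h2⟩
    by_contra h
    simp only [Set.mem_union, Set.mem_ofPred_eq, not_or, not_and, not_not] at h
    refine h2 ?_
    rw [hm, adjunctionCoeff, h.1 h1, h.2]
    simp
  refine ⟨hfin, ?_⟩
  have hloc := fun q : {q : C // IsClosed {q}} =>
    exists_ordOf_derivation_eq hZ hZ2 hb hω q.2 hξ hf H hδ
  choose s hs hsδ hord using hloc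
  have hfin' : {P : Z | (Order.coheight P = 1 ∧ P ≠ i (genericPoint C)) ∧ m P ≠ 0}.Finite :=
    hfin.subset fun P hP => ⟨hP.1.1, hP.2⟩
  set F := hfin'.toFinset with hF
  have hsum : ∀ g : Z → ℤ, (∑ᶠ (P : Z) (_ : Order.coheight P = 1 ∧ P ≠ i (genericPoint C)),
      m P * g P) = ∑ P ∈ F, m P * g P := by
    intro g
    refine finsum_mem_eq_sum_of_subset (s := {P | Order.coheight P = 1 ∧ P ≠ i (genericPoint C)})
      _ ?_ ?_
    · rintro P ⟨h1, h2⟩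
      simpa [hF] using ⟨h1, left_ne_zero_of_mul h2⟩
    · intro P hP
      simp only [hF, Set.Finite.coe_toFinset] at hP
      exact hP.1
  have hinter := fun (P : Z) (hP : P ∈ F) =>
    have hP' := hfin'.mem_toFinset.mp hP
    finite_localIntersection_ne_zero i hC hξ hP'.1.1 hP'.1.2
  have hSfin : (⋃ P ∈ F, {q : C | localIntersection P (i (genericPoint C)) (i q) ≠ 0}).Finite :=
    F.finite_toSet.biUnion fun P hP => (hinter P hP).1
  have hSfin' : {q : {q : C // IsClosed {q}} | ∃ P ∈ F,
      localIntersection P (i (genericPoint C)) (i q.1) ≠ 0}.Finite := by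
    refine Set.Finite.of_finite_image (f := Subtype.val) (hSfin.subset ?_)
      Subtype.val_injective.injOn
    rintro _ ⟨q, ⟨P, hP, hq⟩, rfl⟩
    exact Set.mem_iUnion₂.mpr ⟨P, hP, hq⟩
  set S := hSfin'.toFinset with hS
  have hord' : ∀ q : {q : C // IsClosed {q}}, ordOf (closedPointValuation q) (δ (s q)) =
      -∑ P ∈ F, m P * localIntersection P (i (genericPoint C)) (i q.1) := by
    intro q
    rw [closedPointValuation, hord q]
    simp only [neg_mul_comm]
    refine (hsum fun P => -localIntersection P (i (genericPoint C)) (i q.1)).trans ?_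
    simp
  have hcurve := sum_ordOf_derivation_le_two_of_isProper hC1 hC δ s hsδ hs S fun q hq => by
    rw [hord', Finset.sum_eq_zero, neg_zero]
    intro P hP
    by_contra h
    exact hq (hSfin'.mem_toFinset.mpr ⟨P, hP, right_ne_zero_of_mul h⟩)
  rw [hsum]
  have hswap : ∑ P ∈ F, m P * curveIntersection P (i (genericPoint C)) =
      -∑ q ∈ S, ordOf (closedPointValuation q) (δ (s q)) := by
    rw [← Finset.sum_neg_distrib]
    simp only [hord', neg_neg]
    rw [Finset.sum_comm]
    refine Finset.sum_congr rfl fun P hP => ?_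
    rw [← Finset.mul_sum, curveIntersection_eq_sum S]
    intro q hq
    exact ⟨⟨q, (hinter P hP).2 q hq⟩, hSfin'.mem_toFinset.mpr ⟨P, hP, hq⟩, rfl⟩
  omega

end adjunction

/-! ### Projective schemes are proper -/

section projective

attribute [local instance] MvPolynomial.gradedAlgebra

theorem algebraMap_homogeneousSubmodule_zero_bijective (k : Type u) [Field k] (n : ℕ) :
    Function.Bijective (algebraMap k (MvPolynomial.homogeneousSubmodule (Fin (n + 1)) k 0)) := by
  refine ⟨fun a b h => MvPolynomial.C_injective _ _ (congrArg Subtype.val h), fun ⟨p, hp⟩ => ?_⟩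
  have hp' := hp
  rw [MvPolynomial.homogeneousSubmodule_zero] at hp'
  obtain ⟨c, hc⟩ := Submodule.mem_one.mp hp'
  exact ⟨c, Subtype.ext hc⟩

theorem IsProjective.isProper {k : Type u} [Field k] {V : Scheme.{u}} {s : V ⟶ Spec (.of k)}
    (h : IsProjective s) : IsProper s := by
  obtain ⟨n, j, hj, rfl⟩ := h
  let 𝒜 := MvPolynomial.homogeneousSubmodule (Fin (n + 1)) k
  have h1 : IsIso (CommRingCat.ofHom (algebraMap k (𝒜 0))) :=
    (ConcreteCategory.isIso_iff_bijective _).mpr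
      (algebraMap_homogeneousSubmodule_zero_bijective k n)
  have h2 : Algebra.FiniteType (𝒜 0) (MvPolynomial (Fin (n + 1)) k) :=
    have : IsScalarTower k (𝒜 0) (MvPolynomial (Fin (n + 1)) k) :=
      IsScalarTower.of_algebraMap_eq (R := k) (S := 𝒜 0) (A := MvPolynomial (Fin (n + 1)) k)
        fun _ => rfl
    Algebra.FiniteType.of_restrictScalars_finiteType k _ _
  have h3 : IsProper (Proj.toSpecZero 𝒜) := inferInstance
  infer_instance

end projective

/-! ### The coefficients of an `ε`-lc pair -/

section coefficient

variable {V : Scheme.{u}} [IsIntegral V]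

theorem pullbackFun_id : pullbackFun (𝟙 V) = RingHom.id V.functionField := by
  ext x
  have h := V.presheaf.stalkSpecializes_refl (genericPoint V)
  rw [pullbackFun, Scheme.Hom.stalkMap_id]
  exact congr($(h).hom x)

/-- The identity is a resolution of a smooth variety, so the coefficients of the boundary of an
`ε`-lc pair on it are at most `1 - ε`. -/
theorem IsEpsilonLc.apply_le {k : Type u} [Field k] {n : ℕ} [IsLocallyNoetherian V]
    [V.Over (Spec (.of k))] (hV : Smooth (V ↘ Spec (.of k))) {B : AlgebraicCycle V ℝ} {ε : ℝ}
    (h : IsEpsilonLc k n V B ε) {ω : RationalForm k n V} (hω : ω ≠ 0) {P : V}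
    (hP : Order.coheight P = 1) : B P ≤ 1 - ε := by
  obtain ⟨m, r, f, hf⟩ := h.rCartier ω hω P
  have hres : IsResolution k (𝟙 V) :=
    ⟨inferInstance, by rwa [Category.id_comp], by rw [pullbackFun_id]; exact Function.bijective_id⟩
  have h1 := h.coeff_le V (𝟙 V) hres ω hω P hP m r f hf
  have h2 := hf.2 P hP specializes_rfl
  simp only [pullbackFun_id, RingHom.id_apply] at h1
  have h3 : canonicalDivisor ω P = (formOrder k (fun g : V.functionField => Scheme.ord g P) ω : ℝ) :=
    rfl
  rw [← h2] at h1
  beta_reduce at h1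
  rw [h3] at h1
  linarith

end coefficient

/-! ### The bound on the self-intersection number -/

section selfIntersection

open TopologicalSpace

theorem finsum_mem_eq_sum_filter {α M : Type*} [AddCommMonoid M] (p : α → Prop) [DecidablePred p]
    (F : Finset α) {g : α → M} (hg : ∀ x, p x → x ∉ F → g x = 0) :
    ∑ᶠ (x : α) (_ : p x), g x = ∑ x ∈ F with p x, g x := by
  refine finsum_mem_eq_sum_of_subset (s := {x | p x}) g ?_ ?_
  · rintro x ⟨h1, h2⟩
    by_contra h
    exact h2 (hg x h1 fun hx => h (Finset.mem_coe.mpr (Finset.mem_filter.mpr ⟨hx, h1⟩)))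
  · exact fun x hx => (Finset.mem_filter.mp hx).2

variable {k : Type u} [Field k] [IsAlgClosed k] [CharZero k] {Z : Scheme.{u}} [IsIntegral Z]
  [IsLocallyNoetherian Z] [Z.Over (Spec (.of k))] {B : AlgebraicCycle Z ℝ}
  {ω : RationalForm k 2 Z} {C : Scheme.{u}} [IsIntegral C] (i : C ⟶ Z) [IsClosedImmersion i]

/-- The inequality `-2 ≤ (K + C) · C + (B - b C) · C`, where `b` is the multiplicity of the curve
`C` in `B`: the adjunction inequality, as the other components of `B` meet `C` nonnegatively. -/
theorem neg_two_le_intersectionNumber_add [IsProper (Z ↘ Spec (.of k))]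
    (hZ2 : SmoothOfRelativeDimension 2 (Z ↘ Spec (.of k)))
    (hZ : ∀ x : Z, IsIntegrallyClosed (Z.presheaf.stalk x)) (hB : ∀ P, 0 ≤ B P) (hω : ω ≠ 0)
    (hC : SmoothOfRelativeDimension 1 (i ≫ Z ↘ Spec (.of k)))
    (hf : ∃ f : Z.functionField, Scheme.ord f (i (genericPoint C)) = 1) :
    -2 ≤ intersectionNumber (fun P => canonicalDivisor ω P + B P) (i (genericPoint C)) +
      (1 - B (i (genericPoint C))) * selfIntersection (i (genericPoint C)) := by
  classical
  let : C.Over (Spec (.of k)) := ⟨i ≫ Z ↘ Spec (.of k)⟩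
  have : i.IsOver (Spec (.of k)) := ⟨rfl⟩
  have hCprop : IsProper (i ≫ Z ↘ Spec (.of k)) := inferInstance
  have : IsProper (C ↘ Spec (.of k)) := hCprop
  have : CompactSpace Z := QuasiCompact.compactSpace_of_compactSpace (Z ↘ Spec (.of k))
  have : IsNoetherian Z := {}
  have : IsLocallyNoetherian C := LocallyOfFiniteType.isLocallyNoetherian i
  have : TopologicalSpace.NoetherianSpace C := i.isClosedEmbedding.isInducing.noetherianSpace
  obtain ⟨b, hb⟩ := exists_isFormPairing hZ2 hω
  rw [selfIntersection, intersectionNumber, dif_pos hf, intersectionNumber, dif_pos hf]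
  set f := hf.choose
  have hf1 : Scheme.ord f (i (genericPoint C)) = 1 := hf.choose_spec
  have hf0 : f ≠ 0 := by
    intro h
    rw [h, Scheme.ord_zero] at hf1
    exact zero_ne_one hf1
  have hadj := (neg_two_le_finsum_adjunctionCoeff hZ hZ2 hC hω hf1).2
  set ξ := i (genericPoint C) with hξ
  have hfin := ((finite_formOrder_ne_zero hZ hZ2 hω hb).union (finite_ord_ne_zero hf0)).union
    (finite_algebraicCycle_ne_zero B)
  set F := hfin.toFinset with hF
  have hF' : ∀ P, Order.coheight P = 1 → P ∉ F →
      formOrder k (fun g : Z.functionField => Scheme.ord g P) ω = 0 ∧ Scheme.ord f P = 0 ∧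
        B P = 0 := by
    intro P h1 h2
    simp only [hF, Set.Finite.mem_toFinset, Set.mem_union, Set.mem_ofPred_eq, not_or, not_and,
      not_not] at h2
    exact ⟨h2.1.1 h1, h2.1.2, h2.2⟩
  have hcan : ∀ P, canonicalDivisor ω P =
      (formOrder k (fun g : Z.functionField => Scheme.ord g P) ω : ℝ) := fun P => rfl
  rw [finsum_mem_eq_sum_filter _ F fun P h1 h2 => by
    obtain ⟨h3, h4, h5⟩ := hF' P h1.1 h2
    simp [adjunctionCoeff, h3, h4]] at hadj
  rw [finsum_mem_eq_sum_filter _ F fun P h1 h2 => by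
      obtain ⟨h3, h4, h5⟩ := hF' P h1.1 h2
      simp [hcan, h3, h4, h5],
    finsum_mem_eq_sum_filter _ F fun P h1 h2 => by
      obtain ⟨h3, h4, h5⟩ := hF' P h1.1 h2
      simp [h4, h1.2]]
  have hadj' : (-2 : ℝ) ≤ ∑ P ∈ F with Order.coheight P = 1 ∧ P ≠ ξ,
      (adjunctionCoeff ω f ξ P : ℝ) * (curveIntersection P ξ : ℝ) := by
    exact_mod_cast hadj
  refine hadj'.trans ?_
  rw [Finset.mul_sum, ← Finset.sum_add_distrib]
  refine Finset.sum_le_sum fun P hP => ?_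
  have hPξ := (Finset.mem_filter.mp hP).2.2
  have hI : (0 : ℝ) ≤ curveIntersection P ξ := by
    have : 0 ≤ curveIntersection P ξ := finsum_nonneg fun p => localIntersection_nonneg P ξ p
    exact_mod_cast this
  have hBI := mul_nonneg (hB P) hI
  rw [if_neg hPξ, if_pos rfl, adjunctionCoeff, hcan, hcan]
  push_cast
  linarith

theorem neg_two_div_le_selfIntersection [IsProper (Z ↘ Spec (.of k))]
    (hZ2 : SmoothOfRelativeDimension 2 (Z ↘ Spec (.of k))) (hω : ω ≠ 0)
    (hnum : IsNumericallyTrivial (fun P => canonicalDivisor ω P + B P))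
    (hC : SmoothOfRelativeDimension 1 (i ≫ Z ↘ Spec (.of k))) {ε : ℝ} (hε : 0 < ε)
    (h : IsEpsilonLc k 2 Z B ε) : -2 / ε ≤ selfIntersection (i (genericPoint C)) := by
  have hneg : -2 / ε ≤ 0 := div_nonpos_of_nonpos_of_nonneg (by norm_num) hε.le
  by_cases hf : ∃ f : Z.functionField, Scheme.ord f (i (genericPoint C)) = 1
  · have hξ : Order.coheight (i (genericPoint C)) = 1 := by
      obtain ⟨f, hf⟩ := hf
      by_contra h
      rw [Scheme.ord_eq_zero_of_coheight_neq_one h] at hf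
      exact zero_ne_one hf
    have h1 := neg_two_le_intersectionNumber_add i hZ2 h.normal h.effective hω hC hf
    rw [hnum _ hξ, zero_add] at h1
    have h2 := h.apply_le hZ2.smooth hω hξ
    by_contra! hlt
    rw [lt_div_iff₀ hε] at hlt
    have h3 : selfIntersection (i (genericPoint C)) < 0 := by nlinarith
    nlinarith
  · -- This case does not occur, as `C` has a local equation; the bound holds for the default value.
    rwa [selfIntersection, intersectionNumber, dif_neg hf]

end selfIntersection

end LcSurface

theorem mainTheorem4 {k : Type u} [Field k] [IsAlgClosed k] [CharZero k]
    (Z : Scheme.{u}) [IsIntegral Z] [IsLocallyNoetherian Z] [Z.Over (Spec (.of k))]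
    (hproj : LcSurface.IsProjective (Z ↘ Spec (.of k)))
    (hsmooth : SmoothOfRelativeDimension 2 (Z ↘ Spec (.of k)))
    (B : AlgebraicCycle Z ℝ)
    (ω : LcSurface.RationalForm k 2 Z) (hω : ω ≠ 0)
    (hnum : LcSurface.IsNumericallyTrivial (fun P => LcSurface.canonicalDivisor ω P + B P))
    (C : Scheme.{u}) [IsIntegral C] (i : C ⟶ Z) [IsClosedImmersion i]
    (hC : SmoothOfRelativeDimension 1 (i ≫ Z ↘ Spec (.of k))) :
    (∀ ε : ℝ, 0 < ε → LcSurface.IsEpsilonLc k 2 Z B ε →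
      -2 / ε ≤ LcSurface.selfIntersection (i (genericPoint C))) ∧
    (LcSurface.IsEpsilonLc k 2 Z B (1 / 6) →
      -12 ≤ LcSurface.selfIntersection (i (genericPoint C))) := by
  have := hproj.isProper
  have key : ∀ ε : ℝ, 0 < ε → LcSurface.IsEpsilonLc k 2 Z B ε →
      -2 / ε ≤ LcSurface.selfIntersection (i (genericPoint C)) := fun ε hε h =>
    LcSurface.neg_two_div_le_selfIntersection i hsmooth hω hnum hC hε h
  refine ⟨key, fun h => ?_⟩
  have h6 := key (1 / 6) (by norm_num) h
  norm_num at h6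
  exact h6
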